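/- **Calculus.** Fix a many-sorted algebra of first-order data with inhabited sorts, containing the sort $\mathsf{bool}$ with values true and false. Expressions $e$ are built from names, data constants and the operations of the algebra; names $a,x,\dots$ are service channels or data variables; a value $v$ is a name or a constant; $e\Downarrow v$ is evaluation (values evaluate to themselves, operations are applied to constants). Let $k,k',\dots$ range over session channels. Processes are $$P ::= 0 \mid P|Q \mid (\nu k)P \mid\ !a(k).P \mid a(k).P \mid \bar a(k).P \mid k?(x).P \mid k!\langle e\rangle.P \mid k?((k')).P \mid k!\langle\langle k'\rangle\rangle.P \mid k\triangleright\{l_i:P_i\}_{i\in I} \mid k\triangleleft l.P \mid \mathsf{if}\ e\ \mathsf{then}\ P\ \mathsf{else}\ Q$$ (inaction, parallel, session restriction, replicated service, service, request, input, output, session reception, delegation, branching with $I$ finite and nonempty and distinct labels, selection, conditional); $k$ is bound in $(\nu k)P$, $!a(k).P$, $a(k).P$ and $\bar a(k).P$, $x$ in $k?(x).P$, and $k'$ in $k?((k')).P$. All forms except $0$, $P|Q$, $(\nu k)P$ are called prefixes $\gamma$. $\mathrm{fsc}(P)$ is the set of free session channels. Structural congruence $\equiv$ is the least congruence containing $\alpha$-equivalence,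 commutativity and associativity of $|$, $P|0\equiv P$, $P|(\nu k)Q\equiv(\nu k)(P|Q)$ for $k\notin\mathrm{fsc}(P)$, and $(\nu k)0\equiv0$. Reduction $\to$ is generated by - $!a(k).P\,|\,\bar a(k).Q\to\ !a(k).P\,|\,(\nu k)(P|Q)$ and $a(k).P\,|\,\bar a(k).Q\to(\nu k)(P|Q)$; - $k?(x).P\,|\,k!\langle e\rangle.Q\to P[v/x]\,|\,Q$ if $e\Downarrow v$; - $k?((k')).P\,|\,k!\langle\langle k'\rangle\rangle.Q\to P|Q$; - $k\triangleright\{l_i:P_i\}_{i\in I}\,|\,k\triangleleft l_j.Q\to P_j|Q$ for $j\in I$; - $\mathsf{if}\ e\ \mathsf{then}\ P\ \mathsf{else}\ Q\to P$ if $e\Downarrow\mathrm{true}$, and $\to Q$ if $e\Downarrow\mathrm{false}$; and closed under $\,\cdot\,|Q$, $(\nu k)\,\cdot\,$ and $\equiv$. **Types.** Session types are $\alpha::=\ ?\theta.\alpha\mid\ !\theta.\alpha\mid\&\{l_i:\alpha_i\}_{i\in I}\mid\oplus\{l_i:\alpha_i\}_{i\in I}\mid\mathsf{end}$ with $I$ finite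 and nonempty and distinct labels, $\theta::=S\mid\alpha$, and $S::=b\mid\langle\alpha\rangle$ with $b$ a sort of the algebra. The dual $\bar\alpha$ exchanges $?$ with $!$ and $\&$ with $\oplus$, leaves payloads $\theta$ unchanged and continues into the continuations. $\Gamma$ is a partial map from names to types $S$, and $\Delta$ a partial map from session channels to session types or $\bot$; $\Delta\cdot k:u$ presupposes $k\notin\mathrm{dom}(\Delta)$. $\Gamma\vdash e:S$ is the evident typing of expressions. The judgement $\Gamma\vdash P\triangleright\Delta$ is generated by: - if $\Gamma(a)=\langle\alpha\rangle$, $\Gamma\vdash P\triangleright k:\alpha$, and every channel of $\Delta$ has type $\mathsf{end}$, then $\Gamma\vdash a(k).P\triangleright\Delta$ and $\Gamma\vdash\ !a(k).P\triangleright\Delta$; - if $\Gamma(a)=\langle\alpha\rangle$ and $\Gamma\vdash P\triangleright\Delta\cdot k:\bar\alpha$, then $\Gamma\vdash\bar a(k).P\triangleright\Delta$; - if $\Gamma,x:S\vdash P\triangleright\Delta\cdot k:\alpha$, then $\Gamma\vdash k?(x).P\triangleright\Delta\cdot k:\,?S.\alpha$; if $\Gamma\vdash P\triangleright\Delta\cdot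 k:\alpha$ and $\Gamma\vdash e:S$, then $\Gamma\vdash k!\langle e\rangle.P\triangleright\Delta\cdot k:\,!S.\alpha$; - if $\Gamma\vdash P\triangleright\Delta\cdot k:\alpha\cdot k':\beta$, then $\Gamma\vdash k?((k')).P\triangleright\Delta\cdot k:\,?\beta.\alpha$; if $\Gamma\vdash P\triangleright\Delta\cdot k:\alpha$, then $\Gamma\vdash k!\langle\langle k'\rangle\rangle.P\triangleright\Delta\cdot k:\,!\beta.\alpha\cdot k':\beta$; - if $\Gamma\vdash P_i\triangleright\Delta\cdot k:\alpha_i$ for all $i\in I$, then $\Gamma\vdash k\triangleright\{l_i:P_i\}_{i\in I}\triangleright\Delta\cdot k:\&\{l_i:\alpha_i\}_{i\in I}$; if $\Gamma\vdash P\triangleright\Delta\cdot k:\alpha_j$ and $j\in I$, then $\Gamma\vdash k\triangleleft l_j.P\triangleright\Delta\cdot k:\oplus\{l_i:\alpha_i\}_{i\in I}$; - if $\Gamma\vdash P_i\triangleright\Delta_i$ for $i=1,2$ and $\Delta_1(k)=\overline{\Delta_2(k)}$ (both session types) for all common $k$, then $\Gamma\vdash P_1|P_2\triangleright\Delta_1\odot\Delta_2$,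 where $\Delta_1\odot\Delta_2$ is the union with $\bot$ assigned to the common channels; - $\Gamma\vdash0\triangleright\Delta$ if every channel of $\Delta$ has type $\mathsf{end}$; if $\Gamma\vdash P\triangleright\Delta\cdot k:\bot$, then $\Gamma\vdash(\nu k)P\triangleright\Delta$; if $\Gamma\vdash e:\mathsf{bool}$ and $\Gamma\vdash P_i\triangleright\Delta$ for $i=1,2$, then $\Gamma\vdash\mathsf{if}\ e\ \mathsf{then}\ P_1\ \mathsf{else}\ P_2\triangleright\Delta$; if $\Gamma\vdash P\triangleright\Delta\cdot k:\mathsf{end}$, then $\Gamma\vdash P\triangleright\Delta\cdot k:\bot$. $P$ is *well-typed* if $\Gamma\vdash P\triangleright\Delta$ for some $\Delta$ and some $\Gamma$ all of whose entries are service types $\langle\alpha\rangle$ (so $P$ has no free data variables). **Transparency.** The session dependency graph of $P$ is the multigraph with node labels defined as follows: $0$ has no nodes; a prefix $\gamma$ has one node, labelled $\mathrm{fsc}(\gamma)$, and no edges; $(\nu k)P$ has the graph of $P$ with $k$ removed from all labels; $P|Q$ has the disjoint union of the graphs of $P$ and $Q$ plus one edge between $p$ and $q$ for each node $p$ of $P$,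 node $q$ of $Q$ and channel $k$ labelling both. A *sub-process* of $P$ is a sub-term of some $P'\equiv P$. $P$ is *transparent* if every sub-process of $P$ has an acyclic session dependency graph (two parallel edges form a cycle). **Progress.** A process *contains live channels* unless all its session channels are bound by services or replicated services; channels bound by requests or session receptions count as channels of the process, and a restriction $(\nu k)$ whose channel does not occur is disregarded. Reduction contexts are $E::=[\cdot]\mid E|P\mid(\nu k)E$. *Progress* is the largest predicate such that $P$ has progress iff, whenever $P\to^*P'$, $P'\equiv E[P'']$ for a reduction context $E$, and $P''$ contains live channels, there are $Q$ and $R$ with $Q\not\to$, $P''|Q$ well-typed, $P''|Q\to R$, and $R$ has progress. **Theorem.** Every well-typed and transparent process has progress. -/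

import Mathlib

/-!
A pi-calculus with sessions, its session type system, session dependency graphs, transparency
and progress.

Binding is represented with de Bruijn indices, so that alpha-equivalent processes are equal.
There are two independent kinds of indices: one for service channels and data variables
(a single syntactic class), one for session channels.
-/

namespace Sessions

/-- `cons x f` is the sequence `x, f 0, f 1, …` : what a binder does to an environment. -/
def cons {A : Type*} (x : A) (f : ℕ → A) : ℕ → A
  | 0 => x
  | n + 1 => f n

/-- Values of basic types: `none` is the type `bool`, `some s` is the sort `s` with values `V s`. -/
abbrev OptVal {S : Type} (V : S → Type) : Option S → Type
  | none => Bool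
  | some s => V s

/-- The first-order data that expressions are about: an arbitrary many-sorted algebra with inhabited
carriers. The sort of booleans is added to its sorts below. -/
structure DataAlgebra where
  /-- sorts other than the booleans -/
  DSort : Type
  /-- values of each of these sorts -/
  DVal : DSort → Type
  /-- every sort is inhabited -/
  inhabited : ∀ s, Nonempty (DVal s)
  /-- operation symbols -/
  Op : Type
  /-- number of arguments -/
  arity : Op → ℕ
  /-- sorts of the arguments (`none` is the sort of booleans) -/
  dom : (o : Op) → Fin (arity o) → Option DSort
  /-- sort of the result (`none` is the sort of booleans) -/
  cod : Op → Option DSort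
  /-- the function that the symbol denotes -/
  interp : (o : Op) →
    ((i : Fin (arity o)) → OptVal DVal (dom o i)) → OptVal DVal (cod o)

/-- Basic types: `none` is `bool`, `some s` is any other sort of the data algebra. -/
abbrev Basic (D : DataAlgebra) : Type := Option D.DSort

/-- The values of a basic type. -/
abbrev Carrier (D : DataAlgebra) (b : Basic D) : Type := OptVal D.DVal b

variable {D : DataAlgebra}

/-! ### Expressions -/

/-- Values: service channels (or variables), and data constants. -/
inductive Val (D : DataAlgebra) : Type
  | name (a : ℕ)
  | const (b : Basic D) (c : Carrier D b)

/-- First-order expressions. -/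
inductive Expr (D : DataAlgebra) : Type
  | val (v : Val D)
  | op (o : D.Op) (args : Fin (D.arity o) → Expr D)

/-- Evaluation `e ⇓ v`. -/
inductive Eval : Expr D → Val D → Prop
  | val (v : Val D) : Eval (.val v) v
  | op (o : D.Op) (args : Fin (D.arity o) → Expr D)
      (c : (i : Fin (D.arity o)) → Carrier D (D.dom o i)) :
      (∀ i, Eval (args i) (.const (D.dom o i) (c i))) →
      Eval (.op o args) (.const (D.cod o) (D.interp o c))

/-- Simultaneous substitution of values for names in a value. -/
def Val.subst (σ : ℕ → Val D) : Val D → Val D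
  | .name a => σ a
  | .const b c => .const b c

/-- Simultaneous substitution of values for names in an expression. -/
def Expr.subst (σ : ℕ → Val D) : Expr D → Expr D
  | .val v => .val (v.subst σ)
  | .op o args => .op o (fun i => (args i).subst σ)

/-- A substitution moved under a binder for a name. -/
def liftSubst (σ : ℕ → Val D) : ℕ → Val D :=
  cons (.name 0) (fun n => (σ n).subst (fun m => .name (m + 1)))

/-- A renaming moved under a binder. -/
def liftRen (ρ : ℕ → ℕ) : ℕ → ℕ := cons 0 (fun n => ρ n + 1)

/-! ### Processes -/

/-- Processes. Session channels are indices `k : ℕ`; labels are natural numbers. The subject of a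
service or of a request is a `Val` only so that substitution is a total function: a service or a
request whose subject is a data constant is never well-typed. -/
inductive Proc (D : DataAlgebra) : Type
  /-- `0` -/
  | nil
  /-- `P | Q` -/
  | par (P Q : Proc D)
  /-- `(ν k) P`, binds a session channel -/
  | res (P : Proc D)
  /-- replicated service `! a(k). P`, binds a session channel -/
  | repServ (a : Val D) (P : Proc D)
  /-- service `a(k). P`, binds a session channel -/
  | serv (a : Val D) (P : Proc D)
  /-- invocation of the service `a`, binds a session channel in `P` -/
  | request (a : Val D) (P : Proc D)
  /-- `k?(x). P`, binds a name -/
  | input (k : ℕ) (P : Proc D)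
  /-- `k!⟨e⟩. P` -/
  | output (k : ℕ) (e : Expr D) (P : Proc D)
  /-- `k?((k')). P`, reception of a session channel, binds a session channel -/
  | inputS (k : ℕ) (P : Proc D)
  /-- `k!⟨⟨k'⟩⟩. P`, delegation of the session channel `k'` -/
  | deleg (k k' : ℕ) (P : Proc D)
  /-- `k ▷ {l : P l}` for `l` in the nonempty finite set `I` of labels -/
  | branch (k : ℕ) (I : Finset ℕ) (hI : I.Nonempty) (P : {l : ℕ // l ∈ I} → Proc D)
  /-- `k ◁ l. P` -/
  | select (k : ℕ) (l : ℕ) (P : Proc D)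
  /-- `if e then P else Q` -/
  | ifte (e : Expr D) (P Q : Proc D)

namespace Proc

/-- Renaming of session channels. -/
def renS : (ℕ → ℕ) → Proc D → Proc D
  | _, nil => nil
  | ρ, par P Q => par (P.renS ρ) (Q.renS ρ)
  | ρ, res P => res (P.renS (liftRen ρ))
  | ρ, repServ a P => repServ a (P.renS (liftRen ρ))
  | ρ, serv a P => serv a (P.renS (liftRen ρ))
  | ρ, request a P => request a (P.renS (liftRen ρ))
  | ρ, input k P => input (ρ k) (P.renS ρ)
  | ρ, output k e P => output (ρ k) e (P.renS ρ)
  | ρ, inputS k P => inputS (ρ k) (P.renS (liftRen ρ))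
  | ρ, deleg k k' P => deleg (ρ k) (ρ k') (P.renS ρ)
  | ρ, branch k I hI P => branch (ρ k) I hI (fun l => (P l).renS ρ)
  | ρ, select k l P => select (ρ k) l (P.renS ρ)
  | ρ, ifte e P Q => ifte e (P.renS ρ) (Q.renS ρ)

/-- Simultaneous substitution of values for names. -/
def subst : (ℕ → Val D) → Proc D → Proc D
  | _, nil => nil
  | σ, par P Q => par (P.subst σ) (Q.subst σ)
  | σ, res P => res (P.subst σ)
  | σ, repServ a P => repServ (a.subst σ) (P.subst σ)
  | σ, serv a P => serv (a.subst σ) (P.subst σ)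
  | σ, request a P => request (a.subst σ) (P.subst σ)
  | σ, input k P => input k (P.subst (liftSubst σ))
  | σ, output k e P => output k (e.subst σ) (P.subst σ)
  | σ, inputS k P => inputS k (P.subst σ)
  | σ, deleg k k' P => deleg k k' (P.subst σ)
  | σ, branch k I hI P => branch k I hI (fun l => (P l).subst σ)
  | σ, select k l P => select k l (P.subst σ)
  | σ, ifte e P Q => ifte (e.subst σ) (P.subst σ) (Q.subst σ)

/-- `P[v/x]`, where `x` is the name with index `0` in `P`. -/
def inst (v : Val D) (P : Proc D) : Proc D := P.subst (cons v .name)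

/-- The free session channels. -/
def fsc : Proc D → Set ℕ
  | nil => ∅
  | par P Q => P.fsc ∪ Q.fsc
  | res P => {k | k + 1 ∈ P.fsc}
  | repServ _ P => {k | k + 1 ∈ P.fsc}
  | serv _ P => {k | k + 1 ∈ P.fsc}
  | request _ P => {k | k + 1 ∈ P.fsc}
  | input k P => {k} ∪ P.fsc
  | output k _ P => {k} ∪ P.fsc
  | inputS k P => {k} ∪ {j | j + 1 ∈ P.fsc}
  | deleg k k' P => {k, k'} ∪ P.fsc
  | branch k _ _ P => {k} ∪ ⋃ l, (P l).fsc
  | select k _ P => {k} ∪ P.fsc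
  | ifte _ P Q => P.fsc ∪ Q.fsc

end Proc

open Proc

/-! ### Structural congruence, reduction, sub-processes -/

/-- Structural congruence: the least congruence with the listed laws (alpha-equivalence is equality
here). In `extrude` the channel with index `0` is not free in the weakened copy of `P`. -/
inductive Congr : Proc D → Proc D → Prop
  | refl (P) : Congr P P
  | symm {P Q} : Congr P Q → Congr Q P
  | trans {P Q R} : Congr P Q → Congr Q R → Congr P R
  | par_comm (P Q) : Congr (par P Q) (par Q P)
  | par_assoc (P Q R) : Congr (par P (par Q R)) (par (par P Q) R)
  | par_nil (P) : Congr (par P nil) P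
  | extrude (P Q) : Congr (par P (res Q)) (res (par (P.renS Nat.succ) Q))
  | res_nil : Congr (res nil) nil
  | par {P P' Q Q'} : Congr P P' → Congr Q Q' → Congr (par P Q) (par P' Q')
  | res {P P'} : Congr P P' → Congr (res P) (res P')
  | repServ (a) {P P'} : Congr P P' → Congr (repServ a P) (repServ a P')
  | serv (a) {P P'} : Congr P P' → Congr (serv a P) (serv a P')
  | request (a) {P P'} : Congr P P' → Congr (request a P) (request a P')
  | input (k) {P P'} : Congr P P' → Congr (input k P) (input k P')
  | output (k e) {P P'} : Congr P P' → Congr (output k e P) (output k e P')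
  | inputS (k) {P P'} : Congr P P' → Congr (inputS k P) (inputS k P')
  | deleg (k k') {P P'} : Congr P P' → Congr (deleg k k' P) (deleg k k' P')
  | branch (k I hI) {P P'} : (∀ l, Congr (P l) (P' l)) →
      Congr (branch k I hI P) (branch k I hI P')
  | select (k l) {P P'} : Congr P P' → Congr (select k l P) (select k l P')
  | ifte (e) {P P' Q Q'} : Congr P P' → Congr Q Q' → Congr (ifte e P Q) (ifte e P' Q')

/-- Reduction. In `del` the receiver guesses the delegated channel: its bound channel must be
alpha-convertible to `k'`, which is the case exactly if `k'` is not already free in its body. -/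
inductive Red : Proc D → Proc D → Prop
  | rinit (a P Q) :
      Red (par (repServ a P) (request a Q)) (par (repServ a P) (res (par P Q)))
  | init (a P Q) : Red (par (serv a P) (request a Q)) (res (par P Q))
  | com (k P e v Q) : Eval e v → Red (par (input k P) (output k e Q)) (par (P.inst v) Q)
  | del (k k' P Q) : k' + 1 ∉ P.fsc →
      Red (par (inputS k P) (deleg k k' Q)) (par (P.renS (cons k' id)) Q)
  | sel (k I hI P) (j : {l : ℕ // l ∈ I}) (Q) :
      Red (par (branch k I hI P) (select k j Q)) (par (P j) Q)
  | par {P P'} (Q) : Red P P' → Red (par P Q) (par P' Q)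
  | res {P P'} : Red P P' → Red (res P) (res P')
  | str {P Q Q' P'} : Congr P Q → Red Q Q' → Congr Q' P' → Red P P'
  | ifT (e P Q) : Eval e (.const none true) → Red (ifte e P Q) P
  | ifF (e P Q) : Eval e (.const none false) → Red (ifte e P Q) Q

/-- `Subterm Q P` : `Q` is a (not necessarily proper) sub-term of `P`. -/
inductive Subterm : Proc D → Proc D → Prop
  | refl (P) : Subterm P P
  | par_left {R P Q} : Subterm R P → Subterm R (par P Q)
  | par_right {R P Q} : Subterm R Q → Subterm R (par P Q)
  | res {R P} : Subterm R P → Subterm R (res P)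
  | repServ {R a P} : Subterm R P → Subterm R (repServ a P)
  | serv {R a P} : Subterm R P → Subterm R (serv a P)
  | request {R a P} : Subterm R P → Subterm R (request a P)
  | input {R k P} : Subterm R P → Subterm R (input k P)
  | output {R k e P} : Subterm R P → Subterm R (output k e P)
  | inputS {R k P} : Subterm R P → Subterm R (inputS k P)
  | deleg {R k k' P} : Subterm R P → Subterm R (deleg k k' P)
  | branch {R k I hI P} (l) : Subterm R (P l) → Subterm R (branch k I hI P)
  | select {R k l P} : Subterm R P → Subterm R (select k l P)
  | ifte_left {R e P Q} : Subterm R P → Subterm R (ifte e P Q)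
  | ifte_right {R e P Q} : Subterm R Q → Subterm R (ifte e P Q)

/-- `Q` is a sub-process of `P` iff it is a sub-term of some `P' ≡ P`. -/
def SubProcess (Q P : Proc D) : Prop := ∃ P', Congr P' P ∧ Subterm Q P'

/-! ### Session types and typing -/

/-- Session types. The payload of an input or output is a basic type (`inpB`, `outB`), a service
channel `⟨β⟩` (`inpC`, `outC`) or a session channel of type `β` (`inpS`, `outS`). Branching and
selection are indexed by a nonempty finite set of labels. -/
inductive SType (D : DataAlgebra) : Type
  | inpB (b : Basic D) (α : SType D)
  | inpC (β α : SType D)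
  | inpS (β α : SType D)
  | outB (b : Basic D) (α : SType D)
  | outC (β α : SType D)
  | outS (β α : SType D)
  | bra (I : Finset ℕ) (hI : I.Nonempty) (α : {l : ℕ // l ∈ I} → SType D)
  | sel (I : Finset ℕ) (hI : I.Nonempty) (α : {l : ℕ // l ∈ I} → SType D)
  | fin

/-- The dual session type; payloads are not dualised. -/
def SType.dual : SType D → SType D
  | .inpB b α => .outB b α.dual
  | .inpC β α => .outC β α.dual
  | .inpS β α => .outS β α.dual
  | .outB b α => .inpB b α.dual
  | .outC β α => .inpC β α.dual
  | .outS β α => .inpS β α.dual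
  | .bra I hI α => .sel I hI (fun l => (α l).dual)
  | .sel I hI α => .bra I hI (fun l => (α l).dual)
  | .fin => .fin

/-- The types `S` of names and expressions: basic types and service channel types `⟨α⟩`. -/
inductive Srt (D : DataAlgebra) : Type
  | basic (b : Basic D)
  | chan (α : SType D)

/-- The session type `?S. α`. -/
def Srt.inp : Srt D → SType D → SType D
  | .basic b, α => .inpB b α
  | .chan β, α => .inpC β α

/-- The session type `!S. α`. -/
def Srt.out : Srt D → SType D → SType D
  | .basic b, α => .outB b α
  | .chan β, α => .outC β α

/-- What a session typing assigns to a session channel: a session type or `⊥`. -/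
inductive Use (D : DataAlgebra) : Type
  | ty (α : SType D)
  | bot

/-- Service typings. -/
abbrev ServEnv (D : DataAlgebra) : Type := ℕ → Option (Srt D)

/-- Session typings. -/
abbrev SessEnv (D : DataAlgebra) : Type := ℕ → Option (Use D)

/-- `Γ ⊢ v : S` for values. -/
inductive ValTyped (Γ : ServEnv D) : Val D → Srt D → Prop
  | name {a S} : Γ a = some S → ValTyped Γ (.name a) S
  | const (b c) : ValTyped Γ (.const b c) (.basic b)

/-- `Γ ⊢ e : S` for expressions. -/
inductive ExprTyped (Γ : ServEnv D) : Expr D → Srt D → Prop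
  | val {v S} : ValTyped Γ v S → ExprTyped Γ (.val v) S
  | op (o args) : (∀ i, ExprTyped Γ (args i) (.basic (D.dom o i))) →
      ExprTyped Γ (.op o args) (.basic (D.cod o))

/-- `Δ₁ ≍ Δ₂` : common session channels have dual session types. -/
def Compat (Δ₁ Δ₂ : SessEnv D) : Prop :=
  ∀ k u v, Δ₁ k = some u → Δ₂ k = some v → ∃ α : SType D, u = .ty α.dual ∧ v = .ty α

/-- `Δ₁ ⊙ Δ₂` : the union, with `⊥` for common session channels. -/
def join (Δ₁ Δ₂ : SessEnv D) : SessEnv D := fun k =>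
  match Δ₁ k, Δ₂ k with
  | none, u => u
  | some u, none => some u
  | some _, some _ => some .bot

/-- All session channels of `Δ` have the inactive type. -/
def Completed (Δ : SessEnv D) : Prop := ∀ k u, Δ k = some u → u = .ty .fin

/-- `Typed Γ P Δ` : the judgement `Γ ⊢ P ▷ Δ`. An environment that is written `Δ · k : u` in the
usual presentation of a rule is a `Δ` with `Δ k = some u` in the conclusion, and
`Function.update Δ k (some u)` in the premises. -/
inductive Typed : ServEnv D → Proc D → SessEnv D → Prop
  | serv {Γ a α P Δ} : ValTyped Γ a (.chan α) → Completed Δ →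
      Typed Γ P (cons (some (.ty α)) (fun _ => none)) → Typed Γ (serv a P) Δ
  | repServ {Γ a α P Δ} : ValTyped Γ a (.chan α) → Completed Δ →
      Typed Γ P (cons (some (.ty α)) (fun _ => none)) → Typed Γ (repServ a P) Δ
  | request {Γ a α P Δ} : ValTyped Γ a (.chan α) →
      Typed Γ P (cons (some (.ty α.dual)) Δ) → Typed Γ (request a P) Δ
  | input {Γ k S α P Δ} : Δ k = some (.ty (S.inp α)) →
      Typed (cons (some S) Γ) P (Function.update Δ k (some (.ty α))) → Typed Γ (input k P) Δ
  | output {Γ k e S α P Δ} : Δ k = some (.ty (S.out α)) → ExprTyped Γ e S →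
      Typed Γ P (Function.update Δ k (some (.ty α))) → Typed Γ (output k e P) Δ
  | inputS {Γ k β α P Δ} : Δ k = some (.ty (.inpS β α)) →
      Typed Γ P (cons (some (.ty β)) (Function.update Δ k (some (.ty α)))) →
      Typed Γ (inputS k P) Δ
  | deleg {Γ k k' β α P Δ} : k ≠ k' → Δ k = some (.ty (.outS β α)) → Δ k' = some (.ty β) →
      Typed Γ P (Function.update (Function.update Δ k' none) k (some (.ty α))) →
      Typed Γ (deleg k k' P) Δ
  | branch {Γ k I hI α P Δ} : Δ k = some (.ty (.bra I hI α)) →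
      (∀ l, Typed Γ (P l) (Function.update Δ k (some (.ty (α l))))) →
      Typed Γ (branch k I hI P) Δ
  | select {Γ k I hI α P Δ} (j : {l : ℕ // l ∈ I}) : Δ k = some (.ty (.sel I hI α)) →
      Typed Γ P (Function.update Δ k (some (.ty (α j)))) → Typed Γ (select k j P) Δ
  | par {Γ P₁ P₂ Δ₁ Δ₂} : Typed Γ P₁ Δ₁ → Typed Γ P₂ Δ₂ → Compat Δ₁ Δ₂ →
      Typed Γ (par P₁ P₂) (join Δ₁ Δ₂)
  | nil {Γ Δ} : Completed Δ → Typed Γ nil Δ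
  | res {Γ P Δ} : Typed Γ P (cons (some .bot) Δ) → Typed Γ (res P) Δ
  | ifte {Γ e P Q Δ} : ExprTyped Γ e (.basic none) → Typed Γ P Δ → Typed Γ Q Δ →
      Typed Γ (ifte e P Q) Δ
  | bot {Γ P Δ k} : Δ k = some .bot → Typed Γ P (Function.update Δ k (some (.ty .fin))) →
      Typed Γ P Δ

/-- `P` is well-typed: `Γ ⊢ P ▷ Δ` for some `Γ` and `Δ`, where the free names of `P` are service
channels, that is, `P` has no free data variables. (Typings may have infinite domain here; the
entries for channels and names that do not occur in `P` are irrelevant.) -/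
def WellTyped (P : Proc D) : Prop :=
  ∃ (Γ : ServEnv D) (Δ : SessEnv D),
    (∀ a S, Γ a = some S → ∃ α, S = .chan α) ∧ Typed Γ P Δ

/-! ### Session dependency graphs and transparency -/

/-- Unoriented multigraphs with nodes labelled by sets of session channels; `src` and `tgt` give the
two end nodes of an edge. -/
structure SGraph where
  /-- nodes -/
  Node : Type
  /-- edges -/
  Edge : Type
  /-- one end of an edge -/
  src : Edge → Node
  /-- the other end of an edge -/
  tgt : Edge → Node
  /-- node labels -/
  lab : Node → Set ℕ

namespace SGraph

/-- The graph without nodes. -/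
def empty : SGraph where
  Node := Empty
  Edge := Empty
  src := Empty.elim
  tgt := Empty.elim
  lab := Empty.elim

/-- The graph with one node, labelled `L`, and no edges. -/
def single (L : Set ℕ) : SGraph where
  Node := Unit
  Edge := Empty
  src := Empty.elim
  tgt := Empty.elim
  lab := fun _ => L

/-- Removal of the bound channel (index `0`) from all labels; nodes and edges stay. -/
def restrict (G : SGraph) : SGraph :=
  { G with lab := fun p => {k | k + 1 ∈ G.lab p} }

/-- Disjoint union, with one new edge `(p, q)` for every channel that labels both the node `p` of
the first and the node `q` of the second graph. -/
def compose (G H : SGraph) : SGraph where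
  Node := G.Node ⊕ H.Node
  Edge := (G.Edge ⊕ H.Edge) ⊕ {t : G.Node × H.Node × ℕ // t.2.2 ∈ G.lab t.1 ∩ H.lab t.2.1}
  src
    | .inl (.inl e) => .inl (G.src e)
    | .inl (.inr e) => .inr (H.src e)
    | .inr t => .inl t.1.1
  tgt
    | .inl (.inl e) => .inl (G.tgt e)
    | .inl (.inr e) => .inr (H.tgt e)
    | .inr t => .inr t.1.2.1
  lab := Sum.elim G.lab H.lab

/-- The edge `e` links the nodes `p` and `q`. -/
def Links (G : SGraph) (e : G.Edge) (p q : G.Node) : Prop :=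
  (G.src e = p ∧ G.tgt e = q) ∨ (G.src e = q ∧ G.tgt e = p)

/-- A graph is acyclic if it has no cycle `p₀ e₀ p₁ e₁ … pₙ = p₀`, `0 < n`, with distinct nodes
`p₀, …, pₙ₋₁` and distinct edges `e₀, …, eₙ₋₁`. In particular two parallel edges form a cycle. -/
def Acyclic (G : SGraph) : Prop :=
  ¬ ∃ (n : ℕ) (p : ℕ → G.Node) (e : ℕ → G.Edge), 0 < n ∧ p n = p 0 ∧
      (∀ i < n, G.Links (e i) (p i) (p (i + 1))) ∧
      Set.InjOn p (Set.Iio n) ∧ Set.InjOn e (Set.Iio n)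

end SGraph

/-- The session dependency graph. -/
def graph : Proc D → SGraph
  | nil => .empty
  | res P => (graph P).restrict
  | par P Q => (graph P).compose (graph Q)
  | P => .single P.fsc

/-- `P` is transparent: all its sub-processes have acyclic session dependency graphs. -/
def Transparent (P : Proc D) : Prop := ∀ Q, SubProcess Q P → (graph Q).Acyclic

/-! ### Progress -/

/-- `LiveOver b P` : some session channel of `P` is neither bound by a service or a replicated
service within `P`, nor one of the free channels `k` with `b k`. The channels that count are those
that occur (as subject or object of a communication), and those bound by a request or a session
reception. -/
def LiveOver : (ℕ → Prop) → Proc D → Prop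
  | _, nil => False
  | b, par P Q => LiveOver b P ∨ LiveOver b Q
  | b, res P => LiveOver (cons False b) P
  | b, repServ _ P => LiveOver (cons True b) P
  | b, serv _ P => LiveOver (cons True b) P
  | _, request _ _ => True
  | b, input k P => ¬ b k ∨ LiveOver b P
  | b, output k _ P => ¬ b k ∨ LiveOver b P
  | _, inputS _ _ => True
  | b, deleg k k' P => ¬ b k ∨ ¬ b k' ∨ LiveOver b P
  | b, branch k _ _ P => ¬ b k ∨ ∃ l, LiveOver b (P l)
  | b, select k _ P => ¬ b k ∨ LiveOver b P
  | b, ifte _ P Q => LiveOver b P ∨ LiveOver b Q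

/-- `P` contains live channels: not all session channels of `P` are bound by (replicated)
services. -/
def HasLive (P : Proc D) : Prop := LiveOver (fun _ => False) P

/-- Reduction contexts `E ::= [] | E | P | (ν k) E`. -/
inductive RedCtx (D : DataAlgebra) : Type
  | hole
  | par (E : RedCtx D) (P : Proc D)
  | res (E : RedCtx D)

/-- `E[P]`; the hole may be in the scope of restrictions of `E`, which capture. -/
def RedCtx.fill : RedCtx D → Proc D → Proc D
  | .hole, P => P
  | .par E Q, P => Proc.par (E.fill P) Q
  | .res E, P => Proc.res (E.fill P)

/-- The clause that defines progress, with `X` in place of its recursive occurrence. -/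
def ProgressClause (X : Proc D → Prop) (P : Proc D) : Prop :=
  ∀ P', Relation.ReflTransGen Red P P' →
    ∀ (E : RedCtx D) (P'' : Proc D), Congr P' (E.fill P'') → HasLive P'' →
      ∃ Q, (¬ ∃ Q', Red Q Q') ∧ WellTyped (par P'' Q) ∧ ∃ R, Red (par P'' Q) R ∧ X R

/-- Progress: the largest predicate that satisfies its defining clause. -/
def HasProgress (P : Proc D) : Prop :=
  ∃ X : Proc D → Prop, (∀ R, X R → ProgressClause X R) ∧ X P

end Sessions

/-! The predicate `Safe` (typed over service names only, all sub-terms with acyclic graphs) is a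
post-fixed point of the clause defining progress. Three facts are needed: `Safe` survives reduction,
it passes from `E[P]` to `P`, and a safe process with live channels has an irreducible partner such
that the composition is safe and reduces.

Preservation. Typing is handled by subject reduction (`Red.ty`) for a syntax-directed judgement
`Ty`, equivalent to the given one as far as well-typedness goes (`wellTyped_iff`). For graphs,
acyclicity is recast as "every edge is a bridge" (`Acyclic.bridged`, `Bridged.acyclic`), which is
easy to transport. A communication on `k` contracts the edge `k` between the two prefixes
(`Bridged.merge`) and then expands the merged node into the graph of the continuations
(`Bridged.replace`). The expansion creates no cycle: the two prefixes share no channel besides `k`,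
since two shared channels would be parallel edges, and typing is linear, so a channel with a session
type labels at most one node (`Ty.node_unique`). Opening a session expands the node of the request
in the same way. Cycles could run through the environment, so the induction carries a parallel
context (`Red.hAcyclic_par`).

Partners. All restrictions are pulled to the front. Suppose the top-level prefixes neither reduce
nor offer an interaction to the outside. Then the subject of each prefix `p` also occurs in another
prefix `q`, with dual type, but not as the subject of `q`, as otherwise the two would communicate.
This selects an edge at every node, and no edge twice, so the finite graph has a cycle
(`not_acyclic_of_selection`), a contradiction (`Ty.reduces_or_offers`). Hence a process that does
not reduce by itself offers a service, a request or a session prefix, and a dual prefix is a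
partner. The continuation of that prefix has to dispose of a channel of arbitrary type; it delegates
the channel to a fresh service (`forward`). So the partner shares at most one channel with the
process, and the composition stays acyclic. -/

namespace Sessions

variable {D : DataAlgebra}

/-! ### Acyclic graphs: every edge is a bridge -/

namespace SGraph

/-- The edge `e` is the only one that crosses the cut `A`. -/
def Cut (G : SGraph) (e : G.Edge) (A : Set G.Node) : Prop :=
  (G.src e ∈ A ↔ G.tgt e ∉ A) ∧ ∀ e', e' ≠ e → (G.src e' ∈ A ↔ G.tgt e' ∈ A)

/-- Every edge is a bridge. -/
def Bridged (G : SGraph) : Prop := ∀ e, ∃ A, G.Cut e A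

theorem Cut.compl {G : SGraph} {e : G.Edge} {A : Set G.Node} (h : G.Cut e A) : G.Cut e Aᶜ := by
  obtain ⟨h1, h2⟩ := h
  refine ⟨?_, fun e' he' => ?_⟩
  · simp only [Set.mem_compl_iff]; tauto
  · have := h2 e' he'
    simp only [Set.mem_compl_iff]; tauto

/-- Complementation chooses the side of the source. `Bridged.replace` uses this to obtain cuts that
all leave out the node to be replaced. -/
theorem Bridged.exists_cut_src_notMem {G : SGraph} (h : G.Bridged) (e : G.Edge) :
    ∃ A, G.Cut e A ∧ G.src e ∉ A := by
  obtain ⟨A, hA⟩ := h e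
  by_cases hs : G.src e ∈ A
  · exact ⟨Aᶜ, hA.compl, by simpa using hs⟩
  · exact ⟨A, hA, hs⟩

theorem Links.iff_of_cut {G : SGraph} {e e' : G.Edge} {p q : G.Node} {A : Set G.Node}
    (h : G.Cut e A) (hl : G.Links e' p q) (hne : e' ≠ e) : p ∈ A ↔ q ∈ A := by
  have := h.2 e' hne
  rcases hl with ⟨rfl, rfl⟩ | ⟨rfl, rfl⟩
  · exact this
  · exact this.symm

theorem Links.not_iff_of_cut {G : SGraph} {e : G.Edge} {p q : G.Node} {A : Set G.Node}
    (h : G.Cut e A) (hl : G.Links e p q) : ¬ (p ∈ A ↔ q ∈ A) := by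
  have := h.1
  rcases hl with ⟨rfl, rfl⟩ | ⟨rfl, rfl⟩ <;> tauto

/-- In a cycle the edges other than `e 0` lead from `p 1` back to `p 0` without crossing the cut of
`e 0`, yet that cut separates `p 0` from `p 1`. -/
theorem Bridged.acyclic {G : SGraph} (h : G.Bridged) : G.Acyclic := by
  rintro ⟨n, p, e, hn, hp, hl, -, he⟩
  obtain ⟨A, hA⟩ := h (e 0)
  have key : ∀ i, i + 1 ≤ n → (p 1 ∈ A ↔ p (i + 1) ∈ A) := by
    intro i
    induction i with
    | zero => intro _; rfl
    | succ i ih =>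
      intro hi
      rw [ih (by omega)]
      refine Links.iff_of_cut hA (hl (i + 1) (by omega)) fun hh => ?_
      have := he (Set.mem_Iio.2 (by omega)) (Set.mem_Iio.2 hn) hh
      omega
  have h1 := key (n - 1) (by omega)
  rw [Nat.sub_add_cancel hn, hp] at h1
  exact Links.not_iff_of_cut hA (hl 0 hn) h1.symm

theorem Links.endpoints {G : SGraph} {e : G.Edge} {p q p' q' : G.Node}
    (h : G.Links e p q) (h' : G.Links e p' q') : (p = p' ∧ q = q') ∨ (p = q' ∧ q = p') := by
  rcases h with ⟨rfl, rfl⟩ | ⟨rfl, rfl⟩ <;> rcases h' with ⟨rfl, rfl⟩ | ⟨rfl, rfl⟩ <;> simp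

/-- `p 0, …, p n` is a walk that avoids the edge `e`. -/
def WalkAvoiding (G : SGraph) (e : G.Edge) (n : ℕ) (p : ℕ → G.Node) : Prop :=
  ∀ i < n, ∃ e', e' ≠ e ∧ G.Links e' (p i) (p (i + 1))

/-- A detour between two visits to the same node can be cut out. Hence a shortest walk has distinct
nodes. -/
theorem WalkAvoiding.shortcut {G : SGraph} {e : G.Edge} {n : ℕ} {p : ℕ → G.Node}
    (h : G.WalkAvoiding e n p) {i j : ℕ} (hij : i < j) (hj : j ≤ n) (hp : p i = p j) :
    ∃ q, q 0 = p 0 ∧ q (n - (j - i)) = p n ∧ G.WalkAvoiding e (n - (j - i)) q := by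
  refine ⟨fun m => if m ≤ i then p m else p (m + (j - i)), by simp, ?_, ?_⟩
  · by_cases hc : n - (j - i) ≤ i
    · have : j = n := by omega
      subst this
      have : j - (j - i) = i := by omega
      simp [this, hp]
    · simp only [hc, if_false]
      congr 1; omega
  · intro m hm
    by_cases h1 : m + 1 ≤ i
    · have h2 : m ≤ i := by omega
      simp only [h1, h2, if_true]
      exact h m (by omega)
    · by_cases h2 : m ≤ i
      · have h3 : m = i := by omega
        subst h3
        simp only [le_refl, if_true, h1, if_false, hp]
        have h4 : m + 1 + (j - m) = j + 1 := by omega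
        rw [h4]
        exact h j (by omega)
      · simp only [h1, h2, if_false]
        have h4 : m + 1 + (j - i) = (m + (j - i)) + 1 := by omega
        rw [h4]
        exact h _ (by omega)

/-- The cut of `e` is the set of nodes reachable from its source without using `e`. If the target
were among them, a shortest such walk together with `e` would be a cycle. -/
theorem Acyclic.bridged {G : SGraph} (h : G.Acyclic) : G.Bridged := by
  classical
  intro e
  let A : Set G.Node := {x | ∃ n p, p 0 = G.src e ∧ p n = x ∧ G.WalkAvoiding e n p}
  have hstep : ∀ x y e', e' ≠ e → G.Links e' x y → x ∈ A → y ∈ A := by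
    rintro x y e' hne hl ⟨n, p, h0, hn, hw⟩
    refine ⟨n + 1, fun m => if m ≤ n then p m else y, by simp [h0], by simp, ?_⟩
    intro i hi
    by_cases h1 : i + 1 ≤ n
    · have h2 : i ≤ n := by omega
      simp only [h1, h2, if_true]
      exact hw i (by omega)
    · have h2 : i = n := by omega
      subst h2
      simp only [le_refl, if_true, h1, if_false, hn]
      exact ⟨e', hne, hl⟩
  have hsrc : G.src e ∈ A := ⟨0, fun _ => G.src e, rfl, rfl, fun i hi => by omega⟩
  by_cases htgt : G.tgt e ∈ A
  swap
  · exact ⟨A, by simp [hsrc, htgt], fun e' hne =>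
      ⟨hstep _ _ e' hne (Or.inl ⟨rfl, rfl⟩), hstep _ _ e' hne (Or.inr ⟨rfl, rfl⟩)⟩⟩
  exfalso
  have hex : ∃ n, ∃ p, p 0 = G.src e ∧ p n = G.tgt e ∧ G.WalkAvoiding e n p := htgt
  obtain ⟨p, h0, hn, hw⟩ := Nat.find_spec hex
  have hmin : ∀ m, m < Nat.find hex → _ := fun m hm => Nat.find_min hex hm
  set n := Nat.find hex with hndef
  clear_value n
  have hinj : ∀ i j, i < j → j ≤ n → p i ≠ p j := by
    intro i j hij hj hpe
    obtain ⟨q, hq0, hqn, hqw⟩ := hw.shortcut hij hj hpe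
    exact hmin _ (by omega) ⟨q, hq0.trans h0, hqn.trans hn, hqw⟩
  have hinj' : ∀ i j, i ≤ n → j ≤ n → p i = p j → i = j := by
    intro i j hi hj hpe
    rcases lt_trichotomy i j with hl | hl | hl
    · exact absurd hpe (hinj i j hl hj)
    · exact hl
    · exact absurd hpe.symm (hinj j i hl hi)
  have hw' : ∀ i, ∃ e', i < n → e' ≠ e ∧ G.Links e' (p i) (p (i + 1)) := by
    intro i
    by_cases hi : i < n
    · obtain ⟨e', he'⟩ := hw i hi
      exact ⟨e', fun _ => he'⟩
    · exact ⟨e, fun h => absurd h hi⟩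
  choose f hf using hw'
  -- The edge `e` closes the walk as its edge number `n`. For `n = 0` it is a loop, a cycle of
  -- length one.
  refine h ⟨n + 1, fun i => if i ≤ n then p i else p 0, fun i => if i < n then f i else e,
    by omega, by simp, ?_, ?_, ?_⟩
  · intro i hi
    by_cases h1 : i < n
    · have h2 : i ≤ n := by omega
      have h3 : i + 1 ≤ n := by omega
      simp only [h1, h2, h3, if_true]
      exact (hf i h1).2
    · have h2 : i = n := by omega
      subst h2
      simp only [lt_irrefl, le_refl, if_true, if_false, add_le_iff_nonpos_right, hn, h0]
      exact Or.inr ⟨rfl, rfl⟩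
  · intro i hi j hj hpe
    simp only [Set.mem_Iio] at hi hj
    have h1 : i ≤ n := by omega
    have h2 : j ≤ n := by omega
    simp only [h1, h2, if_true] at hpe
    exact hinj' i j h1 h2 hpe
  · intro i hi j hj hpe
    simp only [Set.mem_Iio] at hi hj
    by_cases h1 : i < n <;> by_cases h2 : j < n
    · simp only [h1, h2, if_true] at hpe
      have l1 := (hf i h1).2
      have l2 := (hf j h2).2
      rw [hpe] at l1
      -- An edge used twice has the same two ends both times. Traversed in opposite directions it
      -- would force `i = j + 1` and `i + 1 = j`.
      rcases l1.endpoints l2 with ⟨ha, -⟩ | ⟨ha, hb⟩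
      · exact hinj' _ _ (by omega) (by omega) ha
      · have := hinj' _ _ (by omega) (by omega) ha
        have := hinj' _ _ (by omega) (by omega) hb
        omega
    · simp only [h1, h2, if_true, if_false] at hpe
      exact absurd hpe (hf i h1).1
    · simp only [h1, h2, if_true, if_false] at hpe
      exact absurd hpe.symm (hf j h2).1
    · omega

/-- A finite graph in which every node selects an edge that starts there, with no edge selected
twice, has a cycle. -/
theorem not_acyclic_of_selection {G : SGraph} [Finite G.Node] [Nonempty G.Node]
    (f : G.Node → G.Node) (e : G.Node → G.Edge) (he : Function.Injective e)
    (hl : ∀ p, G.Links (e p) p (f p)) : ¬ G.Acyclic := by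
  intro h
  obtain ⟨x₀⟩ := ‹Nonempty G.Node›
  -- The orbit of any node under `f` runs into a periodic point, and one minimal period of it, with
  -- the selected edges, is a cycle.
  obtain ⟨a, b, hab, hfab⟩ := Finite.exists_ne_map_eq_of_infinite (fun t : ℕ => f^[t] x₀)
  wlog hlt : a < b generalizing a b
  · exact this b a hab.symm hfab.symm (by omega)
  set x := f^[a] x₀
  have hper : Function.IsPeriodicPt f (b - a) x := by
    change f^[b - a] (f^[a] x₀) = _
    rw [← Function.iterate_add_apply, Nat.sub_add_cancel hlt.le]
    exact hfab.symm
  have hpos : 0 < Function.minimalPeriod f x := hper.minimalPeriod_pos (by omega)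
  have hinj : Set.InjOn (fun t => f^[t] x) (Set.Iio (Function.minimalPeriod f x)) :=
    Function.iterate_injOn_Iio_minimalPeriod
  refine h ⟨Function.minimalPeriod f x, fun t => f^[t] x, fun t => e (f^[t] x), hpos, ?_, ?_,
    hinj, ?_⟩
  · simp
  · intro i _
    simp only [Function.iterate_succ_apply']
    exact hl _
  · intro i hi j hj hij
    exact hinj hi hj (he hij)

/-! ### Embeddings of graphs -/

/-- An embedding is injective on nodes and on edges; labels may grow. -/
def Emb (G H : SGraph) : Prop :=
  ∃ (φ : G.Node → H.Node) (ψ : G.Edge → H.Edge), Function.Injective φ ∧ Function.Injective ψ ∧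
    (∀ e, H.Links (ψ e) (φ (G.src e)) (φ (G.tgt e))) ∧ ∀ p, G.lab p ⊆ H.lab (φ p)

theorem Emb.refl (G : SGraph) : Emb G G :=
  ⟨id, id, Function.injective_id, Function.injective_id, fun _ => Or.inl ⟨rfl, rfl⟩,
    fun _ => le_rfl⟩

theorem Emb.trans {G H K : SGraph} : Emb G H → Emb H K → Emb G K := by
  rintro ⟨φ, ψ, h1, h2, h3, h4⟩ ⟨φ', ψ', h1', h2', h3', h4'⟩
  refine ⟨φ' ∘ φ, ψ' ∘ ψ, h1'.comp h1, h2'.comp h2, fun e => ?_, fun p => (h4 p).trans (h4' _)⟩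
  have a := h3 e
  have b := h3' (ψ e)
  simp only [Function.comp]
  rcases a with ⟨a1, a2⟩ | ⟨a1, a2⟩
  · rwa [a1, a2] at b
  · rw [a1, a2] at b
    exact b.symm

/-- Cuts pull back along an embedding; injectivity on edges keeps every other edge from being sent
to the bridge. -/
theorem Emb.bridged {G H : SGraph} (h : Emb G H) (hH : H.Bridged) : G.Bridged := by
  obtain ⟨φ, ψ, h1, h2, h3, h4⟩ := h
  intro e
  obtain ⟨A, hA⟩ := hH (ψ e)
  refine ⟨φ ⁻¹' A, ?_, fun e' he' => ?_⟩
  · have := (h3 e).not_iff_of_cut hA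
    simp only [Set.mem_preimage]; tauto
  · exact Links.iff_of_cut (G := H) hA (h3 e') (fun hh => he' (h2 hh))

theorem Emb.restrict {G H : SGraph} (h : Emb G H) : Emb G.restrict H.restrict := by
  obtain ⟨φ, ψ, h1, h2, h3, h4⟩ := h
  exact ⟨φ, ψ, h1, h2, h3, fun p k hk => h4 p hk⟩

theorem bridged_single (L : Set ℕ) : (single L).Bridged := fun e => e.elim

theorem bridged_empty : empty.Bridged := fun e => e.elim

/-- The cross edges of a composition of graphs. -/
abbrev Cross (G H : SGraph) : Type := {t : G.Node × H.Node × ℕ // t.2.2 ∈ G.lab t.1 ∩ H.lab t.2.1}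

theorem cross_inj {G H : SGraph} {t t' : Cross G H} (h : t = t') :
    t.1.1 = t'.1.1 ∧ t.1.2.1 = t'.1.2.1 ∧ t.1.2.2 = t'.1.2.2 := by
  subst h
  exact ⟨rfl, rfl, rfl⟩

theorem cross_ext {G H : SGraph} {t t' : Cross G H} (ha : t.1.1 = t'.1.1)
    (hb : t.1.2.1 = t'.1.2.1) (hc : t.1.2.2 = t'.1.2.2) : t = t' :=
  Subtype.ext (Prod.ext ha (Prod.ext hb hc))

theorem Emb.compose {G G' H H' : SGraph} (h : Emb G G') (h' : Emb H H') :
    Emb (G.compose H) (G'.compose H') := by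
  obtain ⟨φ, ψ, h1, h2, h3, h4⟩ := h
  obtain ⟨φ', ψ', h1', h2', h3', h4'⟩ := h'
  refine ⟨Sum.map φ φ', Sum.map (Sum.map ψ ψ')
    (fun t => ⟨(φ t.1.1, φ' t.1.2.1, t.1.2.2), h4 _ t.2.1, h4' _ t.2.2⟩),
    h1.sumMap h1', (h2.sumMap h2').sumMap ?_, ?_, ?_⟩
  · intro t t' hh
    have hh := cross_inj (G := G') (H := H') hh
    exact cross_ext (h1 hh.1) (h1' hh.2.1) hh.2.2
  · rintro ((e | e) | t)
    · rcases h3 e with ⟨a, b⟩ | ⟨a, b⟩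
      · exact Or.inl ⟨congrArg Sum.inl a, congrArg Sum.inl b⟩
      · exact Or.inr ⟨congrArg Sum.inl a, congrArg Sum.inl b⟩
    · rcases h3' e with ⟨a, b⟩ | ⟨a, b⟩
      · exact Or.inl ⟨congrArg Sum.inr a, congrArg Sum.inr b⟩
      · exact Or.inr ⟨congrArg Sum.inr a, congrArg Sum.inr b⟩
    · exact Or.inl ⟨rfl, rfl⟩
  · rintro (p | p)
    · exact h4 p
    · exact h4' p

theorem Emb.compose_left (G H : SGraph) : Emb G (G.compose H) :=
  ⟨Sum.inl, fun e => .inl (.inl e), Sum.inl_injective, fun a b h => by cases h; rfl,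
    fun _ => Or.inl ⟨rfl, rfl⟩, fun _ => le_rfl⟩

theorem Emb.compose_right (G H : SGraph) : Emb H (G.compose H) :=
  ⟨Sum.inr, fun e => .inl (.inr e), Sum.inr_injective, fun a b h => by cases h; rfl,
    fun _ => Or.inl ⟨rfl, rfl⟩, fun _ => le_rfl⟩

theorem Emb.compose_comm (G H : SGraph) : Emb (G.compose H) (H.compose G) := by
  refine ⟨Sum.swap, Sum.map Sum.swap (fun t => ⟨(t.1.2.1, t.1.1, t.1.2.2), t.2.2, t.2.1⟩),
    Sum.swap_leftInverse.injective, Sum.swap_leftInverse.injective.sumMap ?_, ?_, ?_⟩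
  · intro t t' hh
    have hh := cross_inj (G := H) (H := G) hh
    exact cross_ext hh.2.1 hh.1 hh.2.2
  · rintro ((e | e) | t)
    · exact Or.inl ⟨rfl, rfl⟩
    · exact Or.inl ⟨rfl, rfl⟩
    · exact Or.inr ⟨rfl, rfl⟩
  · rintro (p | p) <;> exact le_rfl

theorem Emb.compose_assoc (G H K : SGraph) :
    Emb (G.compose (H.compose K)) ((G.compose H).compose K) := by
  refine ⟨fun p => match p with
      | .inl p => .inl (.inl p)
      | .inr (.inl p) => .inl (.inr p)
      | .inr (.inr p) => .inr p,
    fun e => match e with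
      | .inl (.inl e) => .inl (.inl (.inl (.inl e)))
      | .inl (.inr (.inl (.inl e))) => .inl (.inl (.inl (.inr e)))
      | .inl (.inr (.inl (.inr e))) => .inl (.inr e)
      | .inl (.inr (.inr t)) => .inr ⟨(.inr t.1.1, t.1.2.1, t.1.2.2), t.2⟩
      | .inr ⟨(p, .inl q, k), h⟩ => .inl (.inl (.inr ⟨(p, q, k), h⟩))
      | .inr ⟨(p, .inr q, k), h⟩ => .inr ⟨(.inl p, q, k), h⟩, ?_, ?_, ?_, ?_⟩
  · rintro (p | p | p) (q | q | q) h <;> cases h <;> rfl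
  · rintro ((e | (e | e) | ⟨⟨a, b, k⟩, h⟩) | ⟨⟨a, b | b, k⟩, h⟩)
      ((e' | (e' | e') | ⟨⟨a', b', k'⟩, h'⟩) | ⟨⟨a', b' | b', k'⟩, h'⟩) hh <;> cases hh <;> rfl
  · rintro ((e | (e | e) | ⟨⟨a, b, k⟩, h⟩) | ⟨⟨a, b | b, k⟩, h⟩) <;> exact Or.inl ⟨rfl, rfl⟩
  · rintro (p | p | p) <;> exact le_rfl

theorem Emb.compose_assoc' (G H K : SGraph) :
    Emb ((G.compose H).compose K) (G.compose (H.compose K)) :=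
  (compose_comm _ _).trans <| ((Emb.refl K).compose (compose_comm _ _)).trans <|
    (compose_assoc K H G).trans <| ((compose_comm K H).compose (Emb.refl G)).trans <|
      compose_comm _ _

theorem Emb.compose_empty (G : SGraph) : Emb (G.compose empty) G := by
  refine ⟨Sum.elim id Empty.elim, Sum.elim (Sum.elim id Empty.elim) fun t => Empty.elim t.1.2.1,
    ?_, ?_, ?_, ?_⟩
  · rintro (p | p) (q | q) h
    · exact congrArg Sum.inl h
    · exact q.elim
    all_goals exact p.elim
  · rintro ((e | e) | t) ((e' | e') | t') hh
    · exact congrArg (fun e => Sum.inl (Sum.inl e)) hh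
    · exact e'.elim
    · exact Empty.elim t'.1.2.1
    all_goals first | exact e.elim | exact Empty.elim t.1.2.1
  · rintro ((e | e) | t)
    · exact Or.inl ⟨rfl, rfl⟩
    · exact e.elim
    · exact Empty.elim t.1.2.1
  · rintro (p | p)
    · exact le_rfl
    · exact p.elim

/-- Renaming of the channels in the labels. -/
def relabel (ρ : ℕ → ℕ) (G : SGraph) : SGraph := { G with lab := fun p => ρ '' G.lab p }

theorem Emb.extrude (G H : SGraph) :
    Emb (G.compose H.restrict) ((G.relabel Nat.succ).compose H).restrict := by
  refine ⟨fun p => p, Sum.map id fun t => ⟨(t.1.1, t.1.2.1, t.1.2.2 + 1), ⟨_, t.2.1, rfl⟩, t.2.2⟩,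
    fun _ _ h => h, Function.injective_id.sumMap ?_, ?_, ?_⟩
  · intro t t' hh
    have hh := cross_inj (G := G.relabel Nat.succ) (H := H) hh
    exact cross_ext hh.1 hh.2.1 (Nat.succ_injective hh.2.2)
  · rintro ((e | e) | t) <;> exact Or.inl ⟨rfl, rfl⟩
  · rintro (p | p)
    · intro k hk
      exact ⟨k, hk, rfl⟩
    · exact le_rfl

theorem Emb.extrude' (G H : SGraph) :
    Emb ((G.relabel Nat.succ).compose H).restrict (G.compose H.restrict) := by
  -- The channel of a cross edge labels a node of the shifted graph, so it is a successor and
  -- truncated subtraction loses nothing.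
  have key : ∀ t : Cross (G.relabel Nat.succ) H,
      t.1.2.2 - 1 ∈ G.lab t.1.1 ∩ {k | k + 1 ∈ H.lab t.1.2.1} ∧ t.1.2.2 - 1 + 1 = t.1.2.2 := by
    rintro ⟨⟨a, b, c⟩, ⟨d, hd, hdc⟩, h⟩
    obtain rfl : d + 1 = c := hdc
    exact ⟨⟨hd, h⟩, rfl⟩
  refine ⟨fun p => p, Sum.map id fun t => ⟨(t.1.1, t.1.2.1, t.1.2.2 - 1), (key t).1⟩,
    fun _ _ h => h, Function.injective_id.sumMap ?_, ?_, ?_⟩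
  · rintro t t' hh
    have h1 := (key t).2
    have h2 := (key t').2
    obtain ⟨ha, hb, hc⟩ := cross_inj (G := G) (H := H.restrict) hh
    have hc : t.1.2.2 - 1 = t'.1.2.2 - 1 := hc
    exact cross_ext ha hb (by omega)
  · rintro ((e | e) | t) <;> exact Or.inl ⟨rfl, rfl⟩
  · rintro (p | p)
    · rintro k ⟨j, hj, hjk⟩
      obtain rfl := Nat.succ_injective hjk
      exact hj
    · exact le_rfl

/-! ### Acyclicity of compositions -/

/-- Two graphs without cycles that are linked by at most one edge. -/
theorem Bridged.compose {G H : SGraph} (hG : G.Bridged) (hH : H.Bridged)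
    (hc : ∀ t t' : Cross G H, t = t') : (G.compose H).Bridged := by
  rintro ((e | e) | t)
  · obtain ⟨A, hA⟩ := hG e
    -- `H` goes as one block to the side on which the unique cross edge, if any, is attached to `G`.
    refine ⟨Sum.elim A (fun _ => ∃ t : Cross G H, t.1.1 ∈ A), hA.1, ?_⟩
    rintro ((e' | e') | t') hne
    · exact hA.2 e' (fun h => hne (by rw [h]))
    · exact Iff.rfl
    · refine ⟨fun h => ⟨t', h⟩, ?_⟩
      rintro ⟨s, hs⟩
      rw [hc s t'] at hs
      exact hs
  · obtain ⟨A, hA⟩ := hH e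
    refine ⟨Sum.elim (fun _ => ∃ t : Cross G H, t.1.2.1 ∈ A) A, hA.1, ?_⟩
    rintro ((e' | e') | t') hne
    · exact Iff.rfl
    · exact hA.2 e' (fun h => hne (by rw [h]))
    · refine ⟨?_, fun h => ⟨t', h⟩⟩
      rintro ⟨s, hs⟩
      rw [hc s t'] at hs
      exact hs
  · refine ⟨Sum.elim (fun _ => True) (fun _ => False), ?_, ?_⟩
    · exact ⟨fun _ h => h, fun _ => trivial⟩
    · rintro ((e' | e') | t') hne
      · exact Iff.rfl
      · exact Iff.rfl
      · exact absurd (by rw [hc t t']) hne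

/-- A node of a graph without cycles may be replaced by a graph without cycles. -/
theorem Bridged.replace {V : Set ℕ} {H R : SGraph} (hG : ((single V).compose R).Bridged)
    (hH : H.Bridged) (hV : ∀ h, H.lab h ⊆ V)
    (hu : ∀ h h' r k, k ∈ H.lab h → k ∈ H.lab h' → k ∈ R.lab r → h = h') :
    (H.compose R).Bridged := by
  rintro ((e | e) | t)
  · obtain ⟨A, hA⟩ := hH e
    have hcut := fun t : Cross (single V) R => hG.exists_cut_src_notMem (.inr t)
    choose C hC hCv using hcut
    have hCv' : ∀ t, (Sum.inl () : ((single V).compose R).Node) ∉ C t := fun t => hCv t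
    -- For each edge `t` from the old node into `R`, the set `C t` is a side that hangs on that node
    -- by `t` alone. Each such piece of `R` must follow the node of `H` that inherits the channel of
    -- `t`. By `hu` only one node of `H` does, so the choice is consistent.
    let S : R.Node → Prop := fun x => ∃ (h : H.Node) (t : Cross (single V) R), h ∈ A ∧
      t.1.2.2 ∈ H.lab h ∧ (Sum.inr x : ((single V).compose R).Node) ∈ C t
    refine ⟨Sum.elim A S, hA.1, ?_⟩
    rintro ((e' | e') | t') hne
    · exact hA.2 e' (fun h => hne (by rw [h]))
    · have : ∀ t, _ := fun t => (hC t).2 (.inl (.inr e')) (fun h => nomatch h)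
      exact exists_congr fun h => exists_congr fun t => and_congr_right fun _ =>
        and_congr_right fun _ => this t
    · obtain ⟨⟨h', r', k'⟩, hk1, hk2⟩ := t'
      let t' : Cross (single V) R := ⟨((), r', k'), hV _ hk1, hk2⟩
      constructor
      · intro h'A
        refine ⟨h', t', h'A, hk1, ?_⟩
        by_contra hh
        exact hCv' t' ((hC t').1.2 hh)
      · rintro ⟨h, t, hhA, hk, hx⟩
        by_cases htt : t = t'
        · subst htt
          obtain rfl : h' = h := hu h' h r' k' hk1 hk hk2
          exact hhA
        · exact absurd (((hC t).2 (.inr t') (fun hh => htt (Sum.inr.inj hh).symm)).2 hx) (hCv' t)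
  · obtain ⟨A, hA⟩ := hG (.inl (.inr e))
    -- The bridge lies within `R`: collapsing `H` to the old node pulls back its cut.
    refine ⟨{x | Sum.map (fun _ => ()) id x ∈ A}, hA.1, ?_⟩
    rintro ((e' | e') | t') hne
    · exact Iff.rfl
    · exact hA.2 (.inl (.inr e')) (fun h => hne (by cases h; rfl))
    · exact hA.2 (.inr ⟨((), t'.1.2.1, t'.1.2.2), hV _ t'.2.1, t'.2.2⟩) (fun h => nomatch h)
  · obtain ⟨⟨h, r, k⟩, hk1, hk2⟩ := t
    obtain ⟨A, hA⟩ := hG (.inr ⟨((), r, k), hV _ hk1, hk2⟩)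
    -- The same collapse; by `hu` no other cross edge is sent to the edge that carries `k` to `r`.
    refine ⟨{x | Sum.map (fun _ => ()) id x ∈ A}, hA.1, ?_⟩
    rintro ((e' | e') | ⟨⟨h', r', k'⟩, hk1', hk2'⟩) hne
    · exact Iff.rfl
    · exact hA.2 (.inl (.inr e')) (fun h => nomatch h)
    · refine hA.2 (.inr ⟨((), r', k'), hV _ hk1', hk2'⟩) fun hh => hne ?_
      obtain ⟨rfl, rfl⟩ : r' = r ∧ k' = k := (cross_inj (Sum.inr.inj hh)).2
      obtain rfl := hu h h' _ _ hk1 hk1' hk2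
      rfl

/-- Linked nodes of a graph without cycles may be merged. -/
theorem Bridged.merge {V W : Set ℕ} {R : SGraph}
    (hG : (((single V).compose (single W)).compose R).Bridged) {k₀ : ℕ} (h₀ : k₀ ∈ V ∩ W) :
    ((single (V ∪ W)).compose R).Bridged := by
  let e₀ : (((single V).compose (single W)).compose R).Edge :=
    .inl (.inl (.inr ⟨((), (), k₀), h₀⟩))
  let v : (((single V).compose (single W)).compose R).Node := .inl (.inl ())
  let w : (((single V).compose (single W)).compose R).Node := .inl (.inr ())
  -- The cut of an edge other than `e₀` does not separate the ends `v`, `w` of `e₀`, so it defines a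
  -- side for the merged node.
  have hside : ∀ e A, (((single V).compose (single W)).compose R).Cut e A → e ≠ e₀ →
      (v ∈ A ↔ w ∈ A) := fun e A hA hne => hA.2 e₀ hne.symm
  -- An edge at the merged node comes from an edge with the same channel and the same node of `R`,
  -- starting at `v` or at `w`.
  have old : ∀ t : Cross (single (V ∪ W)) R,
      ∃ t' : Cross ((single V).compose (single W)) R, t'.1.2 = t.1.2 := by
    rintro ⟨⟨-, r, k⟩, hk | hk, hr⟩
    · exact ⟨⟨(.inl (), r, k), hk, hr⟩, rfl⟩
    · exact ⟨⟨(.inr (), r, k), hk, hr⟩, rfl⟩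
  have hend : ∀ (t : Cross ((single V).compose (single W)) R)
      (A : Set (((single V).compose (single W)).compose R).Node), (v ∈ A ↔ w ∈ A) →
      ((Sum.inl t.1.1 : (((single V).compose (single W)).compose R).Node) ∈ A ↔ v ∈ A) := by
    rintro ⟨⟨⟨⟩ | ⟨⟩, r, k⟩, _⟩ A hA
    · exact Iff.rfl
    · exact hA.symm
  have tri : ∀ e A, (((single V).compose (single W)).compose R).Cut e A → e ≠ e₀ →
      ∀ t : Cross (single (V ∪ W)) R,
        (∀ t' : Cross ((single V).compose (single W)) R, t'.1.2 = t.1.2 → .inr t' ≠ e) →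
        (v ∈ A ↔ (Sum.inr t.1.2.1 : (((single V).compose (single W)).compose R).Node) ∈ A) := by
    intro e A hA hne t ht
    obtain ⟨t', ht'⟩ := old t
    have := hA.2 (.inr t') (ht t' ht')
    rw [← ht']
    exact (hend t' A (hside e A hA hne)).symm.trans this
  rintro ((e | e) | t)
  · exact e.elim
  · obtain ⟨A, hA⟩ := hG (.inl (.inr e))
    refine ⟨Sum.elim (fun _ => v ∈ A) (fun x => Sum.inr x ∈ A), hA.1, ?_⟩
    rintro ((e' | e') | t') hne
    · exact e'.elim
    · exact hA.2 (.inl (.inr e')) (fun h => hne (by cases h; rfl))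
    · exact tri _ A hA (fun h => Sum.inr_ne_inl (Sum.inl.inj h)) t' (fun _ _ h => nomatch h)
  · obtain ⟨t₁, ht₁⟩ := old t
    obtain ⟨A, hA⟩ := hG (.inr t₁)
    refine ⟨Sum.elim (fun _ => v ∈ A) (fun x => Sum.inr x ∈ A), ?_, ?_⟩
    · have h1 := hA.1
      have h2 := hend t₁ A (hside _ A hA (fun h => nomatch h))
      change v ∈ A ↔ Sum.inr t.1.2.1 ∉ A
      rw [← ht₁]
      exact h2.symm.trans h1
    · rintro ((e' | e') | t') hne
      · exact e'.elim
      · exact hA.2 (.inl (.inr e')) (fun h => nomatch h)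
      · refine tri _ A hA (fun h => nomatch h) t' ?_
        rintro t₂ ht₂ hh
        obtain rfl := Sum.inr.inj hh
        exact hne (congrArg Sum.inr (Subtype.ext (Prod.ext rfl (ht₂.symm.trans ht₁))))

end SGraph

open Proc

/-! ### Renaming of session channels -/

theorem liftRen_image (ρ : ℕ → ℕ) (S : Set ℕ) :
    {k | k + 1 ∈ liftRen ρ '' S} = ρ '' {k | k + 1 ∈ S} := by
  ext k
  constructor
  · rintro ⟨j | j, hj, hjk⟩
    · exact absurd hjk (Nat.succ_ne_zero k).symm
    · exact ⟨j, hj, Nat.succ_injective hjk⟩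
  · rintro ⟨j, hj, rfl⟩
    exact ⟨j + 1, hj, rfl⟩

theorem liftRen_injOn {ρ : ℕ → ℕ} {S : Set ℕ} (h : Set.InjOn ρ {k | k + 1 ∈ S}) :
    Set.InjOn (liftRen ρ) S := by
  rintro (a | a) ha (b | b) hb hab
  · rfl
  · exact absurd hab (Nat.succ_ne_zero _).symm
  · exact absurd hab (Nat.succ_ne_zero _)
  · rw [h ha hb (Nat.succ_injective hab)]

theorem liftRen_comp (ρ τ : ℕ → ℕ) : liftRen ρ ∘ liftRen τ = liftRen (ρ ∘ τ) := by
  funext k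
  cases k <;> rfl

theorem liftRen_id : liftRen id = id := by
  funext k
  cases k <;> rfl

namespace Proc

theorem fsc_renS (ρ : ℕ → ℕ) (P : Proc D) : (P.renS ρ).fsc = ρ '' P.fsc := by
  induction P generalizing ρ with
  | nil => simp [renS, fsc]
  | par P Q ihP ihQ => simp [renS, fsc, ihP, ihQ, Set.image_union]
  | res P ih => simp only [renS, fsc, ih, liftRen_image]
  | repServ a P ih => simp only [renS, fsc, ih, liftRen_image]
  | serv a P ih => simp only [renS, fsc, ih, liftRen_image]
  | request a P ih => simp only [renS, fsc, ih, liftRen_image]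
  | input k P ih => simp [renS, fsc, ih, Set.image_insert_eq]
  | output k e P ih => simp [renS, fsc, ih, Set.image_insert_eq]
  | inputS k P ih => simp only [renS, fsc, ih, liftRen_image, Set.image_union, Set.image_singleton]
  | deleg k k' P ih => simp [renS, fsc, ih, Set.image_union, Set.image_pair]
  | branch k I hI P ih =>
    simp only [renS, fsc, ih, Set.image_union, Set.image_singleton, Set.image_iUnion]
  | select k l P ih => simp [renS, fsc, ih, Set.image_insert_eq]
  | ifte e P Q ihP ihQ => simp [renS, fsc, ihP, ihQ, Set.image_union]

theorem fsc_subst (σ : ℕ → Val D) (P : Proc D) : (P.subst σ).fsc = P.fsc := by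
  induction P generalizing σ <;> simp_all [subst, fsc]

theorem renS_id (P : Proc D) : P.renS id = P := by
  induction P <;> simp_all [renS, liftRen_id]

theorem renS_renS (ρ τ : ℕ → ℕ) (P : Proc D) : (P.renS τ).renS ρ = P.renS (ρ ∘ τ) := by
  induction P generalizing ρ τ <;> simp_all [renS, liftRen_comp]

theorem finite_fsc (P : Proc D) : P.fsc.Finite := by
  induction P with
  | nil => exact Set.finite_empty
  | par P Q ihP ihQ => exact ihP.union ihQ
  | res P ih => exact ih.preimage (Nat.succ_injective.injOn)
  | repServ a P ih => exact ih.preimage (Nat.succ_injective.injOn)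
  | serv a P ih => exact ih.preimage (Nat.succ_injective.injOn)
  | request a P ih => exact ih.preimage (Nat.succ_injective.injOn)
  | input k P ih => exact (Set.finite_singleton k).union ih
  | output k e P ih => exact (Set.finite_singleton k).union ih
  | inputS k P ih => exact (Set.finite_singleton k).union (ih.preimage (Nat.succ_injective.injOn))
  | deleg k k' P ih => exact (Set.toFinite {k, k'}).union ih
  | branch k I hI P ih => exact (Set.finite_singleton k).union (Set.finite_iUnion ih)
  | select k l P ih => exact (Set.finite_singleton k).union ih
  | ifte e P Q ihP ihQ => exact ihP.union ihQ

/-- Prefixes: all processes except inaction, parallel compositions and restrictions. -/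
def IsPrefix : Proc D → Prop
  | nil => False
  | par _ _ => False
  | res _ => False
  | _ => True

end Proc

theorem Congr.fsc_eq {P Q : Proc D} (h : Congr P Q) : P.fsc = Q.fsc := by
  induction h with
  | refl => rfl
  | symm _ ih => exact ih.symm
  | trans _ _ ih ih' => exact ih.trans ih'
  | par_comm P Q => exact Set.union_comm _ _
  | par_assoc P Q R => exact (Set.union_assoc _ _ _).symm
  | par_nil P => exact Set.union_empty _
  | extrude P Q =>
    ext k
    simp [fsc, fsc_renS]
  | res_nil => rfl
  | branch k I hI _ ih => simp only [fsc, ih]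
  | _ => simp_all [fsc]

/-! ### Session dependency graphs under renaming, substitution and structural congruence -/

theorem graph_prefix {P : Proc D} (h : P.IsPrefix) : graph P = .single P.fsc := by
  cases P <;> first | rfl | exact h.elim

theorem lab_subset_fsc (P : Proc D) (p : (graph P).Node) : (graph P).lab p ⊆ P.fsc := by
  induction P with
  | nil => exact p.elim
  | par P Q ihP ihQ =>
    rcases p with p | p
    · exact (ihP p).trans Set.subset_union_left
    · exact (ihQ p).trans Set.subset_union_right
  | res P ih => exact fun k hk => ih p hk
  | _ => exact le_rfl

theorem graph_subst (σ : ℕ → Val D) (P : Proc D) : graph (P.subst σ) = graph P := by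
  induction P generalizing σ with
  | nil => rfl
  | par P Q ihP ihQ => exact congrArg₂ SGraph.compose (ihP σ) (ihQ σ)
  | res P ih => exact congrArg SGraph.restrict (ih σ)
  | _ => exact congrArg SGraph.single (fsc_subst σ _)

namespace SGraph

theorem Emb.of_lab_subset {G : SGraph} {l l' : G.Node → Set ℕ} (h : ∀ p, l p ⊆ l' p) :
    Emb { G with lab := l } { G with lab := l' } :=
  ⟨fun p => p, fun e => e, fun _ _ h => h, fun _ _ h => h, fun _ => Or.inl ⟨rfl, rfl⟩, h⟩

theorem Emb.relabel_compose {ρ : ℕ → ℕ} {G H : SGraph}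
    (hρ : ∀ p q k k', k ∈ G.lab p → k' ∈ H.lab q → ρ k = ρ k' → k = k') :
    Emb ((G.relabel ρ).compose (H.relabel ρ)) ((G.compose H).relabel ρ) := by
  have key : ∀ t : Cross (G.relabel ρ) (H.relabel ρ),
      ∃ k, k ∈ G.lab t.1.1 ∩ H.lab t.1.2.1 ∧ ρ k = t.1.2.2 := by
    rintro ⟨⟨p, q, j⟩, ⟨k, hk, hkj⟩, ⟨k', hk', hkj'⟩⟩
    obtain rfl := hρ p q k k' hk hk' (hkj.trans hkj'.symm)
    exact ⟨k, ⟨hk, hk'⟩, hkj⟩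
  choose κ hκ hκ' using key
  refine ⟨fun p => p, Sum.map id fun t => ⟨(t.1.1, t.1.2.1, κ t), hκ t⟩, fun _ _ h => h,
    Function.injective_id.sumMap ?_, ?_, ?_⟩
  · intro t t' hh
    obtain ⟨ha, hb, hc⟩ := cross_inj (G := G) (H := H) hh
    exact cross_ext ha hb ((hκ' t).symm.trans ((congrArg ρ hc).trans (hκ' t')))
  · rintro ((e | e) | t) <;> exact Or.inl ⟨rfl, rfl⟩
  · rintro (p | p) <;> exact le_rfl

theorem Emb.compose_relabel {ρ : ℕ → ℕ} {G H : SGraph}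
    (hρ : ∀ p q k k', k ∈ G.lab p → k' ∈ H.lab q → ρ k = ρ k' → k = k') :
    Emb ((G.compose H).relabel ρ) ((G.relabel ρ).compose (H.relabel ρ)) := by
  refine ⟨fun p => p, Sum.map id fun t =>
    ⟨(t.1.1, t.1.2.1, ρ t.1.2.2), ⟨_, t.2.1, rfl⟩, ⟨_, t.2.2, rfl⟩⟩, fun _ _ h => h,
    Function.injective_id.sumMap ?_, ?_, ?_⟩
  · intro t t' hh
    obtain ⟨ha, hb, hc⟩ := cross_inj (G := G.relabel ρ) (H := H.relabel ρ) hh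
    refine cross_ext ha hb (hρ t.1.1 t'.1.2.1 _ _ t.2.1 t'.2.2 hc)
  · rintro ((e | e) | t) <;> exact Or.inl ⟨rfl, rfl⟩
  · rintro (p | p) <;> exact le_rfl

end SGraph

open SGraph

/-- Labels consist of free channels. A renaming injective on these neither creates nor identifies
shared channels, so cross edges correspond. -/
theorem emb_graph_renS {ρ : ℕ → ℕ} {P : Proc D} (h : Set.InjOn ρ P.fsc) :
    Emb (graph (P.renS ρ)) ((graph P).relabel ρ) ∧
      Emb ((graph P).relabel ρ) (graph (P.renS ρ)) := by
  have hsingle : ∀ Q : Proc D, Q.IsPrefix → (Q.renS ρ).IsPrefix →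
      Emb (graph (Q.renS ρ)) ((graph Q).relabel ρ) ∧
        Emb ((graph Q).relabel ρ) (graph (Q.renS ρ)) := by
    intro Q h1 h2
    rw [graph_prefix h1, graph_prefix h2, fsc_renS]
    exact ⟨Emb.refl _, Emb.refl _⟩
  induction P generalizing ρ with
  | nil => exact ⟨⟨fun p => p, fun e => e, fun _ _ h => h, fun _ _ h => h, fun e => e.elim,
      fun p => p.elim⟩, ⟨fun p => p, fun e => e, fun _ _ h => h, fun _ _ h => h, fun e => e.elim,
      fun p => p.elim⟩⟩
  | par P Q ihP ihQ =>
    obtain ⟨a, b⟩ := ihP (h.mono Set.subset_union_left) hsingle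
    obtain ⟨c, d⟩ := ihQ (h.mono Set.subset_union_right) hsingle
    have hρ : ∀ p q k k', k ∈ (graph P).lab p → k' ∈ (graph Q).lab q → ρ k = ρ k' → k = k' :=
      fun p q k k' hk hk' => h (Or.inl (lab_subset_fsc P p hk)) (Or.inr (lab_subset_fsc Q q hk'))
    exact ⟨(a.compose c).trans (Emb.relabel_compose hρ),
      (Emb.compose_relabel hρ).trans (b.compose d)⟩
  | res P ih =>
    obtain ⟨a, b⟩ := ih (liftRen_injOn h) (fun Q h1 h2 => by
      have h2' : (Q.renS (liftRen ρ)).IsPrefix := by cases Q <;> trivial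
      rw [graph_prefix h1, graph_prefix h2', fsc_renS]
      exact ⟨Emb.refl _, Emb.refl _⟩)
    refine ⟨a.restrict.trans (Emb.of_lab_subset (G := graph P) fun p => ?_),
      Emb.trans (Emb.of_lab_subset (G := graph P) fun p => ?_) b.restrict⟩
    · exact (liftRen_image ρ _).le
    · exact (liftRen_image ρ _).ge
  | _ => exact hsingle _ trivial trivial

/-- Mutual embeddings stand in for an isomorphism, since transporting `Bridged` needs no more. A
prefix is a single node whatever its body, so under prefixes `Congr.fsc_eq` suffices. -/
theorem Congr.emb {P Q : Proc D} (h : Congr P Q) :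
    Emb (graph P) (graph Q) ∧ Emb (graph Q) (graph P) := by
  have hsingle : ∀ P Q : Proc D, P.IsPrefix → Q.IsPrefix → Congr P Q →
      Emb (graph P) (graph Q) ∧ Emb (graph Q) (graph P) := by
    intro P Q h1 h2 h
    rw [graph_prefix h1, graph_prefix h2, h.fsc_eq]
    exact ⟨Emb.refl _, Emb.refl _⟩
  induction h with
  | refl => exact ⟨Emb.refl _, Emb.refl _⟩
  | symm _ ih => exact ih.symm
  | trans _ _ ih ih' => exact ⟨ih.1.trans ih'.1, ih'.2.trans ih.2⟩
  | par_comm P Q => exact ⟨Emb.compose_comm _ _, Emb.compose_comm _ _⟩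
  | par_assoc P Q R => exact ⟨Emb.compose_assoc _ _ _, Emb.compose_assoc' _ _ _⟩
  | par_nil P => exact ⟨Emb.compose_empty _, Emb.compose_left _ _⟩
  | extrude P Q =>
    obtain ⟨a, b⟩ := emb_graph_renS (P := P) (Nat.succ_injective.injOn)
    exact ⟨(Emb.extrude _ _).trans (b.compose (Emb.refl _)).restrict,
      Emb.trans (a.compose (Emb.refl _)).restrict (Emb.extrude' _ _)⟩
  | res_nil => exact ⟨⟨fun p => p, fun e => e, fun _ _ h => h, fun _ _ h => h, fun e => e.elim,
      fun p => p.elim⟩, ⟨fun p => p, fun e => e, fun _ _ h => h, fun _ _ h => h, fun e => e.elim,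
      fun p => p.elim⟩⟩
  | par _ _ ih ih' => exact ⟨ih.1.compose ih'.1, ih.2.compose ih'.2⟩
  | res _ ih => exact ⟨ih.1.restrict, ih.2.restrict⟩
  | repServ a h => exact hsingle _ _ trivial trivial (.repServ a h)
  | serv a h => exact hsingle _ _ trivial trivial (.serv a h)
  | request a h => exact hsingle _ _ trivial trivial (.request a h)
  | input k h => exact hsingle _ _ trivial trivial (.input k h)
  | output k e h => exact hsingle _ _ trivial trivial (.output k e h)
  | inputS k h => exact hsingle _ _ trivial trivial (.inputS k h)
  | deleg k k' h => exact hsingle _ _ trivial trivial (.deleg k k' h)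
  | branch k I hI h => exact hsingle _ _ trivial trivial (.branch k I hI h)
  | select k l h => exact hsingle _ _ trivial trivial (.select k l h)
  | ifte e h h' => exact hsingle _ _ trivial trivial (.ifte e h h')

theorem Congr.bridged_iff {P Q : Proc D} (h : Congr P Q) :
    (graph P).Bridged ↔ (graph Q).Bridged :=
  ⟨h.emb.2.bridged, h.emb.1.bridged⟩

/-! ### Hereditary acyclicity -/

/-- All sub-terms of `P` have graphs without cycles. -/
def HAcyclic : Proc D → Prop
  | nil => True
  | par P Q => HAcyclic P ∧ HAcyclic Q ∧ ((graph P).compose (graph Q)).Bridged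
  | res P => HAcyclic P
  | repServ _ P => HAcyclic P
  | serv _ P => HAcyclic P
  | request _ P => HAcyclic P
  | input _ P => HAcyclic P
  | output _ _ P => HAcyclic P
  | inputS _ P => HAcyclic P
  | deleg _ _ P => HAcyclic P
  | branch _ _ _ P => ∀ l, HAcyclic (P l)
  | select _ _ P => HAcyclic P
  | ifte _ P Q => HAcyclic P ∧ HAcyclic Q

theorem HAcyclic.bridged {P : Proc D} (h : HAcyclic P) : (graph P).Bridged := by
  induction P with
  | nil => exact bridged_empty
  | par P Q _ _ => exact h.2.2
  | res P ih => exact ih h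
  | _ => exact bridged_single _

theorem HAcyclic.subterm {P Q : Proc D} (hs : Subterm Q P) (h : HAcyclic P) : HAcyclic Q := by
  induction hs with
  | refl => exact h
  | par_left _ ih => exact ih h.1
  | par_right _ ih => exact ih h.2.1
  | branch l _ ih => exact ih (h l)
  | ifte_left _ ih => exact ih h.1
  | ifte_right _ ih => exact ih h.2
  | _ => simp_all [HAcyclic]

theorem HAcyclic.of_subterms {P : Proc D} (h : ∀ Q, Subterm Q P → (graph Q).Bridged) :
    HAcyclic P := by
  induction P with
  | nil => trivial
  | par P Q ihP ihQ =>
    exact ⟨ihP fun R hR => h R hR.par_left, ihQ fun R hR => h R hR.par_right, h _ (.refl _)⟩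
  | res P ih => exact ih fun R hR => h R hR.res
  | repServ a P ih => exact ih fun R hR => h R hR.repServ
  | serv a P ih => exact ih fun R hR => h R hR.serv
  | request a P ih => exact ih fun R hR => h R hR.request
  | input k P ih => exact ih fun R hR => h R hR.input
  | output k e P ih => exact ih fun R hR => h R hR.output
  | inputS k P ih => exact ih fun R hR => h R hR.inputS
  | deleg k k' P ih => exact ih fun R hR => h R hR.deleg
  | branch k I hI P ih => exact fun l => ih l fun R hR => h R (hR.branch l)
  | select k l P ih => exact ih fun R hR => h R hR.select
  | ifte e P Q ihP ihQ =>
    exact ⟨ihP fun R hR => h R hR.ifte_left, ihQ fun R hR => h R hR.ifte_right⟩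

theorem hAcyclic_subst (σ : ℕ → Val D) (P : Proc D) : HAcyclic (P.subst σ) ↔ HAcyclic P := by
  induction P generalizing σ with
  | par P Q ihP ihQ => simp only [HAcyclic, subst, ihP, ihQ, graph_subst]
  | _ => simp_all [HAcyclic, subst]

theorem hAcyclic_renS {ρ : ℕ → ℕ} {P : Proc D} (h : Set.InjOn ρ P.fsc) :
    HAcyclic (P.renS ρ) ↔ HAcyclic P := by
  induction P generalizing ρ with
  | nil => exact Iff.rfl
  | par P Q ihP ihQ =>
    have he := emb_graph_renS h
    exact and_congr (ihP (h.mono Set.subset_union_left)) (and_congr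
      (ihQ (h.mono Set.subset_union_right)) ⟨fun hb => he.2.bridged hb, fun hb => he.1.bridged hb⟩)
  | res P ih => exact ih (liftRen_injOn h)
  | repServ a P ih => exact ih (liftRen_injOn h)
  | serv a P ih => exact ih (liftRen_injOn h)
  | request a P ih => exact ih (liftRen_injOn h)
  | inputS k P ih => exact ih (liftRen_injOn (h.mono Set.subset_union_right))
  | branch k I hI P ih =>
    exact forall_congr' fun l => ih l
      (h.mono ((Set.subset_iUnion (fun l => (P l).fsc) l).trans Set.subset_union_right))
  | ifte e P Q ihP ihQ =>
    exact and_congr (ihP (h.mono Set.subset_union_left)) (ihQ (h.mono Set.subset_union_right))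
  | input k P ih => exact ih (h.mono Set.subset_union_right)
  | output k e P ih => exact ih (h.mono Set.subset_union_right)
  | deleg k k' P ih => exact ih (h.mono Set.subset_union_right)
  | select k l P ih => exact ih (h.mono Set.subset_union_right)

/-- A structural law may create new sub-terms, for instance by reassociation, but their graphs embed
in the graph of a composition already known to be acyclic. -/
theorem Congr.hAcyclic_iff {P Q : Proc D} (h : Congr P Q) : HAcyclic P ↔ HAcyclic Q := by
  induction h with
  | refl => exact Iff.rfl
  | symm _ ih => exact ih.symm
  | trans _ _ ih ih' => exact ih.trans ih'
  | par_comm P Q =>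
    have := (Congr.par_comm P Q).bridged_iff
    simp only [graph] at this
    simp only [HAcyclic, this]
    tauto
  | par_assoc P Q R =>
    have := (Congr.par_assoc P Q R).bridged_iff
    simp only [graph] at this
    simp only [HAcyclic, graph, this]
    constructor
    · rintro ⟨h1, ⟨h2, h3, -⟩, h4⟩
      exact ⟨⟨h1, h2, (Emb.compose_left _ _).bridged h4⟩, h3, h4⟩
    · rintro ⟨⟨h1, h2, -⟩, h3, h4⟩
      exact ⟨h1, ⟨h2, h3, (Emb.compose_right _ _).bridged (this.2 h4)⟩, h4⟩
  | par_nil P =>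
    have := (Congr.par_nil P).bridged_iff
    simp only [graph] at this
    simp only [HAcyclic, graph, this, true_and]
    exact ⟨fun h => h.1, fun h => ⟨h, h.bridged⟩⟩
  | extrude P Q =>
    have := (Congr.extrude P Q).bridged_iff
    exact and_congr (hAcyclic_renS (Nat.succ_injective.injOn)).symm (and_congr Iff.rfl this)
  | res_nil => exact Iff.rfl
  | par h h' ih ih' => exact and_congr ih (and_congr ih' (h.par h').bridged_iff)
  | branch k I hI _ ih => exact forall_congr' ih
  | ifte e _ _ ih ih' => exact and_congr ih ih'
  | _ => assumption

/-- Invariance under congruence removes the quantifier over all `P' ≡ P`: the sub-terms of `P`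
itself decide. -/
theorem transparent_iff {P : Proc D} : Transparent P ↔ HAcyclic P := by
  constructor
  · intro h
    exact HAcyclic.of_subterms fun Q hQ => (h Q ⟨P, .refl P, hQ⟩).bridged
  · rintro h Q ⟨P', hc, hs⟩
    exact ((hc.hAcyclic_iff.2 h).subterm hs).bridged.acyclic

/-! ### A syntax-directed presentation of session typing -/

theorem SType.dual_dual (α : SType D) : α.dual.dual = α := by
  induction α <;> simp_all [SType.dual]

/-- What a typing may assign to a channel that does not occur. -/
def Idle (u : Option (Use D)) : Prop := u = none ∨ u = some (.ty .fin) ∨ u = some .bot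

/-- The order generated by `none < end < ⊥`. -/
def Up (u w : Option (Use D)) : Prop :=
  u = w ∨ (u = some (.ty .fin) ∧ w = some .bot) ∨ (u = none ∧ Idle w)

/-- `w` is what a parallel composition assigns to a channel to which its components assign `u`
and `v`. -/
def Joined (u v w : Option (Use D)) : Prop :=
  (u = none ∧ w = v) ∨ (v = none ∧ w = u) ∨
    ∃ α : SType D, u = some (.ty α.dual) ∧ v = some (.ty α) ∧ w = some .bot

theorem Up.refl (u : Option (Use D)) : Up u u := Or.inl rfl

theorem Up.trans {u v w : Option (Use D)} : Up u v → Up v w → Up u w := by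
  rintro (rfl | ⟨rfl, rfl⟩ | ⟨rfl, rfl | rfl | rfl⟩) (h | ⟨h, rfl⟩ | ⟨h, rfl | rfl | rfl⟩) <;>
    simp_all [Up, Idle]

theorem Up.idle {u w : Option (Use D)} (h : Up u w) (hu : Idle u) : Idle w := by
  rcases h with rfl | ⟨-, rfl⟩ | ⟨-, h⟩
  · exact hu
  · exact Or.inr (Or.inr rfl)
  · exact h

theorem up_none {w : Option (Use D)} : Up none w ↔ Idle w := by
  constructor
  · intro h
    exact h.idle (Or.inl rfl)
  · exact fun h => Or.inr (Or.inr ⟨rfl, h⟩)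

theorem Joined.symm {u v w : Option (Use D)} : Joined u v w → Joined v u w := by
  rintro (⟨rfl, rfl⟩ | ⟨rfl, rfl⟩ | ⟨α, rfl, rfl, rfl⟩)
  · exact Or.inr (Or.inl ⟨rfl, rfl⟩)
  · exact Or.inl ⟨rfl, rfl⟩
  · exact Or.inr (Or.inr ⟨α.dual, by rw [SType.dual_dual], rfl, rfl⟩)

theorem Joined.none_left (u : Option (Use D)) : Joined none u u := Or.inl ⟨rfl, rfl⟩

theorem Joined.none_right (u : Option (Use D)) : Joined u none u := Or.inr (Or.inl ⟨rfl, rfl⟩)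

/-- `⊥` joins with `none` only, so at most two of the three components have an entry for the
channel. -/
theorem Joined.assoc {u v w x y : Option (Use D)} (h : Joined v w x) (h' : Joined u x y) :
    ∃ z, Joined u v z ∧ Joined z w y := by
  rcases h with ⟨rfl, rfl⟩ | ⟨rfl, rfl⟩ | ⟨α, rfl, rfl, rfl⟩
  · exact ⟨u, .none_right u, h'⟩
  · exact ⟨y, h', .none_right y⟩
  · rcases h' with ⟨rfl, rfl⟩ | ⟨h, -⟩ | ⟨β, -, h, -⟩
    · exact ⟨_, .none_left _, Or.inr (Or.inr ⟨α, rfl, rfl, rfl⟩)⟩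
    · cases h
    · cases h

theorem Joined.assoc' {u v w z y : Option (Use D)} (h : Joined u v z) (h' : Joined z w y) :
    ∃ x, Joined v w x ∧ Joined u x y := by
  obtain ⟨x, h1, h2⟩ := h.symm.assoc h'.symm
  exact ⟨x, h1.symm, h2.symm⟩

/-- If both sides have an entry, the idle one must be `end`, which is self-dual; the other entry
then rises from `end` to `⊥`. This lets a component that does not use a channel be ignored up to
weakening. -/
theorem Joined.up_of_idle {u v w : Option (Use D)} (h : Joined u v w) (hv : Idle v) : Up u w := by
  rcases h with ⟨rfl, rfl⟩ | ⟨rfl, rfl⟩ | ⟨α, rfl, rfl, rfl⟩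
  · exact up_none.2 hv
  · exact .refl _
  · rcases hv with hv | hv | hv
    · cases hv
    · obtain rfl : α = .fin := by simpa using hv
      exact Or.inr (Or.inl ⟨rfl, rfl⟩)
    · cases hv

theorem Joined.idle {u v w : Option (Use D)} (h : Joined u v w) (hu : Idle u) (hv : Idle v) :
    Idle w := (h.up_of_idle hv).idle hu

theorem Joined.of_ty {u v : Option (Use D)} {α : SType D} (h : Joined u v (some (.ty α))) :
    (u = none ∧ v = some (.ty α)) ∨ (v = none ∧ u = some (.ty α)) := by
  rcases h with ⟨rfl, rfl⟩ | ⟨rfl, rfl⟩ | ⟨α, -, -, h⟩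
  · exact Or.inl ⟨rfl, rfl⟩
  · exact Or.inr ⟨rfl, rfl⟩
  · cases h

theorem Joined.of_none {u v : Option (Use D)} (h : Joined u v none) : u = none ∧ v = none := by
  rcases h with ⟨rfl, rfl⟩ | ⟨rfl, rfl⟩ | ⟨α, -, -, h⟩
  · exact ⟨rfl, rfl⟩
  · exact ⟨rfl, rfl⟩
  · cases h

theorem Joined.ty_ty {α β : SType D} {w : Option (Use D)}
    (h : Joined (some (.ty α)) (some (.ty β)) w) : α = β.dual ∧ w = some .bot := by
  rcases h with ⟨h, -⟩ | ⟨h, -⟩ | ⟨γ, h1, h2, rfl⟩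
  · cases h
  · cases h
  · cases h1
    cases h2
    exact ⟨rfl, rfl⟩

theorem Joined.bot_ty {α : SType D} : Joined (some (.ty α)) (some (.ty α.dual)) (some .bot) :=
  Or.inr (Or.inr ⟨α.dual, by rw [SType.dual_dual], rfl, rfl⟩)

/-- `Ty Γ P Δ` : the judgement `Γ ⊢ P ▷ Δ`, with weakening of `Δ` built into the leaves. -/
def Ty : ServEnv D → Proc D → SessEnv D → Prop
  | _, nil, Δ => ∀ k, Idle (Δ k)
  | Γ, par P Q, Δ => ∃ Δ₁ Δ₂, Ty Γ P Δ₁ ∧ Ty Γ Q Δ₂ ∧ ∀ k, Joined (Δ₁ k) (Δ₂ k) (Δ k)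
  | Γ, res P, Δ => Ty Γ P (cons (some .bot) Δ)
  | Γ, repServ a P, Δ => ∃ α, ValTyped Γ a (.chan α) ∧ (∀ k, Idle (Δ k)) ∧
      Ty Γ P (cons (some (.ty α)) fun _ => none)
  | Γ, serv a P, Δ => ∃ α, ValTyped Γ a (.chan α) ∧ (∀ k, Idle (Δ k)) ∧
      Ty Γ P (cons (some (.ty α)) fun _ => none)
  | Γ, request a P, Δ => ∃ α, ValTyped Γ a (.chan α) ∧ Ty Γ P (cons (some (.ty α.dual)) Δ)
  | Γ, input k P, Δ => ∃ S α, Δ k = some (.ty (Srt.inp S α)) ∧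
      Ty (cons (some S) Γ) P (Function.update Δ k (some (.ty α)))
  | Γ, output k e P, Δ => ∃ S α, Δ k = some (.ty (Srt.out S α)) ∧ ExprTyped Γ e S ∧
      Ty Γ P (Function.update Δ k (some (.ty α)))
  | Γ, inputS k P, Δ => ∃ β α, Δ k = some (.ty (.inpS β α)) ∧
      Ty Γ P (cons (some (.ty β)) (Function.update Δ k (some (.ty α))))
  -- `Up` instead of equality absorbs the rule `bot` for a delegated channel of type `end`, whose
  -- entry may have become `⊥`.
  | Γ, deleg k k' P, Δ => k ≠ k' ∧ ∃ β α, Δ k = some (.ty (.outS β α)) ∧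
      Up (some (.ty β)) (Δ k') ∧
      Ty Γ P (Function.update (Function.update Δ k' none) k (some (.ty α)))
  | Γ, branch k I hI P, Δ => ∃ α, Δ k = some (.ty (.bra I hI α)) ∧
      ∀ l, Ty Γ (P l) (Function.update Δ k (some (.ty (α l))))
  | Γ, select k j P, Δ => ∃ (I : Finset ℕ) (hI : I.Nonempty) (α : {l : ℕ // l ∈ I} → SType D)
      (hj : j ∈ I), Δ k = some (.ty (.sel I hI α)) ∧
      Ty Γ P (Function.update Δ k (some (.ty (α ⟨j, hj⟩))))
  | Γ, ifte e P Q, Δ => ExprTyped Γ e (.basic none) ∧ Ty Γ P Δ ∧ Ty Γ Q Δ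

theorem idle_none : Idle (none : Option (Use D)) := Or.inl rfl

theorem idle_of_ne {Δ : SessEnv D} {k j : ℕ} {u : Option (Use D)} (hne : j ≠ k)
    (h : Idle (Function.update Δ k u j)) : Idle (Δ j) := by
  rwa [Function.update_of_ne hne] at h

/-- Channels that do not occur are idle. -/
theorem Ty.idle {Γ : ServEnv D} {P : Proc D} {Δ : SessEnv D} (h : Ty Γ P Δ) {k : ℕ}
    (hk : k ∉ P.fsc) : Idle (Δ k) := by
  induction P generalizing Γ Δ k with
  | nil => exact h k
  | par P Q ihP ihQ =>
    obtain ⟨Δ₁, Δ₂, h1, h2, hj⟩ := h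
    exact (hj k).idle (ihP h1 fun h => hk (Or.inl h)) (ihQ h2 fun h => hk (Or.inr h))
  | res P ih => exact ih (k := k + 1) h hk
  | repServ a P ih =>
    obtain ⟨α, -, h, -⟩ := h
    exact h k
  | serv a P ih =>
    obtain ⟨α, -, h, -⟩ := h
    exact h k
  | request a P ih =>
    obtain ⟨α, -, h⟩ := h
    exact ih (k := k + 1) h hk
  | input j P ih =>
    obtain ⟨S, α, -, h⟩ := h
    exact idle_of_ne (fun h => hk (Or.inl h)) (ih h fun h => hk (Or.inr h))
  | output j e P ih =>
    obtain ⟨S, α, -, -, h⟩ := h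
    exact idle_of_ne (fun h => hk (Or.inl h)) (ih h fun h => hk (Or.inr h))
  | inputS j P ih =>
    obtain ⟨β, α, -, h⟩ := h
    exact idle_of_ne (fun h => hk (Or.inl h)) (ih (k := k + 1) h fun h => hk (Or.inr h))
  | deleg j j' P ih =>
    obtain ⟨-, β, α, -, -, h⟩ := h
    exact idle_of_ne (fun h => hk (Or.inl (Or.inr h)))
      (idle_of_ne (fun h => hk (Or.inl (Or.inl h))) (ih h fun h => hk (Or.inr h)))
  | branch j I hI P ih =>
    obtain ⟨α, -, h⟩ := h
    -- Without a label no branch would constrain the remaining channels.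
    obtain ⟨l, hl⟩ := hI
    exact idle_of_ne (fun h => hk (Or.inl h))
      (ih ⟨l, hl⟩ (h ⟨l, hl⟩) fun h => hk (Or.inr (Set.mem_iUnion.2 ⟨_, h⟩)))
  | select j l P ih =>
    obtain ⟨I, hI, α, hj, -, h⟩ := h
    exact idle_of_ne (fun h => hk (Or.inl h)) (ih h fun h => hk (Or.inr h))
  | ifte e P Q ihP ihQ => exact ihP h.2.1 fun h => hk (Or.inl h)

theorem update_ne_none {Δ : SessEnv D} {k j : ℕ} {u : Option (Use D)} (hne : j ≠ k)
    (h : Function.update Δ k u j ≠ none) : Δ j ≠ none := by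
  rwa [Function.update_of_ne hne] at h

/-- Channels that occur are typed. -/
theorem Ty.ne_none {Γ : ServEnv D} {P : Proc D} {Δ : SessEnv D} (h : Ty Γ P Δ) {k : ℕ}
    (hk : k ∈ P.fsc) : Δ k ≠ none := by
  induction P generalizing Γ Δ k with
  | nil => exact hk.elim
  | par P Q ihP ihQ =>
    obtain ⟨Δ₁, Δ₂, h1, h2, hj⟩ := h
    intro h0
    have := hj k
    rw [h0] at this
    rcases hk with hk | hk
    · exact ihP h1 hk this.of_none.1
    · exact ihQ h2 hk this.of_none.2
  | res P ih => exact ih (k := k + 1) h hk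
  | repServ a P ih =>
    obtain ⟨α, -, -, h⟩ := h
    exact absurd rfl (ih (k := k + 1) h hk)
  | serv a P ih =>
    obtain ⟨α, -, -, h⟩ := h
    exact absurd rfl (ih (k := k + 1) h hk)
  | request a P ih =>
    obtain ⟨α, -, h⟩ := h
    exact ih (k := k + 1) h hk
  | input j P ih =>
    obtain ⟨S, α, h0, h⟩ := h
    by_cases hne : k = j
    · subst hne; simp [h0]
    · exact update_ne_none hne (ih h (hk.resolve_left hne))
  | output j e P ih =>
    obtain ⟨S, α, h0, -, h⟩ := h
    by_cases hne : k = j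
    · subst hne; simp [h0]
    · exact update_ne_none hne (ih h (hk.resolve_left hne))
  | inputS j P ih =>
    obtain ⟨β, α, h0, h⟩ := h
    by_cases hne : k = j
    · subst hne; simp [h0]
    · exact update_ne_none hne (ih (k := k + 1) h (hk.resolve_left hne))
  | deleg j j' P ih =>
    obtain ⟨-, β, α, h0, h1, h⟩ := h
    by_cases hne : k = j
    · subst hne; simp [h0]
    · by_cases hne' : k = j'
      · subst hne'
        intro h2
        rw [h2] at h1
        simp [Up] at h1
      · exact update_ne_none hne' (update_ne_none hne
          (ih h (hk.resolve_left (by rintro (h | h) <;> contradiction))))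
  | branch j I hI P ih =>
    obtain ⟨α, h0, h⟩ := h
    by_cases hne : k = j
    · subst hne; simp [h0]
    · obtain ⟨l, hl⟩ := Set.mem_iUnion.1 (hk.resolve_left hne)
      exact update_ne_none hne (ih l (h l) hl)
  | select j l P ih =>
    obtain ⟨I, hI, α, hj, h0, h⟩ := h
    by_cases hne : k = j
    · subst hne; simp [h0]
    · exact update_ne_none hne (ih h (hk.resolve_left hne))
  | ifte e P Q ihP ihQ => exact hk.elim (fun hk => ihP h.2.1 hk) fun hk => ihQ h.2.2 hk

/-- The environment `Δ'` types the image under `ρ` of a process with channels in `s` that is typed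
by `Δ`. -/
def Transfers (s : Set ℕ) (ρ : ℕ → ℕ) (Δ Δ' : SessEnv D) : Prop :=
  (∀ k ∈ s, Up (Δ k) (Δ' (ρ k))) ∧ ∀ j, j ∉ ρ '' s → Idle (Δ' j)

theorem Transfers.cons {s : Set ℕ} {ρ : ℕ → ℕ} {Δ Δ' : SessEnv D} {u u' : Option (Use D)}
    (h : Transfers {k | k + 1 ∈ s} ρ Δ Δ') (hu : Up u u') (hi : 0 ∉ s → Idle u') :
    Transfers s (liftRen ρ) (Sessions.cons u Δ) (Sessions.cons u' Δ') := by
  constructor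
  · rintro (k | k) hk
    · exact hu
    · exact h.1 k hk
  · rintro (j | j) hj
    · exact hi fun h0 => hj ⟨0, h0, rfl⟩
    · refine h.2 j ?_
      rintro ⟨k, hk, rfl⟩
      exact hj ⟨k + 1, hk, rfl⟩

theorem Transfers.update {s s' : Set ℕ} {ρ : ℕ → ℕ} {Δ Δ' : SessEnv D} {u : Option (Use D)}
    {k : ℕ} (h : Transfers s' ρ Δ Δ') (hρ : Set.InjOn ρ s') (hk : k ∈ s') (hs : s ⊆ s')
    (hs' : s' ⊆ insert k s) (hi : k ∉ s → Idle u) :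
    Transfers s ρ (Function.update Δ k u) (Function.update Δ' (ρ k) u) := by
  constructor
  · intro j hj
    by_cases hjk : j = k
    · subst hjk
      simpa using Up.refl u
    · rw [Function.update_of_ne hjk, Function.update_of_ne fun h => hjk (hρ (hs hj) hk h)]
      exact h.1 j (hs hj)
  · intro j hj
    by_cases hjk : j = ρ k
    · subst hjk
      rw [Function.update_self]
      exact hi fun h0 => hj ⟨k, h0, rfl⟩
    · rw [Function.update_of_ne hjk]
      refine h.2 j ?_
      rintro ⟨i, hi, rfl⟩
      rcases hs' hi with rfl | hi
      · exact hjk rfl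
      · exact hj ⟨i, hi, rfl⟩

theorem Transfers.up_ty {s : Set ℕ} {ρ : ℕ → ℕ} {Δ Δ' : SessEnv D} (h : Transfers s ρ Δ Δ') {k : ℕ}
    (hk : k ∈ s) {α : SType D} (h0 : Δ k = some (.ty α)) (hα : α ≠ .fin) :
    Δ' (ρ k) = some (.ty α) := by
  have := h.1 k hk
  rw [h0] at this
  rcases this with h | ⟨h, -⟩ | ⟨h, -⟩
  · exact h.symm
  · simp only [Option.some.injEq, Use.ty.injEq] at h
    exact absurd h hα
  · cases h

theorem Srt.inp_ne_fin (S : Srt D) (α : SType D) : S.inp α ≠ .fin := by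
  cases S <;> simp [Srt.inp]

theorem Srt.out_ne_fin (S : Srt D) (α : SType D) : S.out α ≠ .fin := by
  cases S <;> simp [Srt.out]

theorem insert_subset_of_subset_union {k : ℕ} {s : Set ℕ} : {k} ∪ s ⊆ insert k s := by
  simp

/-- Renaming and weakening of session channels. -/
theorem Ty.renS {Γ : ServEnv D} {P : Proc D} {Δ Δ' : SessEnv D} {ρ : ℕ → ℕ} (h : Ty Γ P Δ)
    (hρ : Set.InjOn ρ P.fsc) (ht : Transfers P.fsc ρ Δ Δ') : Ty Γ (P.renS ρ) Δ' := by
  classical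
  induction P generalizing Γ Δ Δ' ρ with
  | nil => exact fun k => ht.2 k (by simp [fsc])
  | par P Q ihP ihQ =>
    obtain ⟨Δ₁, Δ₂, h1, h2, hj⟩ := h
    have hunion : ∀ j, j ∉ ρ '' P.fsc → j ∉ ρ '' Q.fsc → Idle (Δ' j) := by
      intro j h1 h2
      refine ht.2 j ?_
      rw [fsc, Set.image_union]
      exact fun h => h.elim h1 h2
    -- A channel used by both components keeps its two entries, read back through the inverse of
    -- `ρ`. Any other entry of `Δ'` goes entirely to `P` if `P` uses the channel, and to `Q`
    -- otherwise.
    refine ⟨fun j => if j ∈ ρ '' P.fsc then (if j ∈ ρ '' Q.fsc then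
        Δ₁ (Function.invFunOn ρ P.fsc j) else Δ' j) else none,
      fun j => if j ∈ ρ '' P.fsc then (if j ∈ ρ '' Q.fsc then
        Δ₂ (Function.invFunOn ρ P.fsc j) else none) else Δ' j, ?_, ?_, ?_⟩
    · refine ihP h1 (hρ.mono Set.subset_union_left) ⟨fun k hk => ?_, fun j hj => ?_⟩
      · have hm : ρ k ∈ ρ '' P.fsc := ⟨k, hk, rfl⟩
        beta_reduce
        rw [if_pos hm]
        split_ifs with hq
        · rw [(hρ.mono Set.subset_union_left).leftInvOn_invFunOn hk]
          exact .refl _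
        · have hkq : k ∉ Q.fsc := fun h => hq ⟨k, h, rfl⟩
          exact ((hj k).up_of_idle (h2.idle hkq)).trans (ht.1 k (Or.inl hk))
      · beta_reduce
        rw [if_neg hj]
        exact idle_none
    · refine ihQ h2 (hρ.mono Set.subset_union_right) ⟨fun k hk => ?_, fun j hj => ?_⟩
      · have hm : ρ k ∈ ρ '' Q.fsc := ⟨k, hk, rfl⟩
        beta_reduce
        rw [if_pos hm]
        split_ifs with hp
        · obtain ⟨k', hk', he⟩ := hp
          obtain rfl := hρ (Or.inl hk') (Or.inr hk) he
          rw [(hρ.mono Set.subset_union_left).leftInvOn_invFunOn hk']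
          exact .refl _
        · have hkp : k ∉ P.fsc := fun h => hp ⟨k, h, rfl⟩
          exact ((hj k).symm.up_of_idle (h1.idle hkp)).trans (ht.1 k (Or.inr hk))
      · beta_reduce
        rw [if_neg hj]
        split_ifs with hp
        · exact idle_none
        · exact hunion j hp hj
    · intro j
      beta_reduce
      by_cases hp : j ∈ ρ '' P.fsc
      · rw [if_pos hp, if_pos hp]
        by_cases hq : j ∈ ρ '' Q.fsc
        · rw [if_pos hq, if_pos hq]
          obtain ⟨k, hk, rfl⟩ := hp
          obtain ⟨k', hk', he⟩ := hq
          obtain rfl := hρ (Or.inr hk') (Or.inl hk) he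
          rw [(hρ.mono Set.subset_union_left).leftInvOn_invFunOn hk]
          have h3 := ht.1 _ (Or.inl hk)
          rcases hj k' with ⟨h0, -⟩ | ⟨h0, -⟩ | ⟨α, ha, hb, hc⟩
          · exact absurd h0 (h1.ne_none hk)
          · exact absurd h0 (h2.ne_none hk')
          -- A shared channel has the entry `⊥`, which is maximal, so weakening leaves it at `⊥`.
          · rw [hc] at h3
            rcases h3 with h3 | ⟨h3, -⟩ | ⟨h3, -⟩
            · rw [← h3, ha, hb]
              exact Or.inr (Or.inr ⟨α, rfl, rfl, rfl⟩)
            · cases h3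
            · cases h3
        · rw [if_neg hq, if_neg hq]
          exact .none_right _
      · rw [if_neg hp, if_neg hp]
        exact .none_left _
  | res P ih =>
    exact ih h (liftRen_injOn hρ) (ht.cons (.refl _) fun _ => Or.inr (Or.inr rfl))
  | repServ a P ih =>
    obtain ⟨α, ha, hi, h⟩ := h
    -- The body of a service is typed with no entry besides its own session, hence uses no other
    -- channel.
    have he : {k | k + 1 ∈ P.fsc} = ∅ :=
      Set.eq_empty_of_forall_notMem fun k hk => h.ne_none (k := k + 1) hk rfl
    refine ⟨α, ha, fun k => ht.2 k ?_, ih h (liftRen_injOn hρ) (Transfers.cons ?_ (.refl _) ?_)⟩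
    · simp [fsc, he]
    · exact ⟨fun k hk => .refl _, fun _ _ => idle_none⟩
    · exact fun h0 => h.idle h0
  | serv a P ih =>
    obtain ⟨α, ha, hi, h⟩ := h
    have he : {k | k + 1 ∈ P.fsc} = ∅ :=
      Set.eq_empty_of_forall_notMem fun k hk => h.ne_none (k := k + 1) hk rfl
    refine ⟨α, ha, fun k => ht.2 k ?_, ih h (liftRen_injOn hρ) (Transfers.cons ?_ (.refl _) ?_)⟩
    · simp [fsc, he]
    · exact ⟨fun k hk => .refl _, fun _ _ => idle_none⟩
    · exact fun h0 => h.idle h0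
  | request a P ih =>
    obtain ⟨α, ha, h⟩ := h
    exact ⟨α, ha, ih h (liftRen_injOn hρ) (ht.cons (.refl _) fun h0 => h.idle h0)⟩
  | input k P ih =>
    obtain ⟨S, α, h0, h⟩ := h
    exact ⟨S, α, ht.up_ty (Or.inl rfl) h0 (S.inp_ne_fin α), ih h (hρ.mono Set.subset_union_right)
      (ht.update hρ (Or.inl rfl) Set.subset_union_right insert_subset_of_subset_union
        fun hk => by simpa using h.idle hk)⟩
  | output k e P ih =>
    obtain ⟨S, α, h0, he, h⟩ := h
    exact ⟨S, α, ht.up_ty (Or.inl rfl) h0 (S.out_ne_fin α), he, ih h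
      (hρ.mono Set.subset_union_right)
      (ht.update hρ (Or.inl rfl) Set.subset_union_right insert_subset_of_subset_union
        fun hk => by simpa using h.idle hk)⟩
  | inputS k P ih =>
    obtain ⟨β, α, h0, h⟩ := h
    exact ⟨β, α, ht.up_ty (Or.inl rfl) h0 (by simp), ih h
      (liftRen_injOn (hρ.mono Set.subset_union_right)) (Transfers.cons
        (ht.update hρ (Or.inl rfl) Set.subset_union_right insert_subset_of_subset_union
        fun hk => by simpa [Sessions.cons] using h.idle (k := k + 1) hk)
        (.refl _) fun h0 => h.idle h0)⟩
  | deleg k k' P ih =>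
    obtain ⟨hne, β, α, h0, hup, h⟩ := h
    have hk' : k' ∉ P.fsc := fun hk' => h.ne_none hk' (by
      rw [Function.update_of_ne hne.symm, Function.update_self])
    refine ⟨fun he => hne (hρ (Or.inl (Or.inl rfl)) (Or.inl (Or.inr rfl)) he), β, α,
      ht.up_ty (Or.inl (Or.inl rfl)) h0 (by simp), hup.trans (ht.1 k' (Or.inl (Or.inr rfl))),
      ih h (hρ.mono Set.subset_union_right) ?_⟩
    have h1 : Transfers ({k} ∪ P.fsc) ρ (Function.update Δ k' none)
        (Function.update Δ' (ρ k') none) := by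
      refine ht.update hρ (Or.inl (Or.inr rfl)) ?_ ?_ fun _ => idle_none
      · rintro i (hi | hi)
        · exact Or.inl (Or.inl hi)
        · exact Or.inr hi
      · rintro i ((hi | hi) | hi)
        · exact Or.inr (Or.inl hi)
        · exact Or.inl hi
        · exact Or.inr (Or.inr hi)
    refine h1.update (hρ.mono ?_) (Or.inl rfl) Set.subset_union_right insert_subset_of_subset_union
        fun hk => by simpa using h.idle hk
    rintro i (hi | hi)
    · exact Or.inl (Or.inl hi)
    · exact Or.inr hi
  | branch k I hI P ih =>
    obtain ⟨α, h0, h⟩ := h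
    refine ⟨α, ht.up_ty (Or.inl rfl) h0 (by simp), fun l => ?_⟩
    have hsub : (P l).fsc ⊆ (Proc.branch k I hI P).fsc :=
      (Set.subset_iUnion (fun l => (P l).fsc) l).trans Set.subset_union_right
    refine ih l (h l) (hρ.mono hsub) ⟨fun i hi => ?_, fun j hj => ?_⟩
    · by_cases hik : i = k
      · subst hik
        simpa using Up.refl _
      · rw [Function.update_of_ne hik,
          Function.update_of_ne fun h => hik (hρ (hsub hi) (Or.inl rfl) h)]
        exact ht.1 i (hsub hi)
    · by_cases hjk : j = ρ k
      · subst hjk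
        simpa using (h l).idle (k := k) fun hk => hj ⟨k, hk, rfl⟩
      · rw [Function.update_of_ne hjk]
        by_cases hjm : j ∈ ρ '' (Proc.branch k I hI P).fsc
        · obtain ⟨i, hi, rfl⟩ := hjm
          have hik : i ≠ k := fun hh => hjk (by rw [hh])
          refine (ht.1 i hi).idle ?_
          exact idle_of_ne hik ((h l).idle fun hh => hj ⟨i, hh, rfl⟩)
        · exact ht.2 j hjm
  | select k l P ih =>
    obtain ⟨I, hI, α, hj, h0, h⟩ := h
    exact ⟨I, hI, α, hj, ht.up_ty (Or.inl rfl) h0 (by simp), ih h (hρ.mono Set.subset_union_right)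
      (ht.update hρ (Or.inl rfl) Set.subset_union_right insert_subset_of_subset_union
        fun hk => by simpa using h.idle hk)⟩
  | ifte e P Q ihP ihQ =>
    obtain ⟨he, h1, h2⟩ := h
    have hor : ∀ j, j ∉ ρ '' P.fsc → j ∈ ρ '' (Proc.ifte e P Q).fsc → Idle (Δ' j) := by
      rintro j hj ⟨i, hi, rfl⟩
      exact (ht.1 i hi).idle (h1.idle fun hh => hj ⟨i, hh, rfl⟩)
    have hor' : ∀ j, j ∉ ρ '' Q.fsc → j ∈ ρ '' (Proc.ifte e P Q).fsc → Idle (Δ' j) := by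
      rintro j hj ⟨i, hi, rfl⟩
      exact (ht.1 i hi).idle (h2.idle fun hh => hj ⟨i, hh, rfl⟩)
    refine ⟨he, ihP h1 (hρ.mono Set.subset_union_left) ⟨fun k hk => ht.1 k (Or.inl hk),
      fun j hj => ?_⟩, ihQ h2 (hρ.mono Set.subset_union_right) ⟨fun k hk => ht.1 k (Or.inr hk),
      fun j hj => ?_⟩⟩
    · by_cases hm : j ∈ ρ '' (Proc.ifte e P Q).fsc
      · exact hor j hj hm
      · exact ht.2 j hm
    · by_cases hm : j ∈ ρ '' (Proc.ifte e P Q).fsc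
      · exact hor' j hj hm
      · exact ht.2 j hm

theorem Ty.transfer {Γ : ServEnv D} {P : Proc D} {Δ Δ' : SessEnv D} (h : Ty Γ P Δ)
    (h1 : ∀ k ∈ P.fsc, Up (Δ k) (Δ' k)) (h2 : ∀ k, k ∉ P.fsc → Idle (Δ' k)) : Ty Γ P Δ' := by
  have := h.renS (ρ := id) (Δ' := Δ') Function.injective_id.injOn ⟨h1, by simpa using h2⟩
  rwa [renS_id] at this

theorem Ty.up {Γ : ServEnv D} {P : Proc D} {Δ Δ' : SessEnv D} (h : Ty Γ P Δ)
    (h1 : ∀ k, Up (Δ k) (Δ' k)) : Ty Γ P Δ' :=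
  h.transfer (fun k _ => h1 k) fun k hk => (h1 k).idle (h.idle hk)

theorem Ty.unshift {Γ : ServEnv D} {P : Proc D} {Δ : SessEnv D} (h : Ty Γ (P.renS Nat.succ) Δ) :
    Ty Γ P (fun k => Δ (k + 1)) := by
  have := h.renS (ρ := Nat.pred) (Δ' := fun k => Δ (k + 1)) ?_ ⟨?_, ?_⟩
  · rwa [renS_renS, show Nat.pred ∘ Nat.succ = id from rfl, renS_id] at this
  · rw [fsc_renS]
    rintro _ ⟨a, -, rfl⟩ _ ⟨b, -, rfl⟩ hab
    exact congrArg Nat.succ hab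
  · rw [fsc_renS]
    rintro _ ⟨a, -, rfl⟩
    exact .refl _
  · intro j hj
    refine h.idle (k := j + 1) fun hk => hj ⟨j + 1, hk, rfl⟩

theorem Ty.shift {Γ : ServEnv D} {P : Proc D} {Δ : SessEnv D} (h : Ty Γ P Δ) :
    Ty Γ (P.renS Nat.succ) (cons none Δ) := by
  refine h.renS Nat.succ_injective.injOn ⟨fun k _ => .refl _, ?_⟩
  rintro (j | j) hj
  · exact idle_none
  · exact h.idle fun hh => hj ⟨j, hh, rfl⟩

/-- Subject congruence. -/
theorem Congr.ty_iff {P Q : Proc D} (h : Congr P Q) {Γ : ServEnv D} {Δ : SessEnv D} :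
    Ty Γ P Δ ↔ Ty Γ Q Δ := by
  induction h generalizing Γ Δ with
  | refl => exact Iff.rfl
  | symm _ ih => exact ih.symm
  | trans _ _ ih ih' => exact ih.trans ih'
  | par_comm P Q =>
    constructor <;> rintro ⟨Δ₁, Δ₂, h1, h2, hj⟩ <;>
      exact ⟨Δ₂, Δ₁, h2, h1, fun k => (hj k).symm⟩
  | par_assoc P Q R =>
    constructor
    · rintro ⟨Δ₁, Δ', h1, ⟨Δ₂, Δ₃, h2, h3, hj⟩, hj'⟩
      choose Δ'' ha hb using fun k => (hj k).assoc (hj' k)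
      exact ⟨Δ'', Δ₃, ⟨Δ₁, Δ₂, h1, h2, ha⟩, h3, hb⟩
    · rintro ⟨Δ', Δ₃, ⟨Δ₁, Δ₂, h1, h2, hj⟩, h3, hj'⟩
      choose Δ'' ha hb using fun k => (hj k).assoc' (hj' k)
      exact ⟨Δ₁, Δ'', h1, ⟨Δ₂, Δ₃, h2, h3, ha⟩, hb⟩
  | par_nil P =>
    constructor
    · rintro ⟨Δ₁, Δ₂, h1, h2, hj⟩
      exact h1.up fun k => (hj k).up_of_idle (h2 k)
    · intro h
      exact ⟨Δ, fun _ => none, h, fun _ => idle_none, fun k => .none_right _⟩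
  | extrude P Q =>
    constructor
    · rintro ⟨Δ₁, Δ₂, h1, h2, hj⟩
      refine ⟨cons none Δ₁, cons (some .bot) Δ₂, h1.shift, h2, ?_⟩
      rintro (k | k)
      · exact .none_left _
      · exact hj k
    · rintro ⟨Δ₁, Δ₂, h1, h2, hj⟩
      -- The weakened copy does not use the channel `0`, so the `⊥` of the restriction can be
      -- charged to `Q` alone.
      have h0 : Idle (Δ₁ 0) := h1.idle (by simp [fsc_renS])
      refine ⟨_, fun k => Δ₂ (k + 1), h1.unshift, ?_, fun k => hj (k + 1)⟩
      refine h2.up ?_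
      rintro (k | k)
      · exact (hj 0).symm.up_of_idle h0
      · exact .refl _
  | res_nil =>
    constructor
    · exact fun h k => h (k + 1)
    · rintro h (k | k)
      · exact Or.inr (Or.inr rfl)
      · exact h k
  | branch k I hI _ ih => simp only [Ty, ih]
  | _ => simp_all [Ty]

/-! ### Comparison with the given typing judgement -/

theorem joined_join {Δ₁ Δ₂ : SessEnv D} (h : Compat Δ₁ Δ₂) (k : ℕ) :
    Joined (Δ₁ k) (Δ₂ k) (join Δ₁ Δ₂ k) := by
  unfold join
  have hk := h k
  cases h1 : Δ₁ k with
  | none => exact .none_left _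
  | some u =>
    cases h2 : Δ₂ k with
    | none => exact .none_right _
    | some v =>
      obtain ⟨α, rfl, rfl⟩ := hk u v h1 h2
      exact Or.inr (Or.inr ⟨α, rfl, rfl, rfl⟩)

theorem join_of_joined {Δ₁ Δ₂ Δ : SessEnv D} (h : ∀ k, Joined (Δ₁ k) (Δ₂ k) (Δ k)) :
    Compat Δ₁ Δ₂ ∧ join Δ₁ Δ₂ = Δ := by
  constructor
  · intro k u v h1 h2
    have := h k
    rw [h1, h2] at this
    rcases this with ⟨h, -⟩ | ⟨h, -⟩ | ⟨α, h, h', -⟩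
    · cases h
    · cases h
    · exact ⟨α, Option.some.inj h, Option.some.inj h'⟩
  · funext k
    unfold join
    rcases h k with ⟨h1, h2⟩ | ⟨h1, h2⟩ | ⟨α, h1, h2, h3⟩
    · rw [h1, h2]
    · rw [h1, h2]
      cases Δ₁ k <;> rfl
    · rw [h1, h2, h3]

theorem Completed.idle {Δ : SessEnv D} (h : Completed Δ) (k : ℕ) : Idle (Δ k) := by
  cases hk : Δ k with
  | none => exact idle_none
  | some u => exact Or.inr (Or.inl (by rw [h k u hk]))

/-- The rule `bot` is the only one that is not syntax-directed; weakening (`Ty.up`) absorbs it. -/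
theorem Typed.ty {Γ : ServEnv D} {P : Proc D} {Δ : SessEnv D} (h : Typed Γ P Δ) : Ty Γ P Δ := by
  induction h with
  | serv ha hc _ ih => exact ⟨_, ha, hc.idle, ih⟩
  | repServ ha hc _ ih => exact ⟨_, ha, hc.idle, ih⟩
  | request ha _ ih => exact ⟨_, ha, ih⟩
  | input h0 _ ih => exact ⟨_, _, h0, ih⟩
  | output h0 he _ ih => exact ⟨_, _, h0, he, ih⟩
  | inputS h0 _ ih => exact ⟨_, _, h0, ih⟩
  | deleg hne h0 h1 _ ih => exact ⟨hne, _, _, h0, h1 ▸ .refl _, ih⟩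
  | branch h0 _ ih => exact ⟨_, h0, ih⟩
  | select j h0 _ ih => exact ⟨_, _, _, j.2, h0, ih⟩
  | par _ _ hc ih ih' => exact ⟨_, _, ih, ih', joined_join hc⟩
  | nil hc => exact hc.idle
  | res _ ih => exact ih
  | ifte he _ _ ih ih' => exact ⟨he, ih, ih'⟩
  | @bot Γ P Δ k h0 _ ih =>
    refine ih.up fun j => ?_
    by_cases hj : j = k
    · subst hj
      rw [h0, Function.update_self]
      exact Or.inr (Or.inl ⟨rfl, rfl⟩)
    · rw [Function.update_of_ne hj]
      exact .refl _

/-- The rule `bot` raises one channel at a time, so a derivation reaches only finitely many. This is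
the source of the finiteness assumption in `Ty.typed`. -/
theorem Typed.weaken_end {Γ : ServEnv D} {P : Proc D} {Δ : SessEnv D} (h : Typed Γ P Δ)
    (s : Finset ℕ) {Δ' : SessEnv D} (hs : ∀ k, k ∉ s → Δ' k = Δ k)
    (hb : ∀ k ∈ s, Δ' k = Δ k ∨ (Δ k = some (.ty .fin) ∧ Δ' k = some .bot)) : Typed Γ P Δ' := by
  induction s using Finset.induction_on generalizing Δ' with
  | empty =>
    obtain rfl : Δ' = Δ := funext fun k => hs k (Finset.notMem_empty k)
    exact h
  | insert a s ha ih =>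
    have h2 : Typed Γ P (Function.update Δ' a (Δ a)) := by
      refine ih (fun k hk => ?_) fun k hk => ?_
      · by_cases hka : k = a
        · subst hka
          simp
        · rw [Function.update_of_ne hka]
          exact hs k (by simp [hka, hk])
      · have hka : k ≠ a := by
          rintro rfl
          exact ha hk
        rw [Function.update_of_ne hka]
        exact hb k (Finset.mem_insert_of_mem hk)
    rcases hb a (Finset.mem_insert_self a s) with h3 | ⟨h3, h4⟩
    · rwa [← h3, Function.update_eq_self] at h2
    · rw [h3] at h2
      exact .bot h4 h2

/-- The channels that an environment types. -/
def sessDom (Δ : SessEnv D) : Set ℕ := {k | Δ k ≠ none}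

theorem finite_sessDom_cons {Δ : SessEnv D} (h : (sessDom Δ).Finite) (u : Option (Use D)) :
    (sessDom (cons u Δ)).Finite := by
  refine ((h.image Nat.succ).insert 0).subset ?_
  rintro (k | k) hk
  · exact Or.inl rfl
  · exact Or.inr ⟨k, hk, rfl⟩

theorem finite_sessDom_update {Δ : SessEnv D} (h : (sessDom Δ).Finite) (k : ℕ)
    (u : Option (Use D)) : (sessDom (Function.update Δ k u)).Finite := by
  refine (h.insert k).subset fun j hj => ?_
  by_cases hjk : j = k
  · exact Or.inl hjk
  · exact Or.inr (update_ne_none hjk hj)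

/-- Entries `⊥` are lowered to `end`, where the rules for inaction and services apply, and are then
raised again. -/
theorem typed_of_completed {Γ : ServEnv D} {P : Proc D} {Δ : SessEnv D}
    (hfin : (sessDom Δ).Finite) (hi : ∀ k, Idle (Δ k))
    (h : ∀ Δ', Completed Δ' → Typed Γ P Δ') : Typed Γ P Δ := by
  classical
  refine (h (fun k => if Δ k = none then none else some (.ty .fin)) ?_).weaken_end hfin.toFinset
    ?_ ?_
  · intro k u hk
    beta_reduce at hk
    split_ifs at hk
    exact (Option.some.inj hk).symm
  · intro k hk
    have : Δ k = none := by simpa [sessDom] using hk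
    simp [this]
  · intro k hk
    have h0 : Δ k ≠ none := by simpa [sessDom] using hk
    rw [if_neg h0]
    rcases hi k with hk | hk | hk
    · exact absurd hk h0
    · exact Or.inl hk
    · exact Or.inr ⟨rfl, hk⟩

theorem Ty.typed {Γ : ServEnv D} {P : Proc D} {Δ : SessEnv D} (h : Ty Γ P Δ)
    (hfin : (sessDom Δ).Finite) : Typed Γ P Δ := by
  induction P generalizing Γ Δ with
  | nil => exact typed_of_completed hfin h fun _ => .nil
  | par P Q ihP ihQ =>
    obtain ⟨Δ₁, Δ₂, h1, h2, hj⟩ := h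
    obtain ⟨hc, rfl⟩ := join_of_joined hj
    refine .par (ihP h1 (hfin.subset fun k hk h0 => hk ?_))
      (ihQ h2 (hfin.subset fun k hk h0 => hk ?_))
      hc
    · exact (h0 ▸ hj k).of_none.1
    · exact (h0 ▸ hj k).of_none.2
  | res P ih => exact .res (ih h (finite_sessDom_cons hfin _))
  | repServ a P ih =>
    obtain ⟨α, ha, hi, h⟩ := h
    have h' := ih h (finite_sessDom_cons (by simp [sessDom]) _)
    exact typed_of_completed hfin hi fun _ hc => .repServ ha hc h'
  | serv a P ih =>
    obtain ⟨α, ha, hi, h⟩ := h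
    have h' := ih h (finite_sessDom_cons (by simp [sessDom]) _)
    exact typed_of_completed hfin hi fun _ hc => .serv ha hc h'
  | request a P ih =>
    obtain ⟨α, ha, h⟩ := h
    exact .request ha (ih h (finite_sessDom_cons hfin _))
  | input k P ih =>
    obtain ⟨S, α, h0, h⟩ := h
    exact .input h0 (ih h (finite_sessDom_update hfin _ _))
  | output k e P ih =>
    obtain ⟨S, α, h0, he, h⟩ := h
    exact .output h0 he (ih h (finite_sessDom_update hfin _ _))
  | inputS k P ih =>
    obtain ⟨β, α, h0, h⟩ := h
    exact .inputS h0 (ih h (finite_sessDom_cons (finite_sessDom_update hfin _ _) _))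
  | deleg k k' P ih =>
    obtain ⟨hne, β, α, h0, hup, h⟩ := h
    have h' := ih h (finite_sessDom_update (finite_sessDom_update hfin _ _) _ _)
    rcases hup with h1 | ⟨h1, h2⟩ | ⟨h1, -⟩
    · exact .deleg hne h0 h1.symm h'
    · obtain rfl : β = .fin := by simpa using h1
      -- The rule `bot` at `k'` restores the type `end` that the delegation rule expects of its
      -- object.
      refine .bot h2 (.deleg (β := .fin) (α := α) hne ?_ ?_ ?_)
      · rwa [Function.update_of_ne hne]
      · simp
      · rwa [Function.update_idem]
    · cases h1
  | branch k I hI P ih =>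
    obtain ⟨α, h0, h⟩ := h
    exact .branch h0 fun l => ih l (h l) (finite_sessDom_update hfin _ _)
  | select k l P ih =>
    obtain ⟨I, hI, α, hj, h0, h⟩ := h
    exact .select ⟨l, hj⟩ h0 (ih h (finite_sessDom_update hfin _ _))
  | ifte e P Q ihP ihQ => exact .ifte h.1 (ihP h.2.1 hfin) (ihQ h.2.2 hfin)

open Classical in
/-- The restriction of a session typing to a set of channels. -/
noncomputable def restrictEnv (s : Set ℕ) (Δ : SessEnv D) : SessEnv D :=
  fun k => if k ∈ s then Δ k else none

theorem Ty.restrictEnv {Γ : ServEnv D} {P : Proc D} {Δ : SessEnv D} (h : Ty Γ P Δ) :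
    Ty Γ P (restrictEnv P.fsc Δ) := by
  refine h.transfer (fun k hk => ?_) fun k hk => ?_
  · rw [Sessions.restrictEnv, if_pos hk]
    exact .refl _
  · rw [Sessions.restrictEnv, if_neg hk]
    exact idle_none

/-- All names are service channels. -/
def ServiceEnv (Γ : ServEnv D) : Prop := ∀ a S, Γ a = some S → ∃ α, S = .chan α

/-- Cutting an environment down to the finitely many free channels of `P` makes `Ty.typed`
applicable. -/
theorem wellTyped_iff {P : Proc D} : WellTyped P ↔ ∃ Γ Δ, ServiceEnv Γ ∧ Ty Γ P Δ := by
  constructor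
  · rintro ⟨Γ, Δ, hΓ, h⟩
    exact ⟨Γ, Δ, hΓ, h.ty⟩
  · rintro ⟨Γ, Δ, hΓ, h⟩
    refine ⟨Γ, restrictEnv P.fsc Δ, hΓ, h.restrictEnv.typed (P.finite_fsc.subset fun k hk => ?_)⟩
    by_contra hn
    exact hk (by rw [restrictEnv, if_neg hn])

/-! ### Substitution of values for names -/

theorem ValTyped.subst {Γ Γ' : ServEnv D} {σ : ℕ → Val D}
    (hσ : ∀ a S, Γ a = some S → ValTyped Γ' (σ a) S) {v : Val D} {S : Srt D}
    (h : ValTyped Γ v S) : ValTyped Γ' (v.subst σ) S := by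
  cases h with
  | name h => exact hσ _ _ h
  | const b c => exact .const b c

theorem ExprTyped.subst {Γ Γ' : ServEnv D} {σ : ℕ → Val D}
    (hσ : ∀ a S, Γ a = some S → ValTyped Γ' (σ a) S) {e : Expr D} {S : Srt D}
    (h : ExprTyped Γ e S) : ExprTyped Γ' (e.subst σ) S := by
  induction h with
  | val h => exact .val (h.subst hσ)
  | op o args _ ih => exact .op o _ ih

theorem valTyped_liftSubst {Γ Γ' : ServEnv D} {σ : ℕ → Val D}
    (hσ : ∀ a S, Γ a = some S → ValTyped Γ' (σ a) S) (T : Srt D) :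
    ∀ a S, cons (some T) Γ a = some S → ValTyped (cons (some T) Γ') (liftSubst σ a) S := by
  rintro (a | a) S h
  · exact .name h
  · exact (hσ a S h).subst (Γ' := cons (some T) Γ') (σ := fun m => .name (m + 1))
      fun b S hb => .name hb

theorem Ty.subst {Γ Γ' : ServEnv D} {σ : ℕ → Val D}
    (hσ : ∀ a S, Γ a = some S → ValTyped Γ' (σ a) S) {P : Proc D} {Δ : SessEnv D}
    (h : Ty Γ P Δ) : Ty Γ' (P.subst σ) Δ := by
  induction P generalizing Γ Γ' σ Δ with
  | nil => exact h
  | par P Q ihP ihQ =>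
    obtain ⟨Δ₁, Δ₂, h1, h2, hj⟩ := h
    exact ⟨Δ₁, Δ₂, ihP hσ h1, ihQ hσ h2, hj⟩
  | res P ih => exact ih hσ h
  | repServ a P ih =>
    obtain ⟨α, ha, hi, h⟩ := h
    exact ⟨α, ha.subst hσ, hi, ih hσ h⟩
  | serv a P ih =>
    obtain ⟨α, ha, hi, h⟩ := h
    exact ⟨α, ha.subst hσ, hi, ih hσ h⟩
  | request a P ih =>
    obtain ⟨α, ha, h⟩ := h
    exact ⟨α, ha.subst hσ, ih hσ h⟩
  | input k P ih =>
    obtain ⟨S, α, h0, h⟩ := h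
    exact ⟨S, α, h0, ih (valTyped_liftSubst hσ S) h⟩
  | output k e P ih =>
    obtain ⟨S, α, h0, he, h⟩ := h
    exact ⟨S, α, h0, he.subst hσ, ih hσ h⟩
  | inputS k P ih =>
    obtain ⟨β, α, h0, h⟩ := h
    exact ⟨β, α, h0, ih hσ h⟩
  | deleg k k' P ih =>
    obtain ⟨hne, β, α, h0, hup, h⟩ := h
    exact ⟨hne, β, α, h0, hup, ih hσ h⟩
  | branch k I hI P ih =>
    obtain ⟨α, h0, h⟩ := h
    exact ⟨α, h0, fun l => ih l hσ (h l)⟩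
  | select k l P ih =>
    obtain ⟨I, hI, α, hj, h0, h⟩ := h
    exact ⟨I, hI, α, hj, h0, ih hσ h⟩
  | ifte e P Q ihP ihQ => exact ⟨h.1.subst hσ, ihP hσ h.2.1, ihQ hσ h.2.2⟩

theorem Ty.inst {Γ : ServEnv D} {S : Srt D} {v : Val D} (hv : ValTyped Γ v S) {P : Proc D}
    {Δ : SessEnv D} (h : Ty (cons (some S) Γ) P Δ) : Ty Γ (P.inst v) Δ := by
  refine h.subst ?_
  rintro (a | a) T ha
  · obtain rfl : S = T := Option.some.inj ha
    exact hv
  · exact .name ha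

theorem Eval.valTyped {Γ : ServEnv D} {e : Expr D} {v : Val D} (h : Eval e v) {S : Srt D}
    (he : ExprTyped Γ e S) : ValTyped Γ v S := by
  cases h with
  | val v =>
    cases he with
    | val hv => exact hv
  | op o args c _ =>
    cases he with
    | op => exact .const _ _

theorem ValTyped.chan_unique {Γ : ServEnv D} {a : Val D} {α β : SType D}
    (h : ValTyped Γ a (.chan α)) (h' : ValTyped Γ a (.chan β)) : α = β := by
  cases h with
  | name h =>
    cases h' with
    | name h' =>
      rw [h] at h'
      simpa using h'

/-! ### Subject reduction -/

theorem Srt.dual_out (S : Srt D) (α : SType D) : (S.out α).dual = S.inp α.dual := by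
  cases S <;> rfl

theorem Srt.inp_injective {S T : Srt D} {α β : SType D} (h : S.inp α = T.inp β) :
    S = T ∧ α = β := by
  cases S <;> cases T <;> simp_all [Srt.inp]

theorem joined_update {Δ₁ Δ₂ Δ : SessEnv D} (hj : ∀ k, Joined (Δ₁ k) (Δ₂ k) (Δ k)) {k : ℕ}
    {u v : Option (Use D)} (h : Joined u v (Δ k)) (j : ℕ) :
    Joined (Function.update Δ₁ k u j) (Function.update Δ₂ k v j) (Δ j) := by
  by_cases hjk : j = k
  · subst hjk
    simpa using h
  · rw [Function.update_of_ne hjk, Function.update_of_ne hjk]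
    exact hj j

theorem Ty.session_par {Γ : ServEnv D} {P Q : Proc D} {α : SType D} {Δ₁ Δ₂ Δ : SessEnv D}
    (hi : ∀ k, Idle (Δ₁ k)) (h1 : Ty Γ P (cons (some (.ty α)) fun _ => none))
    (h2 : Ty Γ Q (cons (some (.ty α.dual)) Δ₂)) (hj : ∀ k, Joined (Δ₁ k) (Δ₂ k) (Δ k)) :
    Ty Γ (.res (.par P Q)) Δ := by
  refine ⟨_, cons (some (.ty α.dual)) Δ, h1, h2.up ?_, ?_⟩
  · rintro (k | k)
    · exact .refl _
    · exact (hj k).symm.up_of_idle (hi k)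
  · rintro (k | k)
    · exact .bot_ty
    · exact .none_left _

theorem Red.ty {P P' : Proc D} (hr : Red P P') {Γ : ServEnv D} {Δ : SessEnv D} (h : Ty Γ P Δ) :
    Ty Γ P' Δ := by
  induction hr generalizing Γ Δ with
  | rinit a P Q =>
    obtain ⟨Δ₁, Δ₂, ⟨α, ha, hi, h1⟩, ⟨β, hb, h2⟩, hj⟩ := h
    obtain rfl := ha.chan_unique hb
    refine ⟨Δ₁, Δ₂, ⟨α, ha, hi, h1⟩, h1.session_par (Δ₁ := fun _ => none) (fun _ => idle_none) h2
      fun _ => .none_left _, hj⟩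
  | init a P Q =>
    obtain ⟨Δ₁, Δ₂, ⟨α, ha, hi, h1⟩, ⟨β, hb, h2⟩, hj⟩ := h
    obtain rfl := ha.chan_unique hb
    exact h1.session_par hi h2 hj
  | com k P e v Q he =>
    obtain ⟨Δ₁, Δ₂, ⟨S, α, h1, hP⟩, ⟨T, β, h2, hT, hQ⟩, hj⟩ := h
    have hk := hj k
    rw [h1, h2] at hk
    obtain ⟨hd, hb⟩ := hk.ty_ty
    rw [Srt.dual_out] at hd
    obtain ⟨rfl, rfl⟩ := Srt.inp_injective hd
    exact ⟨_, _, hP.inst (he.valTyped hT), hQ,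
      joined_update hj (hb ▸ Or.inr (Or.inr ⟨β, rfl, rfl, rfl⟩))⟩
  | del k k' P Q hfree =>
    obtain ⟨Δ₁, Δ₂, ⟨β, α, h1, hP⟩, ⟨hne, β', α', h2, hup, hQ⟩, hj⟩ := h
    have hk := hj k
    rw [h1, h2] at hk
    obtain ⟨hd, hb⟩ := hk.ty_ty
    simp only [SType.dual, SType.inpS.injEq] at hd
    obtain ⟨rfl, rfl⟩ := hd
    have hidle : Idle (Δ₁ k') := by
      have := hP.idle (k := k' + 1) hfree
      change Idle (Function.update Δ₁ k _ k') at this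
      rwa [Function.update_of_ne hne.symm] at this
    have hup' : Up (some (.ty β)) (Δ k') := hup.trans ((hj k').symm.up_of_idle hidle)
    -- The receiver takes over the whole entry `Δ k'`, possibly already `⊥`, while the sender is
    -- left with `none` there.
    refine ⟨Function.update (Function.update Δ₁ k' (Δ k')) k (some (.ty α'.dual)), _,
      hP.renS ?_ ⟨?_, ?_⟩, hQ, joined_update (joined_update hj (.none_right _))
        (hb ▸ Or.inr (Or.inr ⟨α', rfl, rfl, rfl⟩))⟩
    · rintro (a | a) ha (b | b) hb hab
      · rfl
      · exact absurd ((show k' = b from hab) ▸ hb) hfree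
      · exact absurd ((show a = k' from hab) ▸ ha) hfree
      · exact congrArg Nat.succ hab
    · rintro (a | a) ha
      · change Up (some (.ty β))
          ((Function.update (Function.update Δ₁ k' (Δ k')) k _ : SessEnv D) k')
        rw [Function.update_of_ne hne.symm, Function.update_self]
        exact hup'
      · have hak : a ≠ k' := by
          rintro rfl
          exact hfree ha
        change Up ((Function.update Δ₁ k (some (.ty α'.dual)) : SessEnv D) a)
          ((Function.update (Function.update Δ₁ k' (Δ k')) k _ : SessEnv D) a)
        rw [Function.update_comm hne.symm, Function.update_of_ne hak]
        exact .refl _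
    · intro j hj'
      by_cases hjk : j = k'
      · subst hjk
        rw [Function.update_of_ne hne.symm, Function.update_self]
        exact up_none.1 (.trans (up_none.2 (hP.idle (k := 0) fun h0 => hj' ⟨0, h0, rfl⟩)) hup')
      · rw [Function.update_comm hne.symm, Function.update_of_ne hjk]
        exact hP.idle (k := j + 1) fun h0 => hj' ⟨j + 1, h0, rfl⟩
  | sel k I hI P j Q =>
    obtain ⟨Δ₁, Δ₂, ⟨α, h1, hP⟩, ⟨I', hI', α', hj', h2, hQ⟩, hj⟩ := h
    have hk := hj k
    rw [h1, h2] at hk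
    obtain ⟨hd, hb⟩ := hk.ty_ty
    simp only [SType.dual, SType.bra.injEq] at hd
    obtain ⟨rfl, hd⟩ := hd
    obtain rfl := eq_of_heq hd
    exact ⟨_, _, hP j, hQ, joined_update hj (hb ▸ Or.inr (Or.inr ⟨α' j, rfl, rfl, rfl⟩))⟩
  | par Q _ ih =>
    obtain ⟨Δ₁, Δ₂, h1, h2, hj⟩ := h
    exact ⟨Δ₁, Δ₂, ih h1, h2, hj⟩
  | res _ ih => exact ih h
  | str hc _ hc' ih => exact hc'.ty_iff.1 (ih (hc.ty_iff.1 h))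
  | ifT e P Q _ => exact h.2.1
  | ifF e P Q _ => exact h.2.2

/-! ### Reduction preserves hereditary acyclicity -/

/-- A channel with a session type labels at most one node. -/
theorem Ty.node_unique {Γ : ServEnv D} {P : Proc D} {Δ : SessEnv D} (h : Ty Γ P Δ) {k : ℕ}
    (hk : Δ k ≠ some .bot) {p q : (graph P).Node} (hp : k ∈ (graph P).lab p)
    (hq : k ∈ (graph P).lab q) : p = q := by
  induction P generalizing Γ Δ k with
  | nil => exact p.elim
  | par P Q ihP ihQ =>
    obtain ⟨Δ₁, Δ₂, h1, h2, hj⟩ := h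
    have hjk := hj k
    -- An entry other than `⊥` comes from one component only, and the other component then does not
    -- use the channel.
    have aux : Δ₁ k ≠ none → Δ₁ k ≠ some .bot ∧ Δ₂ k = none := by
      intro h0
      rcases hjk with ⟨h, -⟩ | ⟨h, h'⟩ | ⟨α, -, -, h⟩
      · exact absurd h h0
      · exact ⟨h' ▸ hk, h⟩
      · exact absurd h hk
    have aux' : Δ₂ k ≠ none → Δ₂ k ≠ some .bot ∧ Δ₁ k = none := by
      intro h0
      rcases hjk with ⟨h, h'⟩ | ⟨h, -⟩ | ⟨α, -, -, h⟩
      · exact ⟨h' ▸ hk, h⟩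
      · exact absurd h h0
      · exact absurd h hk
    rcases p with p | p <;> rcases q with q | q
    · have := aux (h1.ne_none (lab_subset_fsc P p hp))
      exact congrArg Sum.inl (ihP h1 this.1 hp hq)
    · have := aux (h1.ne_none (lab_subset_fsc P p hp))
      exact absurd this.2 (h2.ne_none (lab_subset_fsc Q q hq))
    · have := aux' (h2.ne_none (lab_subset_fsc Q p hp))
      exact absurd this.2 (h1.ne_none (lab_subset_fsc P q hq))
    · have := aux' (h2.ne_none (lab_subset_fsc Q p hp))
      exact congrArg Sum.inr (ihQ h2 this.1 hp hq)
  | res P ih => exact ih (k := k + 1) h hk hp hq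
  | _ => rfl

theorem Joined.ne_bot {u v w : Option (Use D)} (h : Joined u v w) (hu : u ≠ none)
    (hv : v ≠ none) : u ≠ some .bot := by
  rcases h with ⟨h, -⟩ | ⟨h, -⟩ | ⟨α, rfl, -, -⟩
  · exact absurd h hu
  · exact absurd h hv
  · simp

/-- A shared channel has a session type on either side, so it labels one node in each graph and
yields one cross edge. With at most one shared channel `Bridged.compose` applies. -/
theorem HAcyclic.par {Γ : ServEnv D} {P Q : Proc D} {Δ : SessEnv D} (hP : HAcyclic P)
    (hQ : HAcyclic Q) (h : Ty Γ (.par P Q) Δ)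
    (hu : ∀ k k', k ∈ P.fsc → k ∈ Q.fsc → k' ∈ P.fsc → k' ∈ Q.fsc → k = k') :
    HAcyclic (.par P Q) := by
  obtain ⟨Δ₁, Δ₂, h1, h2, hj⟩ := h
  refine ⟨hP, hQ, hP.bridged.compose hQ.bridged ?_⟩
  rintro ⟨⟨p, q, k⟩, hp, hq⟩ ⟨⟨p', q', k'⟩, hp', hq'⟩
  have hkP := lab_subset_fsc P p hp
  have hkQ := lab_subset_fsc Q q hq
  obtain rfl : k = k' := hu k k' hkP hkQ (lab_subset_fsc P p' hp') (lab_subset_fsc Q q' hq')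
  obtain rfl := h1.node_unique ((hj k).ne_bot (h1.ne_none hkP) (h2.ne_none hkQ)) hp hp'
  obtain rfl := h2.node_unique ((hj k).symm.ne_bot (h2.ne_none hkQ) (h1.ne_none hkP)) hq hq'
  rfl

/-- Linearity supplies the uniqueness condition of `Bridged.replace`: a channel shared with `R` is
not `⊥` in the typing of `P`. -/
theorem HAcyclic.replace {Γ : ServEnv D} {V : Set ℕ} {P R : Proc D} {Δ : SessEnv D}
    (hV : ((SGraph.single V).compose (graph R)).Bridged) (hP : HAcyclic P) (hR : HAcyclic R)
    (hs : P.fsc ⊆ V) (h : Ty Γ (.par P R) Δ) : HAcyclic (.par P R) := by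
  obtain ⟨Δ₁, Δ₂, h1, h2, hj⟩ := h
  refine ⟨hP, hR, hV.replace hP.bridged (fun p => (lab_subset_fsc P p).trans hs) ?_⟩
  intro p p' r k hp hp' hr
  exact h1.node_unique ((hj k).ne_bot (h1.ne_none (lab_subset_fsc P p hp))
    (h2.ne_none (lab_subset_fsc R r hr))) hp hp'

/-- Each shared channel is an edge between the same two nodes, and no cut is crossed by just one of
two parallel edges. -/
theorem HAcyclic.shared_unique {P Q : Proc D} (h : HAcyclic (.par P Q)) (hP : P.IsPrefix)
    (hQ : Q.IsPrefix) {k k' : ℕ} (h1 : k ∈ P.fsc) (h2 : k ∈ Q.fsc) (h1' : k' ∈ P.fsc)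
    (h2' : k' ∈ Q.fsc) : k = k' := by
  have hb := h.2.2
  rw [graph_prefix hP, graph_prefix hQ] at hb
  obtain ⟨A, hA⟩ := hb (.inr ⟨((), (), k), h1, h2⟩)
  by_contra hne
  have h3 := hA.2 (.inr ⟨((), (), k'), h1', h2'⟩)
    fun h => hne (cross_inj (Sum.inr.inj h)).2.2.symm
  have h4 := hA.1
  exact (iff_not_self (h3.symm.trans h4)).elim

/-- A communication on the channel `k` preserves hereditary acyclicity. -/
theorem HAcyclic.communicate {Γ : ServEnv D} {P Q P' Q' R : Proc D} {Δ : SessEnv D}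
    (hP : P.IsPrefix) (hQ : Q.IsPrefix) (h : HAcyclic (.par (.par P Q) R)) {k : ℕ}
    (hkP : k ∈ P.fsc) (hkQ : k ∈ Q.fsc) (hP' : HAcyclic P') (hQ' : HAcyclic Q')
    (hs : P'.fsc ∪ Q'.fsc ⊆ P.fsc ∪ Q.fsc) (hu : ∀ j, j ∈ P'.fsc → j ∈ Q'.fsc → j = k)
    (ht : Ty Γ (.par (.par P' Q') R) Δ) : HAcyclic (.par (.par P' Q') R) := by
  have hb := h.2.2
  simp only [graph] at hb
  rw [graph_prefix hP, graph_prefix hQ] at hb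
  -- The two prefixes are merged along `k`, and the resulting node is replaced by the graph of the
  -- continuations.
  refine HAcyclic.replace (hb.merge ⟨hkP, hkQ⟩) ?_ h.2.1 hs ht
  obtain ⟨Δ₁, Δ₂, h1, h2, hj⟩ := ht
  exact hP'.par hQ' h1 fun j j' h1 h2 h3 h4 => (hu j h1 h2).trans (hu j' h3 h4).symm

/-- The initiation of a session preserves hereditary acyclicity. -/
theorem HAcyclic.initiate {Γ : ServEnv D} {P Q R : Proc D} {Δ : SessEnv D} {a : Val D}
    (hb : ((SGraph.single (Proc.request a Q).fsc).compose (graph R)).Bridged) (hP : HAcyclic P)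
    (hQ : HAcyclic Q) (hR : HAcyclic R) (hs : ∀ k, k + 1 ∉ P.fsc)
    (ht : Ty Γ (.par (.res (.par P Q)) R) Δ) : HAcyclic (.par (.res (.par P Q)) R) := by
  -- Apart from the new session the body `P` of the service has no channels. So the opened session
  -- takes the place of the node of the request, and `P`, `Q` share at most the new channel.
  refine HAcyclic.replace hb ?_ hR ?_ ht
  · obtain ⟨Δ₁, Δ₂, h1, h2, hj⟩ := ht
    refine hP.par hQ h1 ?_
    rintro (k | k) (k' | k') h1 h2 h3 h4
    · rfl
    · exact absurd h3 (hs k')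
    · exact absurd h1 (hs k)
    · exact absurd h1 (hs k)
  · rintro k (hk | hk)
    · exact absurd hk (hs k)
    · exact hk

theorem Congr.res_par (P R : Proc D) :
    Congr (.par (.res P) R) (.res (.par P (R.renS Nat.succ))) :=
  (Congr.par_comm _ _).trans ((Congr.extrude _ _).trans (Congr.res (Congr.par_comm _ _)))

/-- The context `R` makes the induction work: acyclicity of the reduct alone would say nothing about
cycles through its environment. In the case of `par` the idle component moves into `R`. -/
theorem Red.hAcyclic_par {P P' : Proc D} (hr : Red P P') (R : Proc D) {Γ : ServEnv D}
    {Δ : SessEnv D} (ht : Ty Γ (.par P R) Δ) (h : HAcyclic (.par P R)) :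
    HAcyclic (.par P' R) := by
  induction hr generalizing Γ Δ R with
  | rinit a P Q =>
    have ht' := (Congr.par_assoc _ _ _).ty_iff.2 ((Red.rinit a P Q).par R |>.ty ht)
    have hs : ∀ k, k + 1 ∉ P.fsc := by
      obtain ⟨Δ₁, Δ₂, ⟨α, ha, hi, h1⟩, -, hj⟩ := ht'
      exact fun k hk => h1.ne_none hk rfl
    -- The surviving replicated service has no free channels, so it is split off and reattached
    -- without any new edge.
    refine (Congr.par_assoc _ _ _).hAcyclic_iff.1 (HAcyclic.par h.1.1 ?_ ht'
      fun k _ hk => absurd hk (hs k))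
    obtain ⟨Δ₁, Δ₂, -, h2, -⟩ := ht'
    exact HAcyclic.initiate (a := a) (((Emb.compose_right _ _).compose (Emb.refl _)).bridged h.2.2)
      h.1.1 h.1.2.1 h.2.1 hs h2
  | init a P Q =>
    have hs : ∀ k, k + 1 ∉ P.fsc := by
      obtain ⟨Δ₁, Δ₂, ⟨_, _, ⟨α, ha, hi, h1⟩, -, hj⟩, -, -⟩ := ht
      exact fun k hk => h1.ne_none hk rfl
    exact HAcyclic.initiate (a := a) (((Emb.compose_right _ _).compose (Emb.refl _)).bridged h.2.2)
      h.1.1 h.1.2.1 h.2.1 hs ((Red.init a P Q).par R |>.ty ht)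
  | com k P e v Q he =>
    have hfsc : (P.inst v).fsc = P.fsc := fsc_subst _ _
    refine HAcyclic.communicate (P := .input k P) (Q := .output k e Q)
      trivial trivial h (Or.inl rfl) (Or.inl rfl)
      ((hAcyclic_subst _ _).2 h.1.1) h.1.2.1 ?_ ?_ ((Red.com k P e v Q he).par R |>.ty ht)
    · rw [hfsc]
      exact Set.union_subset_union Set.subset_union_right Set.subset_union_right
    · intro j h1 h2
      rw [hfsc] at h1
      exact h.1.shared_unique trivial trivial (Or.inr h1) (Or.inr h2) (Or.inl rfl) (Or.inl rfl)
  | del k k' P Q hfree =>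
    -- The sender gives up `k'`, so afterwards `k` is still the only channel the two continuations
    -- can share.
    have hk'Q : k' ∉ Q.fsc := by
      obtain ⟨Δ₁, Δ₂, ⟨_, _, -, ⟨hne, β', α', h2, hup, hQ⟩, -⟩, -, -⟩ := ht
      refine fun hh => hQ.ne_none hh ?_
      rw [Function.update_of_ne hne.symm, Function.update_self]
    have hfsc : ∀ j, j ∈ (P.renS (cons k' id)).fsc → j = k' ∨ j + 1 ∈ P.fsc := by
      rw [fsc_renS]
      rintro _ ⟨i | i, hi, rfl⟩
      · exact Or.inl rfl
      · exact Or.inr hi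
    have hinj : Set.InjOn (cons k' id) P.fsc := by
      rintro (a | a) ha (b | b) hb hab
      · rfl
      · exact absurd ((show k' = b from hab) ▸ hb) hfree
      · exact absurd ((show a = k' from hab) ▸ ha) hfree
      · exact congrArg Nat.succ hab
    refine HAcyclic.communicate (P := .inputS k P) (Q := .deleg k k' Q)
      trivial trivial h (Or.inl rfl) (Or.inl (Or.inl rfl))
      ((hAcyclic_renS hinj).2 h.1.1) h.1.2.1 ?_ ?_ ((Red.del k k' P Q hfree).par R |>.ty ht)
    · rintro j (hj | hj)
      · rcases hfsc j hj with rfl | hj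
        · exact Or.inr (Or.inl (Or.inr rfl))
        · exact Or.inl (Or.inr hj)
      · exact Or.inr (Or.inr hj)
    · intro j h1 h2
      rcases hfsc j h1 with rfl | h1
      · exact absurd h2 hk'Q
      · exact h.1.shared_unique trivial trivial (Or.inr h1) (Or.inr h2) (Or.inl rfl)
          (Or.inl (Or.inl rfl))
  | sel k I hI P j Q =>
    have hsub : (P j).fsc ⊆ ⋃ l, (P l).fsc := Set.subset_iUnion (fun l => (P l).fsc) j
    refine HAcyclic.communicate (P := .branch k I hI P) (Q := .select k j Q)
      trivial trivial h (Or.inl rfl) (Or.inl rfl) (h.1.1 j) h.1.2.1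
      (Set.union_subset_union (hsub.trans Set.subset_union_right) Set.subset_union_right) ?_
      ((Red.sel k I hI P j Q).par R |>.ty ht)
    intro i h1 h2
    exact h.1.shared_unique trivial trivial (Or.inr (hsub h1)) (Or.inr h2) (Or.inl rfl) (Or.inl rfl)
  | par Q hr ih =>
    exact (Congr.par_assoc _ _ _).hAcyclic_iff.1 (ih _ ((Congr.par_assoc _ _ _).ty_iff.2 ht)
      ((Congr.par_assoc _ _ _).hAcyclic_iff.2 h))
  | res hr ih =>
    have ht' : Ty Γ (.res _) Δ := (Congr.res_par _ _).ty_iff.1 ht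
    have h' : HAcyclic (.res _) := (Congr.res_par _ _).hAcyclic_iff.1 h
    exact (Congr.res_par _ _).hAcyclic_iff.2 (ih _ ht' h')
  | str hc _ hc' ih =>
    exact (hc'.par (.refl R)).hAcyclic_iff.1 (ih R ((hc.par (.refl R)).ty_iff.1 ht)
      ((hc.par (.refl R)).hAcyclic_iff.1 h))
  | ifT e P Q he =>
    exact HAcyclic.replace h.2.2 h.1.1 h.2.1 Set.subset_union_left
      ((Red.ifT e P Q he).par R |>.ty ht)
  | ifF e P Q he =>
    exact HAcyclic.replace h.2.2 h.1.2 h.2.1 Set.subset_union_right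
      ((Red.ifF e P Q he).par R |>.ty ht)

theorem Red.hAcyclic {P P' : Proc D} (hr : Red P P') {Γ : ServEnv D} {Δ : SessEnv D}
    (ht : Ty Γ P Δ) (h : HAcyclic P) : HAcyclic P' :=
  (Congr.par_nil P').hAcyclic_iff.1 (hr.hAcyclic_par .nil ((Congr.par_nil P).ty_iff.2 ht)
    ((Congr.par_nil P).hAcyclic_iff.2 h))

/-! ### Irreducibility of prefixes -/

/-- The number of top-level prefixes; conditionals count twice, since they reduce by themselves. -/
def weight : Proc D → ℕ
  | nil => 0
  | par P Q => weight P + weight Q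
  | res P => weight P
  | ifte _ _ _ => 2
  | _ => 1

theorem weight_renS (ρ : ℕ → ℕ) (P : Proc D) : weight (P.renS ρ) = weight P := by
  induction P generalizing ρ <;> simp_all [weight, renS]

theorem Congr.weight_eq {P Q : Proc D} (h : Congr P Q) : weight P = weight Q := by
  induction h with
  | par_comm => exact Nat.add_comm _ _
  | par_assoc => exact (Nat.add_assoc _ _ _).symm
  | extrude P Q => simp [weight, weight_renS]
  | _ => simp_all [weight]

/-- A reduction consumes two prefixes or one conditional. So the partners built below, of weight at
most one, are irreducible. -/
theorem Red.two_le_weight {P Q : Proc D} (h : Red P Q) : 2 ≤ weight P := by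
  induction h with
  | par Q _ ih => exact ih.trans (Nat.le_add_right _ _)
  | res _ ih => exact ih
  | str hc _ _ ih => rwa [hc.weight_eq]
  | _ => exact le_rfl

theorem not_liveOver_of_weight_eq_zero {P : Proc D} (h : weight P = 0) (b : ℕ → Prop) :
    ¬ LiveOver b P := by
  induction P generalizing b with
  | nil => exact id
  | par P Q ihP ihQ =>
    simp only [weight, Nat.add_eq_zero_iff] at h
    rintro (hl | hl)
    · exact ihP h.1 b hl
    · exact ihQ h.2 b hl
  | res P ih => exact ih h _
  | _ => simp [weight] at h

/-! ### Normal forms -/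

/-- `n` restrictions of `P`. -/
def resN : ℕ → Proc D → Proc D
  | 0, P => P
  | n + 1, P => res (resN n P)

/-- No restriction stands above a top-level prefix. -/
def Flat : Proc D → Prop
  | par P Q => Flat P ∧ Flat Q
  | res _ => False
  | _ => True

theorem Flat.renS {P : Proc D} (h : Flat P) (ρ : ℕ → ℕ) : Flat (P.renS ρ) := by
  induction P with
  | par P Q ihP ihQ => exact ⟨ihP h.1, ihQ h.2⟩
  | res P => exact h.elim
  | _ => trivial

theorem Congr.resN {P Q : Proc D} (h : Congr P Q) (n : ℕ) : Congr (resN n P) (resN n Q) := by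
  induction n with
  | zero => exact h
  | succ n ih => exact ih.res

theorem Red.resN {P Q : Proc D} (h : Red P Q) (n : ℕ) : Red (resN n P) (resN n Q) := by
  induction n with
  | zero => exact h
  | succ n ih => exact ih.res

theorem resN_renS (n : ℕ) (ρ : ℕ → ℕ) (P : Proc D) :
    ∃ τ, (resN n P).renS ρ = resN n (P.renS τ) := by
  induction n generalizing ρ with
  | zero => exact ⟨ρ, rfl⟩
  | succ n ih =>
    obtain ⟨τ, h⟩ := ih (liftRen ρ)
    exact ⟨τ, congrArg res h⟩

theorem Congr.resN_par (n : ℕ) (P R : Proc D) :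
    Congr (.par (Sessions.resN n P) R) (Sessions.resN n (.par P (R.renS (· + n)))) := by
  induction n generalizing R with
  | zero =>
    have : R.renS (· + 0) = R := renS_id R
    rw [this]
    exact .refl _
  | succ n ih =>
    refine (Congr.res_par _ R).trans (Congr.res ?_)
    have h := ih (R.renS Nat.succ)
    rw [renS_renS] at h
    have : (fun k => k + n) ∘ Nat.succ = (· + (n + 1)) := by
      funext k
      simp only [Function.comp]
      omega
    rwa [this] at h

/-- Scope extrusion moves all restrictions above the parallel compositions. In a flat process, node
labels are exactly the free channels of the prefixes (`Flat.lab_eq`). -/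
theorem exists_normal_form (P : Proc D) : ∃ n M, Flat M ∧ Congr P (resN n M) := by
  induction P with
  | par P Q ihP ihQ =>
    obtain ⟨n, M, hM, hP⟩ := ihP
    obtain ⟨m, N, hN, hQ⟩ := ihQ
    obtain ⟨τ, hτ⟩ := resN_renS m (· + n) N
    refine ⟨n + m, .par (M.renS (· + m)) (N.renS τ), ⟨hM.renS _, hN.renS _⟩,
      (hP.par hQ).trans ((Congr.resN_par n M _).trans ?_)⟩
    rw [hτ]
    have h1 : Congr (.par M (resN m (N.renS τ))) (resN m (.par (M.renS (· + m)) (N.renS τ))) :=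
      (Congr.par_comm _ _).trans ((Congr.resN_par m _ _).trans ((Congr.par_comm _ _).resN m))
    have h2 : ∀ X : Proc D, resN n (resN m X) = resN (n + m) X := by
      intro X
      clear hP hτ
      induction n with
      | zero => simp [resN]
      | succ n ih =>
        rw [Nat.add_right_comm]
        exact congrArg res ih
    rw [← h2]
    exact h1.resN n
  | res P ih =>
    obtain ⟨n, M, hM, hP⟩ := ih
    exact ⟨n + 1, M, hM, hP.res⟩
  | _ =>
    refine ⟨0, _, ?_, .refl _⟩
    trivial

theorem fsc_resN (n : ℕ) (P : Proc D) : (resN n P).fsc = {k | k + n ∈ P.fsc} := by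
  induction n with
  | zero => rfl
  | succ n ih =>
    ext k
    simp only [resN, fsc, ih, Set.mem_ofPred_eq]
    rw [Nat.add_right_comm, Nat.add_assoc]

theorem weight_resN (n : ℕ) (P : Proc D) : weight (resN n P) = weight P := by
  induction n with
  | zero => rfl
  | succ n ih => exact ih

theorem hAcyclic_resN (n : ℕ) (P : Proc D) : HAcyclic (resN n P) ↔ HAcyclic P := by
  induction n with
  | zero => exact Iff.rfl
  | succ n ih => exact ih

/-- Restricted channels have the entry `⊥`, so a session type inside belongs to a channel visible
from outside, shifted by `n`. -/
theorem Ty.of_resN {Γ : ServEnv D} {n : ℕ} {P : Proc D} {Δ : SessEnv D} (h : Ty Γ (resN n P) Δ) :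
    ∃ Δ', Ty Γ P Δ' ∧ ∀ k α, Δ' k = some (.ty α) → ∃ j, k = j + n ∧ Δ j = some (.ty α) := by
  induction n generalizing Δ with
  | zero => exact ⟨Δ, h, fun k α hk => ⟨k, rfl, hk⟩⟩
  | succ n ih =>
    obtain ⟨Δ', h', hΔ⟩ := ih (Δ := cons (some .bot) Δ) h
    refine ⟨Δ', h', fun k α hk => ?_⟩
    obtain ⟨j | j, rfl, hj⟩ := hΔ k α hk
    · cases hj
    · exact ⟨j, by omega, hj⟩

/-! ### Top-level prefixes as nodes of the graph -/

/-- The prefix that a node of the graph stands for. -/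
def nodeProc : (P : Proc D) → (graph P).Node → Proc D
  | nil, _ => nil
  | par P _, .inl p => nodeProc P p
  | par _ Q, .inr q => nodeProc Q q
  | res P, p => nodeProc P p
  | repServ a P, _ => repServ a P
  | serv a P, _ => serv a P
  | request a P, _ => request a P
  | input k P, _ => input k P
  | output k e P, _ => output k e P
  | inputS k P, _ => inputS k P
  | deleg k k' P, _ => deleg k k' P
  | branch k I hI P, _ => branch k I hI P
  | select k l P, _ => select k l P
  | ifte e P Q, _ => ifte e P Q

theorem nodeProc_isPrefix {M : Proc D} (p : (graph M).Node) : (nodeProc M p).IsPrefix := by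
  induction M with
  | nil => exact p.elim
  | par P Q ihP ihQ =>
    rcases p with p | p
    · exact ihP p
    · exact ihQ p
  | res P ih => exact ih p
  | _ => trivial

theorem Flat.lab_eq {M : Proc D} (h : Flat M) (p : (graph M).Node) :
    (graph M).lab p = (nodeProc M p).fsc := by
  induction M with
  | nil => exact p.elim
  | par P Q ihP ihQ =>
    rcases p with p | p
    · exact ihP h.1 p
    · exact ihQ h.2 p
  | res P => exact h.elim
  | _ => rfl

theorem nonempty_node_of_weight {M : Proc D} (h : weight M ≠ 0) : Nonempty (graph M).Node := by
  induction M with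
  | nil => exact absurd rfl h
  | par P Q ihP ihQ =>
    by_cases hP : weight P = 0
    · obtain ⟨q⟩ := ihQ fun hQ => h (by simp [weight, hP, hQ])
      exact ⟨.inr q⟩
    · obtain ⟨p⟩ := ihP hP
      exact ⟨.inl p⟩
  | res P ih => exact ih h
  | _ => exact ⟨()⟩

theorem finite_node (M : Proc D) : Finite (graph M).Node := by
  induction M with
  | nil => exact inferInstanceAs (Finite Empty)
  | par P Q ihP ihQ => exact inferInstanceAs (Finite ((graph P).Node ⊕ (graph Q).Node))
  | res P ih => exact ih
  | _ => exact inferInstanceAs (Finite Unit)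

/-- The edges of the graph of a flat process can be identified by a channel and two nodes. -/
theorem Flat.exists_edge {M : Proc D} (h : Flat M) : ∃ c : (graph M).Edge → ℕ,
    ∀ p q k, p ≠ q → k ∈ (graph M).lab p → k ∈ (graph M).lab q →
      ∃ e, (graph M).Links e p q ∧ c e = k := by
  induction M with
  | nil => exact ⟨fun e => e.elim, fun p => p.elim⟩
  | par P Q ihP ihQ =>
    obtain ⟨c, hc⟩ := ihP h.1
    obtain ⟨c', hc'⟩ := ihQ h.2
    refine ⟨Sum.elim (Sum.elim c c') fun t => t.1.2.2, ?_⟩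
    rintro (p | p) (q | q) k hne hp hq
    · obtain ⟨e, he, hk⟩ := hc p q k (fun h => hne (congrArg Sum.inl h)) hp hq
      refine ⟨.inl (.inl e), ?_, hk⟩
      rcases he with ⟨rfl, rfl⟩ | ⟨rfl, rfl⟩
      · exact Or.inl ⟨rfl, rfl⟩
      · exact Or.inr ⟨rfl, rfl⟩
    · exact ⟨.inr ⟨(p, q, k), hp, hq⟩, Or.inl ⟨rfl, rfl⟩, rfl⟩
    · exact ⟨.inr ⟨(q, p, k), hq, hp⟩, Or.inr ⟨rfl, rfl⟩, rfl⟩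
    · obtain ⟨e, he, hk⟩ := hc' p q k (fun h => hne (congrArg Sum.inr h)) hp hq
      refine ⟨.inl (.inr e), ?_, hk⟩
      rcases he with ⟨rfl, rfl⟩ | ⟨rfl, rfl⟩
      · exact Or.inl ⟨rfl, rfl⟩
      · exact Or.inr ⟨rfl, rfl⟩
  | res P => exact h.elim
  | _ => exact ⟨fun e => e.elim, fun p q k hne => absurd rfl hne⟩

theorem Congr.par_par_comm (A B C E : Proc D) :
    Congr (.par (.par A B) (.par C E)) (.par (.par A C) (.par B E)) :=
  (Congr.par_assoc _ _ _).trans <| (Congr.par (((Congr.par_assoc _ _ _).symm).trans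
    (((Congr.refl A).par (.par_comm B C)).trans (.par_assoc _ _ _))) (.refl E)).trans
      (Congr.par_assoc _ _ _).symm

theorem SType.dual_ne_fin {α : SType D} (h : α ≠ .fin) : α.dual ≠ .fin := by
  cases α <;> simp_all [SType.dual]

theorem not_idle_ty {α : SType D} (h : α ≠ .fin) : ¬ Idle (some (Use.ty α)) := by
  simp [Idle, h]

/-- A channel with an active session type occurs in a top-level prefix, with the same type. -/
theorem Ty.exists_node {Γ : ServEnv D} {M : Proc D} {Δ : SessEnv D} (hM : Flat M) (h : Ty Γ M Δ)
    {k : ℕ} {α : SType D} (hα : α ≠ .fin) (hk : Δ k = some (.ty α)) :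
    ∃ q Δ' M₀, Ty Γ (nodeProc M q) Δ' ∧ Δ' k = some (.ty α) ∧
      Congr M (.par (nodeProc M q) M₀) := by
  induction M generalizing Γ Δ with
  | nil => exact absurd (hk ▸ h k) (not_idle_ty hα)
  | par P Q ihP ihQ =>
    obtain ⟨Δ₁, Δ₂, h1, h2, hj⟩ := h
    have hjk := hj k
    rw [hk] at hjk
    rcases hjk.of_ty with ⟨-, h0⟩ | ⟨-, h0⟩
    · obtain ⟨q, Δ', M₀, ht, hΔ, hc⟩ := ihQ hM.2 h2 h0
      exact ⟨.inr q, Δ', .par M₀ P, ht, hΔ, (Congr.par_comm _ _).trans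
        ((hc.par (.refl P)).trans (Congr.par_assoc _ _ _).symm)⟩
    · obtain ⟨q, Δ', M₀, ht, hΔ, hc⟩ := ihP hM.1 h1 h0
      exact ⟨.inl q, Δ', .par M₀ Q, ht, hΔ, (hc.par (.refl Q)).trans (Congr.par_assoc _ _ _).symm⟩
  | res P => exact hM.elim
  | _ => exact ⟨(), Δ, .nil, h, hk, (Congr.par_nil _).symm⟩

/-- An active session type in the typing of a top-level prefix belongs either to the interface of
the process or to a channel shared with another top-level prefix, which has the dual type there. -/
theorem Ty.exists_partner {Γ : ServEnv D} {M : Proc D} {Δ : SessEnv D} (hM : Flat M) (h : Ty Γ M Δ)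
    (p : (graph M).Node) : ∃ Δp, Ty Γ (nodeProc M p) Δp ∧
      (∃ M₀, Congr M (.par (nodeProc M p) M₀)) ∧
      ∀ k α, α ≠ .fin → Δp k = some (.ty α) → Δ k = some (.ty α) ∨
        ∃ q Δq M₀, q ≠ p ∧ Ty Γ (nodeProc M q) Δq ∧ Δq k = some (.ty α.dual) ∧
          Congr M (.par (.par (nodeProc M p) (nodeProc M q)) M₀) := by
  induction M generalizing Γ Δ with
  | nil => exact p.elim
  | par P Q ihP ihQ =>
    obtain ⟨Δ₁, Δ₂, h1, h2, hj⟩ := h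
    rcases p with p | p
    · obtain ⟨Δp, hp, ⟨P₀, hc⟩, hk⟩ := ihP hM.1 h1 p
      refine ⟨Δp, hp, ⟨.par P₀ Q, (hc.par (.refl Q)).trans (Congr.par_assoc _ _ _).symm⟩, ?_⟩
      intro k α hα hkα
      rcases hk k α hα hkα with h0 | ⟨q, Δq, M₀, hne, hq, hΔq, hcq⟩
      · have hjk := hj k
        rw [h0] at hjk
        rcases hjk with ⟨h, -⟩ | ⟨-, h⟩ | ⟨β, hb, hb', -⟩
        · cases h
        · exact Or.inl h
        -- The channel was in the interface of `P` and is now shared with `Q`; the partner is the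
        -- prefix of `Q` that carries the dual type.
        · have : α = β.dual := by simpa using hb
          subst this
          rw [SType.dual_dual]
          obtain ⟨q, Δq, Q₀, hq, hΔq, hcq⟩ := h2.exists_node hM.2
            (fun hf => hα (by rw [hf]; rfl)) hb'
          exact Or.inr ⟨.inr q, Δq, .par P₀ Q₀, Sum.inr_ne_inl, hq, hΔq,
            (hc.par hcq).trans (Congr.par_par_comm _ _ _ _)⟩
      · exact Or.inr ⟨.inl q, Δq, .par M₀ Q, fun h => hne (Sum.inl.inj h), hq, hΔq,
          (hcq.par (.refl Q)).trans (Congr.par_assoc _ _ _).symm⟩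
    · obtain ⟨Δp, hp, ⟨Q₀, hc⟩, hk⟩ := ihQ hM.2 h2 p
      have hcomm := Congr.par_comm P Q
      refine ⟨Δp, hp, ⟨.par Q₀ P, hcomm.trans ((hc.par (.refl P)).trans
        (Congr.par_assoc _ _ _).symm)⟩, ?_⟩
      intro k α hα hkα
      rcases hk k α hα hkα with h0 | ⟨q, Δq, M₀, hne, hq, hΔq, hcq⟩
      · have hjk := (hj k).symm
        rw [h0] at hjk
        rcases hjk with ⟨h, -⟩ | ⟨-, h⟩ | ⟨β, hb, hb', -⟩
        · cases h
        · exact Or.inl h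
        · have : α = β.dual := by simpa using hb
          subst this
          rw [SType.dual_dual]
          obtain ⟨q, Δq, P₀, hq, hΔq, hcq⟩ := h1.exists_node hM.1
            (fun hf => hα (by rw [hf]; rfl)) hb'
          exact Or.inr ⟨.inl q, Δq, .par Q₀ P₀, Sum.inl_ne_inr, hq, hΔq,
            hcomm.trans ((hc.par hcq).trans (Congr.par_par_comm _ _ _ _))⟩
      · exact Or.inr ⟨.inr q, Δq, .par M₀ P, fun h => hne (Sum.inr.inj h), hq, hΔq,
          hcomm.trans ((hcq.par (.refl P)).trans (Congr.par_assoc _ _ _).symm)⟩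
  | res P => exact hM.elim
  | _ => exact ⟨Δ, h, ⟨.nil, (Congr.par_nil _).symm⟩, fun k α _ hk => Or.inl hk⟩

/-! ### Communication between dual prefixes -/

/-- The subject of a session prefix. -/
def subject : Proc D → Option ℕ
  | input k _ => some k
  | output k _ _ => some k
  | inputS k _ => some k
  | deleg k _ _ => some k
  | branch k _ _ _ => some k
  | select k _ _ => some k
  | _ => none

theorem subject_renS (ρ : ℕ → ℕ) (P : Proc D) : subject (P.renS ρ) = (subject P).map ρ := by
  cases P <;> rfl

theorem subject_mem_fsc {P : Proc D} {k : ℕ} (h : subject P = some k) : k ∈ P.fsc := by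
  cases P <;> simp_all [subject, fsc]

theorem Ty.subject_type {Γ : ServEnv D} {P : Proc D} {Δ : SessEnv D} (h : Ty Γ P Δ) {k : ℕ}
    (hk : subject P = some k) : ∃ α, α ≠ .fin ∧ Δ k = some (.ty α) := by
  cases P with
  | input j P =>
    obtain rfl : j = k := by simpa [subject] using hk
    obtain ⟨S, α, h0, -⟩ := h
    exact ⟨_, S.inp_ne_fin α, h0⟩
  | output j e P =>
    obtain rfl : j = k := by simpa [subject] using hk
    obtain ⟨S, α, h0, -⟩ := h
    exact ⟨_, S.out_ne_fin α, h0⟩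
  | inputS j P =>
    obtain rfl : j = k := by simpa [subject] using hk
    obtain ⟨β, α, h0, -⟩ := h
    exact ⟨_, by simp, h0⟩
  | deleg j j' P =>
    obtain rfl : j = k := by simpa [subject] using hk
    obtain ⟨-, β, α, h0, -⟩ := h
    exact ⟨_, by simp, h0⟩
  | branch j I hI P =>
    obtain rfl : j = k := by simpa [subject] using hk
    obtain ⟨α, h0, -⟩ := h
    exact ⟨_, by simp, h0⟩
  | select j l P =>
    obtain rfl : j = k := by simpa [subject] using hk
    obtain ⟨I, hI, α, -, h0, -⟩ := h
    exact ⟨_, by simp, h0⟩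
  | _ => simp [subject] at hk

/-- What the type of its subject says about the form of a session prefix. -/
theorem Ty.subject_form {Γ : ServEnv D} {P : Proc D} {Δ : SessEnv D} (h : Ty Γ P Δ) {k : ℕ}
    (hk : subject P = some k) {α : SType D} (hα : Δ k = some (.ty α)) :
    match α with
    | .inpB _ _ => ∃ P', P = .input k P'
    | .inpC _ _ => ∃ P', P = .input k P'
    | .inpS _ _ => ∃ P', P = .inputS k P'
    | .outB _ _ => ∃ e S P', P = .output k e P' ∧ ExprTyped Γ e S
    | .outC _ _ => ∃ e S P', P = .output k e P' ∧ ExprTyped Γ e S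
    | .outS _ _ => ∃ k' P', P = .deleg k k' P'
    | .bra I hI _ => ∃ P', P = .branch k I hI P'
    | .sel I _ _ => ∃ (j : {l // l ∈ I}) (P' : Proc D), P = .select k j P'
    | .fin => False := by
  cases P with
  | input j P =>
    obtain rfl : j = k := by simpa [subject] using hk
    obtain ⟨S, β, h0, -⟩ := h
    obtain rfl : Srt.inp S β = α := by simpa [hα] using h0.symm
    cases S <;> exact ⟨_, rfl⟩
  | output j e P =>
    obtain rfl : j = k := by simpa [subject] using hk
    obtain ⟨S, β, h0, he, -⟩ := h
    obtain rfl : Srt.out S β = α := by simpa [hα] using h0.symm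
    cases S <;> exact ⟨_, _, _, rfl, he⟩
  | inputS j P =>
    obtain rfl : j = k := by simpa [subject] using hk
    obtain ⟨β, γ, h0, -⟩ := h
    obtain rfl : SType.inpS β γ = α := by simpa [hα] using h0.symm
    exact ⟨_, rfl⟩
  | deleg j j' P =>
    obtain rfl : j = k := by simpa [subject] using hk
    obtain ⟨-, β, γ, h0, -⟩ := h
    obtain rfl : SType.outS β γ = α := by simpa [hα] using h0.symm
    exact ⟨_, _, rfl⟩
  | branch j I hI P =>
    obtain rfl : j = k := by simpa [subject] using hk
    obtain ⟨β, h0, -⟩ := h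
    obtain rfl : SType.bra I hI β = α := by simpa [hα] using h0.symm
    exact ⟨_, rfl⟩
  | select j l P =>
    obtain rfl : j = k := by simpa [subject] using hk
    obtain ⟨I, hI, β, hl, h0, -⟩ := h
    obtain rfl : SType.sel I hI β = α := by simpa [hα] using h0.symm
    exact ⟨⟨l, hl⟩, _, rfl⟩
  | _ => simp [subject] at hk

/-- Names have service types only, so an expression of basic type contains no variable and its
operations meet constants. -/
theorem ExprTyped.exists_eval_const {Γ : ServEnv D} (hΓ : ServiceEnv Γ) {e : Expr D} {b : Basic D}
    (h : ExprTyped Γ e (.basic b)) : ∃ c, Eval e (.const b c) := by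
  generalize hS : Srt.basic b = S at h
  induction h generalizing b with
  | val hv =>
    subst hS
    cases hv with
    | name ha =>
      obtain ⟨α, hα⟩ := hΓ _ _ ha
      cases hα
    | const b c => exact ⟨c, .val _⟩
  | op o args _ ih =>
    cases hS
    choose c hc using fun i => ih i rfl
    exact ⟨_, .op o args c hc⟩

theorem ExprTyped.exists_eval {Γ : ServEnv D} (hΓ : ServiceEnv Γ) {e : Expr D} {S : Srt D}
    (h : ExprTyped Γ e S) : ∃ v, Eval e v := by
  cases h with
  | @val v S hv => exact ⟨v, .val v⟩
  | op o args ha =>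
    obtain ⟨c, hc⟩ := (ExprTyped.op o args ha).exists_eval_const hΓ
    exact ⟨_, hc⟩

theorem Red.congr_left {P Q R : Proc D} (hc : Congr P Q) (h : Red Q R) : Red P R :=
  .str hc h (.refl R)

/-- Session prefixes with a common subject and dual types communicate. -/
theorem exists_red_of_dual {Γ₁ Γ₂ : ServEnv D} (hΓ₁ : ServiceEnv Γ₁) (hΓ₂ : ServiceEnv Γ₂)
    {P Q : Proc D} {Δ₁ Δ₂ : SessEnv D} (hP : Ty Γ₁ P Δ₁) (hQ : Ty Γ₂ Q Δ₂) {k : ℕ}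
    (hkP : subject P = some k) (hkQ : subject Q = some k) {α : SType D}
    (h1 : Δ₁ k = some (.ty α)) (h2 : Δ₂ k = some (.ty α.dual))
    (hu : ∀ j, j ∈ P.fsc → j ∈ Q.fsc → j = k) : ∃ R, Red (.par P Q) R := by
  have f1 := hP.subject_form hkP h1
  have f2 := hQ.subject_form hkQ h2
  cases α with
  | inpB b α =>
    obtain ⟨P', rfl⟩ := f1
    obtain ⟨e, S, Q', rfl, he⟩ := f2
    obtain ⟨v, hv⟩ := he.exists_eval hΓ₂
    exact ⟨_, .com _ _ _ _ _ hv⟩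
  | inpC β α =>
    obtain ⟨P', rfl⟩ := f1
    obtain ⟨e, S, Q', rfl, he⟩ := f2
    obtain ⟨v, hv⟩ := he.exists_eval hΓ₂
    exact ⟨_, .com _ _ _ _ _ hv⟩
  | inpS β α =>
    obtain ⟨P', rfl⟩ := f1
    obtain ⟨k', Q', rfl⟩ := f2
    -- If the receiver used `k'`, it would be a second shared channel, hence equal to the subject by
    -- `hu`; typing forbids delegating the subject.
    exact ⟨_, .del _ _ _ _ fun hk' =>
      hQ.1.symm (hu k' (Or.inr hk') (Or.inl (Or.inr rfl)))⟩
  | outB b α =>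
    obtain ⟨e, S, P', rfl, he⟩ := f1
    obtain ⟨Q', rfl⟩ := f2
    obtain ⟨v, hv⟩ := he.exists_eval hΓ₁
    exact ⟨_, .congr_left (.par_comm _ _) (.com _ _ _ _ _ hv)⟩
  | outC β α =>
    obtain ⟨e, S, P', rfl, he⟩ := f1
    obtain ⟨Q', rfl⟩ := f2
    obtain ⟨v, hv⟩ := he.exists_eval hΓ₁
    exact ⟨_, .congr_left (.par_comm _ _) (.com _ _ _ _ _ hv)⟩
  | outS β α =>
    obtain ⟨k', P', rfl⟩ := f1
    obtain ⟨Q', rfl⟩ := f2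
    exact ⟨_, .congr_left (.par_comm _ _) (.del _ _ _ _ fun hk' =>
      hP.1.symm (hu k' (Or.inl (Or.inr rfl)) (Or.inr hk')))⟩
  | bra I hI α =>
    obtain ⟨P', rfl⟩ := f1
    obtain ⟨j, Q', rfl⟩ := f2
    exact ⟨_, .sel _ _ _ _ _ _⟩
  | sel I hI α =>
    obtain ⟨j, P', rfl⟩ := f1
    obtain ⟨Q', rfl⟩ := f2
    exact ⟨_, .congr_left (.par_comm _ _) (.sel _ _ _ _ _ _)⟩
  | fin => exact f1.elim

/-! ### Irreducible processes offer an interaction -/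

/-- Services, replicated services and requests. -/
def IsSessionOpener : Proc D → Prop
  | repServ _ _ => True
  | serv _ _ => True
  | request _ _ => True
  | _ => False

theorem prefix_cases {P : Proc D} (h : P.IsPrefix) : IsSessionOpener P ∨
    (∃ e A B, P = .ifte e A B) ∨ ∃ k, subject P = some k := by
  cases P with
  | nil => exact h.elim
  | par => exact h.elim
  | res => exact h.elim
  | repServ => exact Or.inl trivial
  | serv => exact Or.inl trivial
  | request => exact Or.inl trivial
  | ifte e A B => exact Or.inr (Or.inl ⟨e, A, B, rfl⟩)
  | _ => exact Or.inr (Or.inr ⟨_, rfl⟩)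

theorem exists_red_ifte {Γ : ServEnv D} (hΓ : ServiceEnv Γ) {e : Expr D} {P Q : Proc D}
    {Δ : SessEnv D} (h : Ty Γ (.ifte e P Q) Δ) : ∃ R, Red (.ifte e P Q) R := by
  obtain ⟨c, hc⟩ := h.1.exists_eval_const hΓ
  cases c
  · exact ⟨_, .ifF e P Q hc⟩
  · exact ⟨_, .ifT e P Q hc⟩

/-- A typed flat process without cycles that has a top-level prefix reduces, or else it has a
top-level prefix that can interact with the environment. -/
theorem Ty.reduces_or_offers {Γ : ServEnv D} (hΓ : ServiceEnv Γ) {M : Proc D} {Δ : SessEnv D}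
    (hM : Flat M) (h : Ty Γ M Δ) (hA : HAcyclic M) [Nonempty (graph M).Node] :
    (∃ M', Red M M') ∨ ∃ γ M₀ Δ', Congr M (.par γ M₀) ∧ Ty Γ γ Δ' ∧
      (IsSessionOpener γ ∨ ∃ k α, subject γ = some k ∧ α ≠ .fin ∧ Δ' k = some (.ty α) ∧
        Δ k = some (.ty α)) := by
  by_contra hcon
  push Not at hcon
  obtain ⟨hred, hoff⟩ := hcon
  -- When `M` is stuck, each prefix waits on its subject for a prefix that holds the channel but
  -- currently acts on another one.
  have key : ∀ p : (graph M).Node, ∃ k q, subject (nodeProc M p) = some k ∧ q ≠ p ∧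
      k ∈ (nodeProc M q).fsc ∧ subject (nodeProc M q) ≠ some k := by
    intro p
    obtain ⟨Δp, hp, ⟨M₀, hc⟩, hpart⟩ := h.exists_partner hM p
    obtain ⟨hop, hsub⟩ := hoff _ M₀ Δp hc hp
    have hk : ∃ k, subject (nodeProc M p) = some k := by
      rcases prefix_cases (nodeProc_isPrefix p) with ho | ⟨e, A, B, he⟩ | hk
      · exact absurd ho hop
      · rw [he] at hp hc
        obtain ⟨R, hR⟩ := exists_red_ifte hΓ hp
        exact absurd (.congr_left hc (hR.par M₀)) (hred _)
      · exact hk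
    obtain ⟨k, hk⟩ := hk
    obtain ⟨α, hα, hkα⟩ := hp.subject_type hk
    rcases hpart k α hα hkα with h0 | ⟨q, Δq, M₁, hne, hq, hqα, hcq⟩
    · exact absurd h0 (hsub k α hk hα hkα)
    · have hkq : k ∈ (nodeProc M q).fsc := by
        by_contra hn
        exact not_idle_ty (SType.dual_ne_fin hα) (hqα ▸ hq.idle hn)
      refine ⟨k, q, hk, hne, hkq, fun hsq => ?_⟩
      have hA' : HAcyclic (.par (nodeProc M p) (nodeProc M q)) := (hcq.hAcyclic_iff.1 hA).1
      obtain ⟨R, hR⟩ := exists_red_of_dual hΓ hΓ hp hq hk hsq hkα hqα fun j h1 h2 =>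
        hA'.shared_unique (nodeProc_isPrefix p) (nodeProc_isPrefix q) h1 h2 (subject_mem_fsc hk) hkq
      exact hred _ (.congr_left hcq (hR.par M₁))
  choose s f hs hf hmem hsne using key
  obtain ⟨c, hc⟩ := hM.exists_edge
  have hedge : ∀ p, ∃ e, (graph M).Links e p (f p) ∧ c e = s p := by
    intro p
    refine hc p (f p) (s p) (hf p).symm ?_ ?_
    · rw [hM.lab_eq]
      exact subject_mem_fsc (hs p)
    · rw [hM.lab_eq]
      exact hmem p
  choose e he hce using hedge
  have := finite_node M
  refine not_acyclic_of_selection f e ?_ he hA.bridged.acyclic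
  intro p p' hpp
  have hsp : s p = s p' := by rw [← hce p, ← hce p', hpp]
  -- An edge selected from both ends would have its channel as subject of both prefixes, against
  -- `hsne`.
  rcases (hpp ▸ he p).endpoints (he p') with ⟨h, -⟩ | ⟨h, -⟩
  · exact h
  · exact absurd (by rw [← h, hs p, hsp]) (hsne p')

/-! ### Partners -/

/-- Typing depends on finitely many names only. -/
theorem ExprTyped.exists_bound {Γ : ServEnv D} {e : Expr D} {S : Srt D} (h : ExprTyped Γ e S) :
    ∃ N, ∀ Γ' : ServEnv D, (∀ a < N, Γ' a = Γ a) → ExprTyped Γ' e S := by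
  induction h with
  | val hv =>
    cases hv with
    | @name a S ha =>
      exact ⟨a + 1, fun Γ' hΓ' => .val (.name ((hΓ' a (Nat.lt_succ_self a)).trans ha))⟩
    | const b c => exact ⟨0, fun Γ' _ => .val (.const b c)⟩
  | op o args _ ih =>
    choose N hN using ih
    exact ⟨Finset.univ.sup N, fun Γ' hΓ' => .op o args fun i => hN i Γ' fun a ha =>
      hΓ' a (ha.trans_le (Finset.le_sup (Finset.mem_univ i)))⟩

theorem ValTyped.exists_bound {Γ : ServEnv D} {v : Val D} {S : Srt D} (h : ValTyped Γ v S) :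
    ∃ N, ∀ Γ' : ServEnv D, (∀ a < N, Γ' a = Γ a) → ValTyped Γ' v S := by
  obtain ⟨N, hN⟩ := (ExprTyped.val h).exists_bound
  refine ⟨N, fun Γ' hΓ' => ?_⟩
  cases hN Γ' hΓ' with
  | val h => exact h

/-- `Γ` may be defined on all names. Overwriting it beyond the bound provides the fresh services
that partners need. -/
theorem Ty.exists_bound {Γ : ServEnv D} {P : Proc D} {Δ : SessEnv D} (h : Ty Γ P Δ) :
    ∃ N, ∀ Γ' : ServEnv D, (∀ a < N, Γ' a = Γ a) → Ty Γ' P Δ := by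
  induction P generalizing Γ Δ with
  | nil => exact ⟨0, fun _ _ => h⟩
  | par P Q ihP ihQ =>
    obtain ⟨Δ₁, Δ₂, h1, h2, hj⟩ := h
    obtain ⟨N₁, h1⟩ := ihP h1
    obtain ⟨N₂, h2⟩ := ihQ h2
    exact ⟨max N₁ N₂, fun Γ' hΓ' => ⟨Δ₁, Δ₂, h1 Γ' fun a ha => hΓ' a (lt_max_of_lt_left ha),
      h2 Γ' fun a ha => hΓ' a (lt_max_of_lt_right ha), hj⟩⟩
  | res P ih => exact ih h
  | repServ a P ih =>
    obtain ⟨α, ha, hi, h⟩ := h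
    obtain ⟨N₁, h1⟩ := ha.exists_bound
    obtain ⟨N₂, h2⟩ := ih h
    exact ⟨max N₁ N₂, fun Γ' hΓ' => ⟨α, h1 Γ' fun a ha => hΓ' a (lt_max_of_lt_left ha), hi,
      h2 Γ' fun a ha => hΓ' a (lt_max_of_lt_right ha)⟩⟩
  | serv a P ih =>
    obtain ⟨α, ha, hi, h⟩ := h
    obtain ⟨N₁, h1⟩ := ha.exists_bound
    obtain ⟨N₂, h2⟩ := ih h
    exact ⟨max N₁ N₂, fun Γ' hΓ' => ⟨α, h1 Γ' fun a ha => hΓ' a (lt_max_of_lt_left ha), hi,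
      h2 Γ' fun a ha => hΓ' a (lt_max_of_lt_right ha)⟩⟩
  | request a P ih =>
    obtain ⟨α, ha, h⟩ := h
    obtain ⟨N₁, h1⟩ := ha.exists_bound
    obtain ⟨N₂, h2⟩ := ih h
    exact ⟨max N₁ N₂, fun Γ' hΓ' => ⟨α, h1 Γ' fun a ha => hΓ' a (lt_max_of_lt_left ha),
      h2 Γ' fun a ha => hΓ' a (lt_max_of_lt_right ha)⟩⟩
  | input k P ih =>
    obtain ⟨S, α, h0, h⟩ := h
    obtain ⟨N, hN⟩ := ih h
    refine ⟨N, fun Γ' hΓ' => ⟨S, α, h0, hN _ ?_⟩⟩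
    rintro (a | a) ha
    · rfl
    · exact hΓ' a (Nat.lt_of_succ_lt ha)
  | output k e P ih =>
    obtain ⟨S, α, h0, he, h⟩ := h
    obtain ⟨N₁, h1⟩ := he.exists_bound
    obtain ⟨N₂, h2⟩ := ih h
    exact ⟨max N₁ N₂, fun Γ' hΓ' => ⟨S, α, h0, h1 Γ' fun a ha => hΓ' a (lt_max_of_lt_left ha),
      h2 Γ' fun a ha => hΓ' a (lt_max_of_lt_right ha)⟩⟩
  | inputS k P ih =>
    obtain ⟨β, α, h0, h⟩ := h
    obtain ⟨N, hN⟩ := ih h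
    exact ⟨N, fun Γ' hΓ' => ⟨β, α, h0, hN Γ' hΓ'⟩⟩
  | deleg k k' P ih =>
    obtain ⟨hne, β, α, h0, hup, h⟩ := h
    obtain ⟨N, hN⟩ := ih h
    exact ⟨N, fun Γ' hΓ' => ⟨hne, β, α, h0, hup, hN Γ' hΓ'⟩⟩
  | branch k I hI P ih =>
    obtain ⟨α, h0, h⟩ := h
    choose N hN using fun l => ih l (h l)
    exact ⟨Finset.univ.sup N, fun Γ' hΓ' => ⟨α, h0, fun l => hN l Γ' fun a ha =>
      hΓ' a (ha.trans_le (Finset.le_sup (Finset.mem_univ l)))⟩⟩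
  | select k l P ih =>
    obtain ⟨I, hI, α, hj, h0, h⟩ := h
    obtain ⟨N, hN⟩ := ih h
    exact ⟨N, fun Γ' hΓ' => ⟨I, hI, α, hj, h0, hN Γ' hΓ'⟩⟩
  | ifte e P Q ihP ihQ =>
    obtain ⟨N₀, h0⟩ := h.1.exists_bound
    obtain ⟨N₁, h1⟩ := ihP h.2.1
    obtain ⟨N₂, h2⟩ := ihQ h.2.2
    exact ⟨max N₀ (max N₁ N₂), fun Γ' hΓ' => ⟨h0 Γ' fun a ha => hΓ' a (lt_max_of_lt_left ha),
      h1 Γ' fun a ha => hΓ' a (lt_max_of_lt_right (lt_max_of_lt_left ha)),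
      h2 Γ' fun a ha => hΓ' a (lt_max_of_lt_right (lt_max_of_lt_right ha))⟩⟩

/-- `Γ` on the names below `N`, followed by service channels with types `G 0, G 1, …`. -/
def extendEnv (N : ℕ) (Γ : ServEnv D) (G : ℕ → SType D) : ServEnv D :=
  fun a => if a < N then Γ a else some (.chan (G (a - N)))

theorem extendEnv_service {N : ℕ} {Γ : ServEnv D} {G : ℕ → SType D} (h : ServiceEnv Γ) :
    ServiceEnv (extendEnv N Γ G) := by
  intro a S ha
  unfold extendEnv at ha
  split_ifs at ha with hN
  · exact h a S ha
  · exact ⟨_, (Option.some.inj ha).symm⟩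

theorem extendEnv_of_lt {N : ℕ} {Γ : ServEnv D} {G : ℕ → SType D} {a : ℕ} (h : a < N) :
    extendEnv N Γ G a = Γ a := if_pos h

theorem extendEnv_add {N : ℕ} {Γ : ServEnv D} {G : ℕ → SType D} (i : ℕ) :
    extendEnv N Γ G (N + i) = some (.chan (G i)) := by
  simp [extendEnv]

/-- The process that delegates the channel `k` to a client of the service `c`. -/
def forward (c k : ℕ) (P : Proc D) : Proc D := .request (.name c) (.deleg 0 (k + 1) P)

/-- A fresh service of type `⟨?α.end⟩` takes a channel of any type `α` off the hands of its client,
so no process implementing `α` has to be built. -/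
theorem ty_forward {Γ : ServEnv D} {Δ : SessEnv D} {c k : ℕ} {α : SType D} {P : Proc D}
    (hc : Γ c = some (.chan (.inpS α .fin))) (hk : Δ k = some (.ty α))
    (hP : Ty Γ P (cons (some (.ty .fin)) (Function.update Δ k none))) :
    Ty Γ (forward c k P) Δ := by
  refine ⟨_, .name hc, (Nat.succ_ne_zero k).symm, α, .fin, rfl, Or.inl hk.symm, ?_⟩
  refine hP.up ?_
  rintro (j | j)
  · exact .refl _
  · rw [Function.update_of_ne (Nat.succ_ne_zero j)]
    by_cases hj : j = k
    · subst hj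
      rw [Function.update_self]
      change Up (Function.update Δ j none j) none
      rw [Function.update_self]
      exact .refl _
    · rw [Function.update_of_ne (fun h => hj (Nat.succ_injective h))]
      change Up (Function.update Δ k none j) (Δ j)
      rw [Function.update_of_ne hj]
      exact .refl _

theorem ty_forward_nil {Γ : ServEnv D} {Δ : SessEnv D} {c k : ℕ} {α : SType D}
    (hc : Γ c = some (.chan (.inpS α .fin))) (hk : Δ k = some (.ty α))
    (hi : ∀ j, j ≠ k → Idle (Δ j)) : Ty Γ (forward c k .nil) Δ := by
  refine ty_forward hc hk ?_
  rintro (j | j)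
  · exact Or.inr (Or.inl rfl)
  · change Idle (Function.update Δ k none j)
    by_cases hj : j = k
    · subst hj
      rw [Function.update_self]
      exact idle_none
    · rw [Function.update_of_ne hj]
      exact hi j hj

theorem nonempty_carrier (b : Basic D) : Nonempty (Carrier D b) := by
  cases b with
  | none => exact ⟨true⟩
  | some s => exact D.inhabited s

/-- The session typing with the single entry `k : u`. -/
def singleEnv (k : ℕ) (u : Use D) : SessEnv D := Function.update (fun _ => none) k (some u)

theorem singleEnv_idle {k j : ℕ} {u : Use D} (h : j ≠ k) : Idle (singleEnv k u j) := by
  rw [singleEnv, Function.update_of_ne h]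
  exact idle_none

theorem update_singleEnv (k : ℕ) (u v : Use D) :
    Function.update (singleEnv k u) k (some v) = singleEnv k v := Function.update_idem ..

theorem singleEnv_self (k : ℕ) (u : Use D) : singleEnv k u k = some u := Function.update_self ..

/-- Every active session type is the type of the subject of a session prefix; at most one further
channel is needed. -/
theorem exists_session_prefix {α : SType D} (hα : α ≠ .fin) (Γ : ServEnv D) (N : ℕ) {j j' : ℕ}
    (hj : j' ≠ j) : ∃ (G : ℕ → SType D) (Q : Proc D) (Δ : SessEnv D),
      Ty (extendEnv N Γ G) Q Δ ∧ Δ j = some (.ty α) ∧ (∀ k, k ≠ j → k ≠ j' → Δ k = none) ∧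
      subject Q = some j ∧ HAcyclic Q ∧ weight Q = 1 := by
  have hs : ∀ (Δ : SessEnv D), Δ = singleEnv j (.ty α) →
      Δ j = some (.ty α) ∧ ∀ k, k ≠ j → k ≠ j' → Δ k = none := by
    rintro Δ rfl
    exact ⟨singleEnv_self .., fun k h _ => Function.update_of_ne h ..⟩
  have hfw : ∀ (Γ : ServEnv D) (c : ℕ) (u : Use D) (β : SType D),
      Γ c = some (.chan (.inpS β .fin)) →
      Ty Γ (forward c j .nil) (Function.update (singleEnv j u) j (some (.ty β))) := by
    intro Γ c u β hc
    rw [update_singleEnv]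
    exact ty_forward_nil hc (singleEnv_self ..) fun i hi => singleEnv_idle hi
  cases α with
  | inpB b α =>
    -- The input binds a name, so under it the fresh service `N` has index `N + 1`.
    exact ⟨fun _ => .inpS α .fin, .input j (forward (N + 1) j .nil), _,
      ⟨.basic b, α, singleEnv_self .., hfw _ _ _ _
        (extendEnv_add (N := N) (Γ := Γ) (G := fun _ => .inpS α .fin) 0)⟩, (hs _ rfl).1,
      (hs _ rfl).2,
      rfl, trivial, rfl⟩
  | inpC β α =>
    exact ⟨fun _ => .inpS α .fin, .input j (forward (N + 1) j .nil), _,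
      ⟨.chan β, α, singleEnv_self .., hfw _ _ _ _
        (extendEnv_add (N := N) (Γ := Γ) (G := fun _ => .inpS α .fin) 0)⟩, (hs _ rfl).1,
      (hs _ rfl).2,
      rfl, trivial, rfl⟩
  | outB b α =>
    obtain ⟨c⟩ := nonempty_carrier b
    exact ⟨fun _ => .inpS α .fin, .output j (.val (.const b c)) (forward N j .nil), _,
      ⟨.basic b, α, singleEnv_self .., .val (.const b c), hfw _ _ _ _ (extendEnv_add 0)⟩,
      (hs _ rfl).1, (hs _ rfl).2, rfl, trivial, rfl⟩
  | outC β α =>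
    -- Two fresh names: `N`, of type `⟨β⟩`, is the value sent, and `N + 1` takes the rest of the
    -- session.
    exact ⟨cons β fun _ => .inpS α .fin, .output j (.val (.name N)) (forward (N + 1) j .nil), _,
      ⟨.chan β, α, singleEnv_self .., .val (.name (extendEnv_add 0)),
        hfw _ _ _ _ (extendEnv_add 1)⟩, (hs _ rfl).1, (hs _ rfl).2, rfl, trivial, rfl⟩
  | inpS β α =>
    -- Both the subject and the received channel are forwarded. Under the reception the subject is
    -- `j + 1`; under the first request the received channel is `1`.
    refine ⟨cons (.inpS α .fin) fun _ => .inpS β .fin,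
      .inputS j (forward N (j + 1) (forward (N + 1) 1 .nil)), _,
      ⟨β, α, singleEnv_self .., ty_forward (α := α) (extendEnv_add 0) ?_ (ty_forward_nil (α := β)
        (extendEnv_add 1) ?_ ?_)⟩, (hs _ rfl).1, (hs _ rfl).2, rfl, trivial, rfl⟩
    · exact Function.update_self ..
    · change Function.update _ (j + 1) none 0 = _
      rw [Function.update_of_ne (Nat.succ_ne_zero j).symm]
      rfl
    · rintro (i | i) hi
      · exact Or.inr (Or.inl rfl)
      · change Idle ((Function.update _ (j + 1) none : SessEnv D) i)
        by_cases hij : i = j + 1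
        · rw [hij, Function.update_self]
          exact idle_none
        · rw [Function.update_of_ne hij]
          rcases i with - | i
          · exact absurd rfl hi
          · rw [update_singleEnv]
            exact singleEnv_idle fun h => hij (congrArg Nat.succ h)
  | outS β α =>
    -- Here the additional channel `j'` is needed, as the object of type `β` that is delegated.
    refine ⟨fun _ => .inpS α .fin, .deleg j j' (forward N j .nil),
      Function.update (singleEnv j (.ty (.outS β α))) j' (some (.ty β)),
      ⟨hj.symm, β, α, ?_, ?_, ?_⟩, ?_, ?_, rfl, trivial, rfl⟩
    · rw [Function.update_of_ne hj.symm]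
      exact singleEnv_self ..
    · rw [Function.update_self]
      exact .refl _
    · rw [Function.update_idem]
      refine ty_forward_nil (extendEnv_add 0) (Function.update_self ..) fun i hi => ?_
      rw [Function.update_of_ne hi]
      by_cases hij : i = j'
      · rw [hij, Function.update_self]
        exact idle_none
      · rw [Function.update_of_ne hij]
        exact singleEnv_idle hi
    · rw [Function.update_of_ne hj.symm]
      exact singleEnv_self ..
    · intro k hk hk'
      rw [Function.update_of_ne hk']
      exact (hs _ rfl).2 k hk hk'
  | bra I hI α =>
    -- Every label `l` gets its own fresh service `N + l`, since the continuations have different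
    -- types; the default `.fin` is never called upon.
    refine ⟨fun i => if h : i ∈ I then .inpS (α ⟨i, h⟩) .fin else .fin,
      .branch j I hI (fun l => forward (N + l.1) j .nil), _,
      ⟨α, singleEnv_self .., fun l => hfw _ _ _ _ ?_⟩, (hs _ rfl).1, (hs _ rfl).2, rfl,
      fun _ => trivial, rfl⟩
    rw [extendEnv_add]
    simp [l.2]
  | sel I hI α =>
    obtain ⟨l, hl⟩ := hI
    exact ⟨fun _ => .inpS (α ⟨l, hl⟩) .fin, .select j l (forward N j .nil), _,
      ⟨I, _, α, hl, singleEnv_self .., hfw _ _ _ _ (extendEnv_add 0)⟩, (hs _ rfl).1, (hs _ rfl).2,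
      rfl, trivial, rfl⟩
  | fin => exact absurd rfl hα

/-- A partner of a top-level prefix is a partner of the whole process. -/
theorem exists_red_par {P M γ M₀ Q X : Proc D} {n : ℕ} (hP : Congr P (resN n M))
    (hM : Congr M (.par γ M₀)) (h : Red (.par γ (Q.renS (· + n))) X) :
    ∃ R, Red (.par P Q) R := by
  have h1 : Congr (.par M (Q.renS (· + n))) (.par (.par γ (Q.renS (· + n))) M₀) :=
    (hM.par (.refl _)).trans ((Congr.par_assoc _ _ _).symm.trans
      (((Congr.refl γ).par (.par_comm _ _)).trans (.par_assoc _ _ _)))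
  exact ⟨_, .congr_left ((hP.par (.refl Q)).trans (Congr.resN_par n M Q))
    ((Red.congr_left h1 (h.par M₀)).resN n)⟩

/-- `P` and `Q` in parallel are well-typed and have no cycles, `Q` is irreducible, and they
reduce. -/
def Partner (P Q : Proc D) : Prop :=
  (¬ ∃ Q', Red Q Q') ∧ (∃ Γ Δ, ServiceEnv Γ ∧ Ty Γ (.par P Q) Δ) ∧ HAcyclic (.par P Q) ∧
    ∃ R, Red (.par P Q) R

theorem not_red_of_weight {P : Proc D} (h : weight P ≤ 1) : ¬ ∃ Q, Red P Q := by
  rintro ⟨Q, hQ⟩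
  have := hQ.two_le_weight
  omega

theorem Ty.par_of_fsc_empty {Γ : ServEnv D} {P Q : Proc D} {Δ Δ' : SessEnv D} (hP : Ty Γ P Δ)
    (hQ : Ty Γ Q Δ') (h : Q.fsc = ∅) : Ty Γ (.par P Q) Δ := by
  refine ⟨Δ, fun _ => none, hP, hQ.transfer (fun k hk => ?_) fun _ _ => idle_none,
    fun k => .none_right _⟩
  rw [h] at hk
  exact hk.elim

/-- The partner of a service or a request. -/
theorem exists_partner_of_opener {Γ : ServEnv D} (hΓ : ServiceEnv Γ) {P M γ M₀ : Proc D}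
    {Δ Δ' : SessEnv D} {n : ℕ} (h : Ty Γ P Δ) (hA : HAcyclic P) (hP : Congr P (resN n M))
    (hM : Congr M (.par γ M₀)) (hγ : Ty Γ γ Δ') (ho : IsSessionOpener γ) : ∃ Q, Partner P Q := by
  obtain ⟨N₁, hN₁⟩ := h.exists_bound
  obtain ⟨a, α, ha, hQ⟩ : ∃ (a : Val D) (α : SType D), ValTyped Γ a (.chan α) ∧
      ((∃ A, γ = .request a A) ∨ ∃ A, γ = .serv a A ∨ γ = .repServ a A) := by
    cases γ with
    | repServ a A => exact ⟨a, hγ.choose, hγ.choose_spec.1, Or.inr ⟨A, Or.inr rfl⟩⟩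
    | serv a A => exact ⟨a, hγ.choose, hγ.choose_spec.1, Or.inr ⟨A, Or.inl rfl⟩⟩
    | request a A => exact ⟨a, hγ.choose, hγ.choose_spec.1, Or.inl ⟨A, rfl⟩⟩
    | _ => exact ho.elim
  obtain ⟨N₂, hN₂⟩ := ha.exists_bound
  -- A partner without free session channels adds an isolated node and is unaffected by the shift
  -- past the restrictions of `P`.
  have key : ∀ Q : Proc D, (∀ ρ, Q.renS ρ = Q) → Q.fsc = ∅ → weight Q = 1 → HAcyclic Q →
      (∃ G Δ'', Ty (extendEnv (max N₁ N₂) Γ G) Q Δ'') → (∃ X, Red (.par γ Q) X) → Partner P Q := by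
    rintro Q hr hf hw hQA ⟨G, Δ'', hQ⟩ ⟨X, hX⟩
    have hPQ : Ty (extendEnv (max N₁ N₂) Γ G) (.par P Q) Δ :=
      (hN₁ _ fun a ha => extendEnv_of_lt (lt_max_of_lt_left ha)).par_of_fsc_empty hQ hf
    refine ⟨not_red_of_weight hw.le, ⟨_, _, extendEnv_service hΓ, hPQ⟩,
      hA.par hQA hPQ fun k _ _ hk => ?_, exists_red_par hP hM ((hr _).symm ▸ hX)⟩
    rw [hf] at hk
    exact hk.elim
  have hG : ∀ β : SType D, extendEnv (max N₁ N₂) Γ (fun _ => .inpS β .fin) (max N₁ N₂) =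
      some (.chan (.inpS β .fin)) := fun β => extendEnv_add 0
  have ha' : ∀ G, ValTyped (extendEnv (max N₁ N₂) Γ G) a (.chan α) := fun G =>
    hN₂ _ fun b hb => extendEnv_of_lt (lt_max_of_lt_right hb)
  have hf : {k | k + 1 ∈ (forward (max N₁ N₂) 0 nil : Proc D).fsc} = ∅ := by
    ext k
    simp [forward, fsc]
  rcases hQ with ⟨A, rfl⟩ | hQ
  · refine ⟨.serv a (forward (max N₁ N₂) 0 .nil), key _ (fun _ => rfl) hf rfl trivial
      ⟨fun _ => .inpS α .fin, fun _ => none, α, ha' _, fun _ => idle_none,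
        ty_forward_nil (hG α) rfl ?_⟩ ⟨_, .congr_left (.par_comm _ _) (.init _ _ _)⟩⟩
    rintro (j | j) hj
    · exact absurd rfl hj
    · exact idle_none
  · refine ⟨.request a (forward (max N₁ N₂) 0 .nil), key _ (fun _ => rfl) hf rfl trivial
      ⟨fun _ => .inpS α.dual .fin, fun _ => none, α, ha' _,
        ty_forward_nil (hG α.dual) rfl ?_⟩ ?_⟩
    · rintro (j | j) hj
      · exact absurd rfl hj
      · exact idle_none
    · obtain ⟨A, rfl | rfl⟩ := hQ
      · exact ⟨_, .init _ _ _⟩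
      · exact ⟨_, .rinit _ _ _⟩

/-- The partner of a session prefix whose subject has a session type. -/
theorem exists_partner_of_subject {Γ : ServEnv D} (hΓ : ServiceEnv Γ) {P M γ M₀ : Proc D}
    {Δ Δ' : SessEnv D} {n j : ℕ} {α : SType D} (h : Ty Γ P Δ) (hA : HAcyclic P)
    (hP : Congr P (resN n M)) (hM : Congr M (.par γ M₀)) (hγ : Ty Γ γ Δ')
    (hs : subject γ = some (j + n)) (hα : α ≠ .fin) (hj' : Δ' (j + n) = some (.ty α))
    (hj : Δ j = some (.ty α)) : ∃ Q, Partner P Q := by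
  obtain ⟨N, hN⟩ := h.restrictEnv.exists_bound
  have hjP : j ∈ P.fsc := by
    by_contra hn
    exact not_idle_ty hα (hj ▸ h.idle hn)
  -- The partner may have to delegate a channel. Taking one that `P` does not use leaves `j` as the
  -- only shared channel.
  obtain ⟨i, hi⟩ := P.finite_fsc.exists_notMem
  have hij : i ≠ j := by
    rintro rfl
    exact hi hjP
  obtain ⟨G, Q, ΔQ, hQ, hQj, hQn, hQs, hQA, hQw⟩ :=
    exists_session_prefix (SType.dual_ne_fin hα) Γ N hij
  have hfQ : ∀ k, k ∈ Q.fsc → k = j ∨ k = i := by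
    intro k hk
    by_contra hn
    push Not at hn
    exact hQ.ne_none hk (hQn k hn.1 hn.2)
  have hPQ : ∃ Δ'', Ty (extendEnv N Γ G) (.par P Q) Δ'' := by
    have hjoin : ∀ k, ∃ w, Joined (restrictEnv P.fsc Δ k) (ΔQ k) w := by
      intro k
      by_cases hkj : k = j
      · subst hkj
        rw [restrictEnv, if_pos hjP, hj, hQj]
        exact ⟨_, .bot_ty⟩
      · by_cases hki : k = i
        · subst hki
          rw [restrictEnv, if_neg hi]
          exact ⟨_, .none_left _⟩
        · rw [hQn k hkj hki]
          exact ⟨_, .none_right _⟩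
    choose Δ'' hΔ'' using hjoin
    exact ⟨Δ'', _, _, hN _ fun a ha => extendEnv_of_lt ha, hQ, hΔ''⟩
  obtain ⟨Δ'', hPQ⟩ := hPQ
  have hshared : ∀ k, k ∈ P.fsc → k ∈ Q.fsc → k = j := by
    intro k hk hk'
    rcases hfQ k hk' with rfl | rfl
    · rfl
    · exact absurd hk hi
  have hshift : Ty (extendEnv N Γ G) (Q.renS (· + n))
      (fun k => if k < n then none else ΔQ (k - n)) := by
    refine hQ.renS (add_left_injective n).injOn ⟨fun k _ => ?_, fun k hk => ?_⟩
    · simpa using Up.refl _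
    · beta_reduce
      split_ifs with hkn
      · exact idle_none
      · refine hQ.idle fun hk' => hk ⟨k - n, hk', ?_⟩
        exact Nat.sub_add_cancel (not_lt.1 hkn)
  obtain ⟨X, hX⟩ : ∃ X, Red (.par γ (Q.renS (· + n))) X := by
    refine exists_red_of_dual hΓ (extendEnv_service (G := G) (N := N) hΓ) hγ hshift hs ?_ hj' ?_ ?_
    · rw [subject_renS, hQs]
      rfl
    · simpa using hQj
    · rw [fsc_renS]
      rintro _ hk ⟨k, hkQ, rfl⟩
      refine congrArg (· + n) (hshared k ?_ hkQ)
      rw [hP.fsc_eq, fsc_resN]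
      change k + n ∈ M.fsc
      rw [hM.fsc_eq]
      exact Or.inl hk
  exact ⟨Q, not_red_of_weight hQw.le, ⟨_, _, extendEnv_service hΓ, hPQ⟩,
    hA.par hQA hPQ fun k k' h1 h2 h3 h4 => (hshared k h1 h2).trans (hshared k' h3 h4).symm,
    exists_red_par hP hM hX⟩

/-- A live channel guarantees a top-level prefix, so the normal form reduces or offers. In the first
case inaction is a partner; in the second a prefix dual to the one offered. -/
theorem exists_partner {Γ : ServEnv D} (hΓ : ServiceEnv Γ) {P : Proc D} {Δ : SessEnv D}
    (h : Ty Γ P Δ) (hA : HAcyclic P) (hl : HasLive P) : ∃ Q, Partner P Q := by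
  obtain ⟨n, M, hM, hP⟩ := exists_normal_form P
  have hw : weight M ≠ 0 := by
    rw [← weight_resN n M, ← hP.weight_eq]
    exact fun h0 => not_liveOver_of_weight_eq_zero h0 _ hl
  have := nonempty_node_of_weight hw
  obtain ⟨Δ', hM', hΔ'⟩ := (hP.ty_iff.1 h).of_resN
  have hMA : HAcyclic M := (hAcyclic_resN n M).1 (hP.hAcyclic_iff.1 hA)
  rcases hM'.reduces_or_offers hΓ hM hMA with ⟨M', hr⟩ | ⟨γ, M₀, Δγ, hc, hγ, ho | ho⟩
  · have hPn : Congr (.par P .nil) P := .par_nil P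
    exact ⟨.nil, not_red_of_weight (Nat.zero_le 1), ⟨Γ, Δ, hΓ, hPn.ty_iff.2 h⟩,
      hPn.hAcyclic_iff.2 hA, _, .congr_left (hPn.trans hP) (hr.resN n)⟩
  · exact exists_partner_of_opener hΓ h hA hP hc hγ ho
  · obtain ⟨k, α, hs, hα, hk, hk'⟩ := ho
    obtain ⟨j, rfl, hj⟩ := hΔ' k α hk'
    exact exists_partner_of_subject hΓ h hA hP hc hγ hs hα hk hj

/-! ### Progress -/

theorem Ty.of_fill {Γ : ServEnv D} {E : RedCtx D} {P : Proc D} {Δ : SessEnv D}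
    (h : Ty Γ (E.fill P) Δ) : ∃ Δ', Ty Γ P Δ' := by
  induction E generalizing Δ with
  | hole => exact ⟨Δ, h⟩
  | par E Q ih =>
    obtain ⟨Δ₁, Δ₂, h1, -, -⟩ := h
    exact ih h1
  | res E ih => exact ih h

theorem HAcyclic.of_fill {E : RedCtx D} {P : Proc D} (h : HAcyclic (E.fill P)) : HAcyclic P := by
  induction E with
  | hole => exact h
  | par E Q ih => exact ih h.1
  | res E ih => exact ih h

/-- The invariant of progress. -/
def Safe (P : Proc D) : Prop := ∃ Γ Δ, ServiceEnv Γ ∧ Ty Γ P Δ ∧ HAcyclic P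

theorem Safe.red {P Q : Proc D} (h : Safe P) (hr : Red P Q) : Safe Q := by
  obtain ⟨Γ, Δ, hΓ, ht, hA⟩ := h
  exact ⟨Γ, Δ, hΓ, hr.ty ht, hr.hAcyclic ht hA⟩

theorem Safe.reds {P Q : Proc D} (h : Safe P) (hr : Relation.ReflTransGen Red P Q) : Safe Q := by
  induction hr with
  | refl => exact h
  | tail _ hr ih => exact ih.red hr

/-- This is the coinduction step. The composition with the partner is itself safe, so its reduct
falls back under the invariant. -/
theorem Safe.progressClause {P : Proc D} (h : Safe P) : ProgressClause Safe P := by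
  intro P' hr E P'' hc hl
  obtain ⟨Γ, Δ, hΓ, ht, hA⟩ := h.reds hr
  obtain ⟨Δ', ht'⟩ := (hc.ty_iff.1 ht).of_fill
  obtain ⟨Q, hQ, ⟨Γ', Δ'', hΓ', hPQ⟩, hPQA, R, hR⟩ :=
    exists_partner hΓ ht' (hc.hAcyclic_iff.1 hA).of_fill hl
  exact ⟨Q, hQ, wellTyped_iff.2 ⟨Γ', Δ'', hΓ', hPQ⟩, R, hR,
    Safe.red ⟨Γ', Δ'', hΓ', hPQ, hPQA⟩ hR⟩

end Sessions

theorem mainTheorem1 (D : Sessions.DataAlgebra) (P : Sessions.Proc D)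
    (hty : Sessions.WellTyped P) (htr : Sessions.Transparent P) :
    Sessions.HasProgress P := by
  obtain ⟨Γ, Δ, hΓ, h⟩ := Sessions.wellTyped_iff.1 hty
  exact ⟨Sessions.Safe, fun R hR => hR.progressClause,
    Γ, Δ, hΓ, h, Sessions.transparent_iff.1 htr⟩
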